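/- **Notation.** For $0<r\le 1$ let $C_r=\{|\lambda|=r\}$, $I_r=\{|\lambda|<r\}$, $A_r=\{r<|\lambda|<1/r\}$, $\sigma_3=\mathrm{diag}[1,-1]$. A matrix function $g$ is *twisted* if $\sigma_3\,g(-\lambda)\,\sigma_3^{-1}=g(\lambda)$. A loop is a continuous map $C_r\to \mathbf{SL}(2,\mathbb C)$ (this contains the smooth, $H^s$ ($s>1/2$) and Wiener loops). $\Lambda_r^+\mathbf{SL}_\sigma$ is the set of twisted loops on $C_r$ that extend analytically to $I_r$; $\Lambda_r\mathbf{SU}_\sigma$ is the set of twisted loops on $C_r$ that extend analytically to $A_r$ and are $\mathbf{SU}(2)$-valued on $S^1$; $\Lambda_{\mathbb C^*}\mathbf{SU}_\sigma=\bigcap_{0<r\le1}\Lambda_r\mathbf{SU}_\sigma$, whose elements are holomorphic on $\mathbb C^*$. $\mathbf U(1)$ denotes the constant matrices $\mathrm{diag}[u,u^{-1}]$, $|u|=1$. Let $M$ be a connected Riemann surface with universal cover $\widetilde M$, and $\tau$ a deck transformation. A *normalized extended unitary frame* with base point $\tilde z_0\in\widetilde M$ is a smooth map $F:\widetilde M\to\Lambda_{\mathbb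 C^*}\mathbf{SU}_\sigma$ with $F(\tilde z_0)=\mathrm{Id}$ and $$F^{-1}dF=\lambda^{-1}\alpha'+\alpha_0+\lambda\,\alpha'',$$ where $\alpha',\alpha''$ are off-diagonal $(1,0)$- respectively $(0,1)$-forms, $\alpha_0$ is a diagonal trace-free $1$-form, and all three are independent of $\lambda$. For $h\in\Lambda_r^+\mathbf{SL}_\sigma$ the *dressed frame* $\hat F=h\#F$ is the smooth map $\hat F:\widetilde M\to\Lambda_r\mathbf{SU}_\sigma$ with $\hat F(\tilde z_0)=\mathrm{Id}$ and $hF=\hat F B$ pointwise on $C_r$ for some $B:\widetilde M\to\Lambda_r^+\mathbf{SL}_\sigma$. A *monodromy* of $F$ (or of $\hat F$) with respect to $\tau$ is a loop $\chi\in\Lambda_{\mathbb C^*}\mathbf{SU}_\sigma$ with $F\circ\tau=\chi\,F\,k$ for some smooth $k:\widetilde M\to\mathbf U(1)$. For $\chi\in\Lambda_{\mathbb C^*}\mathbf{SU}_\sigma$ let $\mathbb S(\chi)\subset\mathbb C^*$ be $\mathbb C^*$ cut radially from each root of odd order of $(\mathrm{tr}\,\chi)^2-4$ inside the unit circle to $0$,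 and from each root of odd order outside the unit circle to $\infty$ (there are none on $S^1$). **Theorem.** Let $0<s<r\le1$. Let $F$ be a normalized extended unitary frame on $\widetilde M$ with a monodromy $\chi$ with respect to $\tau$ whose trace is not constant in $\lambda$, and put $\mathbb S=\mathbb S(\chi)$. Let $h\in\Lambda_r^+\mathbf{SL}_\sigma$ be such that $h\chi h^{-1}$ is meromorphic on $\mathbb S\cap A_s$, i.e. there is a meromorphic matrix function on $\mathbb S\cap A_s$ that agrees with $h\chi h^{-1}$ on $\{\lambda\in\mathbb S: s<|\lambda|\le r\}$. Suppose that $\hat F=h\#F$ has a monodromy $\hat\chi$ with respect to $\tau$, and put $\hat{\mathbb S}=\mathbb S(\hat\chi)$. Then $D=\mathbb S\cap\hat{\mathbb S}\cap A_s$ is a connected open set containing $S^1$, and there are $l\in(s,r]$ and matrix functions $\mathcal M$, $\mathcal C$ such that 1. $h=\mathcal M\,\mathcal C$ on the possibly segmented circle $C_l\cap\mathbb S\cap\hat{\mathbb S}$, on which $\mathcal M$ has no poles; 2. $\mathcal C$ is defined on $C_l\cap\mathbb S\cap\hat{\mathbb S}$, is twisted and $\mathbf{SL}(2,\mathbb C)$-valued,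 and $[\mathcal C,\chi]=0$ there; 3. $\mathcal M$ is meromorphic on $D$ and twisted $\mathbf{SU}(2)$-valued: wherever the values involved are finite, $\det\mathcal M=1$, $\sigma_3\mathcal M(-\lambda)\sigma_3^{-1}=\mathcal M(\lambda)$ and $\overline{\mathcal M(1/\bar\lambda)}^{\,t}=\mathcal M(\lambda)^{-1}$; on $S^1$, $\mathcal M$ has no poles and takes values in $\mathbf{SU}(2)$. -/

import Mathlib

open scoped Manifold ContDiff ComplexConjugate Matrix

noncomputable section

namespace LoopDressing

/-- Complex `2 × 2` matrices. -/
abbrev Mat2 : Type := Matrix (Fin 2) (Fin 2) ℂ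

/-- The circle `C_r = {|ζ| = r}`. -/
def circle (r : ℝ) : Set ℂ := {ζ | ‖ζ‖ = r}

/-- The open annulus `A_r = {r < |ζ| < 1/r}` about the unit circle. -/
def annulus (r : ℝ) : Set ℂ := {ζ | r < ‖ζ‖ ∧ ‖ζ‖ < 1 / r}

/-- `σ₃ = diag[1, -1]` (note that it is its own inverse). -/
def sigma3 : Mat2 := !![1, 0; 0, -1]

/-- `g` is twisted on the set `U`: `σ₃ g(-ζ) σ₃⁻¹ = g(ζ)` for `ζ ∈ U`. -/
def TwistedOn (g : ℂ → Mat2) (U : Set ℂ) : Prop :=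
  ∀ ζ ∈ U, sigma3 * g (-ζ) * sigma3 = g ζ

/-- Membership in the group of positive twisted loops `Λ_r^+ SL_σ`: a twisted loop
`C_r → SL(2, ℂ)` that extends analytically to the disc `{|ζ| < r}`. The function `g` stands for
the loop together with its extension, so that it is relevant on the closed disc only. Loops are
continuous on `C_r`; this contains the smooth loops, the loops of Sobolev class `H^s`, `s > 1/2`,
and the loops of (weighted) Wiener class. -/
structure IsPositiveLoop (r : ℝ) (g : ℂ → Mat2) : Prop where
  continuousOn : ContinuousOn g (Metric.closedBall 0 r)
  differentiableOn : ∀ i j, DifferentiableOn ℂ (fun ζ => g ζ i j) (Metric.ball 0 r)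
  det_eq_one : ∀ ζ ∈ Metric.closedBall (0 : ℂ) r, (g ζ).det = 1
  twisted : TwistedOn g (Metric.closedBall 0 r)

/-- Membership in the group of unitary twisted loops `Λ_r SU_σ`: a twisted loop
`C_r → SL(2, ℂ)` that extends analytically to the annulus `A_r` and has values in `SU(2)` on the
unit circle. The function `g` stands for the loop together with its extension, so that it is
relevant on `C_r ∪ A_r ∪ S¹` only. -/
structure IsUnitaryLoop (r : ℝ) (g : ℂ → Mat2) : Prop where
  continuousOn : ContinuousOn g (circle r ∪ annulus r)
  differentiableOn : ∀ i j, DifferentiableOn ℂ (fun ζ => g ζ i j) (annulus r)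
  det_eq_one : ∀ ζ ∈ circle r ∪ annulus r, (g ζ).det = 1
  twisted : TwistedOn g (circle r ∪ annulus r)
  unitary : ∀ ζ ∈ circle 1, g ζ ∈ Matrix.specialUnitaryGroup (Fin 2) ℂ

/-- Membership in `Λ_{ℂ*} SU_σ`, the intersection of all `Λ_r SU_σ` with `0 < r ≤ 1`. -/
def IsUnitaryLoopStar (g : ℂ → Mat2) : Prop :=
  ∀ r : ℝ, 0 < r → r ≤ 1 → IsUnitaryLoop r g

section Frames

variable {X : Type*} [TopologicalSpace X] [ChartedSpace ℂ X]

/-- A matrix valued function on a Riemann surface is smooth (in the real sense). -/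
def SmoothMat (G : X → Mat2) : Prop :=
  ∀ i j, ContMDiff 𝓘(ℝ, ℂ) 𝓘(ℝ, ℂ) ∞ (fun z => G z i j)

/-- The (real) differential of a matrix valued function at `z`, applied to the tangent vector
with complex coordinate `v` in the holomorphic chart at `z`. -/
def matDeriv (G : X → Mat2) (z : X) (v : ℂ) : Mat2 :=
  Matrix.of fun i j =>
    (mfderiv 𝓘(ℝ, ℂ) 𝓘(ℝ, ℂ) (fun y => G y i j) z : ℂ →L[ℝ] ℂ) v

/-- The extended unitary frames: maps `F` from the Riemann surface `X` to `Λ_{ℂ*} SU_σ`, smooth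
in `z ∈ X`, with Maurer--Cartan form
`F⁻¹ dF = ζ⁻¹ α' + α₀ + ζ α''`, where `α' = a dz` is an off-diagonal `(1,0)`-form,
`α'' = b dz̄` is an off-diagonal `(0,1)`-form, and the form `α₀` is diagonal and trace free.
All three do not depend on `ζ`. -/
structure IsExtendedFrame (F : X → ℂ → Mat2) : Prop where
  loop : ∀ z, IsUnitaryLoopStar (F z)
  smooth : ∀ ζ : ℂ, ζ ≠ 0 → SmoothMat fun z => F z ζ
  maurerCartan : ∃ (a b : X → Mat2) (α₀ : X → ℂ → Mat2),
    (∀ z i, a z i i = 0) ∧ (∀ z i, b z i i = 0) ∧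
    (∀ z v i j, i ≠ j → α₀ z v i j = 0) ∧ (∀ z v, (α₀ z v).trace = 0) ∧
    ∀ (z : X) (ζ : ℂ), ζ ≠ 0 → ∀ v : ℂ,
      (F z ζ)⁻¹ * matDeriv (fun y => F y ζ) z v
        = (ζ⁻¹ * v) • a z + α₀ z v + (ζ * conj v) • b z

/-- The extended unitary frames normalized at the base point `z₀`. -/
structure IsNormalizedFrame (F : X → ℂ → Mat2) (z₀ : X) : Prop extends IsExtendedFrame F where
  base : ∀ ζ : ℂ, ζ ≠ 0 → F z₀ ζ = 1

/-- `F'` is the dressed frame `h # F`: a smooth map `F' : X → Λ_r SU_σ` with `F'(z₀) = Id` such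
that `h F = F' B` is a pointwise Iwasawa decomposition on `C_r`, i.e. `B` takes values in
`Λ_r^+ SL_σ`. (The smoothness of `B = F'⁻¹ h F` in `z` is automatic.) -/
structure IsDressedFrame (r : ℝ) (h : ℂ → Mat2) (F : X → ℂ → Mat2) (z₀ : X)
    (F' : X → ℂ → Mat2) : Prop where
  loop : ∀ z, IsUnitaryLoop r (F' z)
  smooth : ∀ ζ ∈ circle r, SmoothMat fun z => F' z ζ
  base : ∀ ζ ∈ circle r, F' z₀ ζ = 1
  iwasawa : ∃ B : X → ℂ → Mat2, (∀ z, IsPositiveLoop r (B z)) ∧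
    ∀ z, ∀ ζ ∈ circle r, h ζ * F z ζ = F' z ζ * B z ζ

/-- The subgroup `U(1) = {diag[u, u⁻¹] : |u| = 1}` of `SU(2)`. -/
def IsU1 (k : Mat2) : Prop := ∃ u : ℂ, ‖u‖ = 1 ∧ k = !![u, 0; 0, u⁻¹]

/-- `χ ∈ Λ_{ℂ*} SU_σ` is a monodromy of `F` with respect to `τ`: there is a smooth map
`k : X → U(1)` with `τ^* F = χ F k` as maps into the loops on `C_r`. -/
def IsMonodromy (r : ℝ) (τ : X → X) (F : X → ℂ → Mat2) (χ : ℂ → Mat2) : Prop :=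
  IsUnitaryLoopStar χ ∧
    ∃ k : X → Mat2, SmoothMat k ∧ (∀ z, IsU1 (k z)) ∧
      ∀ z, ∀ ζ ∈ circle r, F (τ z) ζ = χ ζ * F z ζ * k z

end Frames

/-- The roots of odd order of `(tr χ)² - 4` in `ℂ*`, i.e. the branch points of the eigenvalues
of `χ`. (If the function vanishes identically, then its order is infinite, and no point is a
branch point.) -/
def branchPoints (χ : ℂ → Mat2) : Set ℂ :=
  {α | α ≠ 0 ∧ ∃ n : ℕ, Odd n ∧ analyticOrderAt (fun ζ => (χ ζ).trace ^ 2 - 4) α = n}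

/-- The cut set `𝕊` of `χ`: the plane `ℂ*`, cut radially from every branch point inside the unit
circle to `0`, and from every branch point outside the unit circle to `∞`. (The eigenvalues of a
loop in `Λ_{ℂ*} SU_σ` have no branch points on the unit circle.) -/
def cutPlane (χ : ℂ → Mat2) : Set ℂ :=
  {ζ | ζ ≠ 0 ∧ ∀ α ∈ branchPoints χ,
    (‖α‖ < 1 → ∀ t : ℝ, 0 ≤ t → t ≤ 1 → ζ ≠ t * α) ∧
    (1 < ‖α‖ → ∀ t : ℝ, 1 ≤ t → ζ ≠ t * α)}

/-- All entries of `M` are meromorphic on `U`. -/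
def MatMeromorphicOn (M : ℂ → Mat2) (U : Set ℂ) : Prop :=
  ∀ i j, MeromorphicOn (fun ζ => M ζ i j) U

/-- All entries of `M` are analytic at `ζ`. -/
def MatAnalyticAt (M : ℂ → Mat2) (ζ : ℂ) : Prop :=
  ∀ i j, AnalyticAt ℂ (fun w => M w i j) ζ

/-- `M` is twisted `SU(2)`-valued and meromorphic on `U ⊇ S¹`: it is meromorphic on `U`, and there
(at the points where the values involved are finite) `det M = 1`, `σ M = M` and `M^* = M⁻¹`, where
`M^*(ζ)` is the conjugate transpose of `M(1/ζ̄)`; on the unit circle, `M` has no poles and takes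
its values in `SU(2)`. -/
structure IsTwistedSUMeromorphicOn (M : ℂ → Mat2) (U : Set ℂ) : Prop where
  meromorphicOn : MatMeromorphicOn M U
  det_eq_one : ∀ ζ ∈ U, MatAnalyticAt M ζ → (M ζ).det = 1
  twisted : ∀ ζ ∈ U, MatAnalyticAt M ζ → MatAnalyticAt M (-ζ) →
    sigma3 * M (-ζ) * sigma3 = M ζ
  star_eq_inv : ∀ ζ ∈ U, MatAnalyticAt M ζ → MatAnalyticAt M (1 / conj ζ) →
    (M (1 / conj ζ))ᴴ = (M ζ)⁻¹
  analyticAt_circle : ∀ ζ ∈ circle 1, MatAnalyticAt M ζ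
  unitary : ∀ ζ ∈ circle 1, M ζ ∈ Matrix.specialUnitaryGroup (Fin 2) ℂ

end LoopDressing

end

open LoopDressing

/-! Write `A` and `B` for the trace free parts of `χ` and `χ'`. Comparing the two monodromies
through the dressing relation produces the loop `c = h⁻¹ χ'⁻¹ h χ`, for which `F⁻¹ c F` extends
holomorphically to the disc at every point of the surface (`exists_isotropy`). Such loops are rigid.
The circle integral of `N = F⁻¹ c F` vanishes along the surface, and so does that of its derivative,
the commutator of `N` with the Maurer–Cartan form; the residue at `0` shows that `N(0)` commutes
with the `(1,0)`-coefficient `[[0, p], [q, 0]]` (`StabBy.commute_zero`). Where `p q ≠ 0`, a trace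
free `N(0)` is a multiple of that matrix, and a nonzero one after division by a power of `ζ`. Hence
two nonzero trace free loops of this kind are never orthogonal for the trace form
(`StabBy.eq_zero_or_eq_zero`). A point with `p q ≠ 0` exists: otherwise `p` or `q` vanishes
identically, a constant diagonal gauge carries the whole dependence of `F` on `ζ`, and `tr χ` is
constant (`IsNormalizedFrame.exists_ne_zero`).

Let `a` be the trace free part of `c` and `a' = χ⁻¹ a χ`, which is again of this kind (look at the
point `τ z`). Since `tr (a + a')(a - a') = 0`, one has `a' = a` or `a' = -a`; the second with `a ≠
0` makes `tr χ` vanish along an arc, hence everywhere. So `c` commutes with `χ`, that is, `h χ h⁻¹`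
commutes with `χ'`, on `C_r` (`commute_on_circle`) and then on the punctured disc
(`commute_of_norm_le`).

Therefore `H = h A h⁻¹` and `B` are commuting trace free matrices, so `ρ B = det B · H` with `ρ =
-tr (H B) / 2` and `ρ² = det A · det B`. Meromorphy of `h χ h⁻¹` makes `ρ` meromorphic on `D`, and
then holomorphic because its square is (`exists_isTwistedPair`). It remains to find a twisted
unitary `M` with `M A M⁻¹ = ρ B / det B = H`; then `C = M⁻¹ h` commutes with `χ`.

For every `X`, the matrix `P = ρ² X - ρ B X A` intertwines `A` with `ρ B / det B`, and one of four
twisted unitary choices of `X` gives `det P ≢ 0`. This `P` has all the symmetries of `M` except `det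
= 1`: its determinant is an even function, nonnegative on the unit circle. The defect is repaired by
a right factor `α + β A` with eigenvalues `1/g` and `1/g^*`, where `g g^* = det P` is a
factorization of Fejér–Riesz type (`IsNonnegEven.exists_mul_reflect`). The coefficient `β` needs a
root `δ` of `det A`; it exists because the cuts remove the zeros of odd order off the circle, and
zeros on the circle have even order by positivity (`IsNonnegEven.exists_sqrt`). The root is even or
odd, and the symmetry of `g` under `ζ ↦ -ζ` is chosen accordingly so that `M` is twisted
(`IsTwistedPair.exists_conjugator`). Only finitely many points are exceptional, and `l` avoids their
moduli. -/

noncomputable section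

namespace LoopDressing

/-! ### Coordinates on the Riemann surface. -/

section Charts

variable {X : Type*} [TopologicalSpace X] [ChartedSpace ℂ X]

/-- The derivative at `y` of the coordinate change from the chart at `z` to the preferred chart
at the point with coordinate `y`. -/
def chartFactor (z : X) (y : ℂ) : ℂ :=
  deriv (chartAt ℂ ((chartAt ℂ z).symm y) ∘ (chartAt ℂ z).symm) y

theorem contDiffAt_chart_symm {f : X → ℂ} (hf : ContMDiff 𝓘(ℝ, ℂ) 𝓘(ℝ, ℂ) ∞ f) (z : X) :
    ContDiffAt ℝ ∞ (f ∘ (chartAt ℂ z).symm) (chartAt ℂ z z) := by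
  have := (contMDiffAt_iff.1 (hf z)).2
  simp only [extChartAt, OpenPartialHomeomorph.extend, modelWithCornersSelf_partialEquiv,
    PartialEquiv.trans_refl, OpenPartialHomeomorph.toFun_eq_coe,
    OpenPartialHomeomorph.coe_toPartialEquiv_symm, modelWithCornersSelf_coe, Set.range_id,
    contDiffWithinAt_univ, chartAt_self_eq, OpenPartialHomeomorph.refl_apply] at this
  exact this

theorem mfderiv_eq_fderiv_chart {f : X → ℂ} (hf : ContMDiff 𝓘(ℝ, ℂ) 𝓘(ℝ, ℂ) ∞ f) (z : X) :
    (mfderiv 𝓘(ℝ, ℂ) 𝓘(ℝ, ℂ) f z : ℂ →L[ℝ] ℂ)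
      = fderiv ℝ (f ∘ (chartAt ℂ z).symm) (chartAt ℂ z z) := by
  rw [((hf z).mdifferentiableAt (by simp)).mfderiv]
  simp
  rfl

theorem chart_comp_symm_eventuallyEq (f : X → ℂ) (z : X) {y : ℂ}
    (hy : y ∈ (chartAt ℂ z).target) :
    f ∘ (chartAt ℂ z).symm =ᶠ[nhds y]
      (f ∘ (chartAt ℂ ((chartAt ℂ z).symm y)).symm) ∘
        (chartAt ℂ ((chartAt ℂ z).symm y) ∘ (chartAt ℂ z).symm) := by
  set w := (chartAt ℂ z).symm y with hwdef
  have hw : w ∈ (chartAt ℂ w).source := mem_chart_source ℂ w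
  have hopen : (chartAt ℂ z).target ∩ (chartAt ℂ z).symm ⁻¹' (chartAt ℂ w).source ∈ nhds y :=
    ((chartAt ℂ z).isOpen_inter_preimage_symm (chartAt ℂ w).open_source).mem_nhds ⟨hy, hw⟩
  filter_upwards [hopen] with x hx
  simp [(chartAt ℂ w).left_inv hx.2]

variable [IsManifold 𝓘(ℂ) ω X]

theorem contDiffAt_coordChange (z w : X) {y : ℂ} (hy : y ∈ (chartAt ℂ z).target)
    (hw : (chartAt ℂ z).symm y ∈ (chartAt ℂ w).source) :
    ContDiffAt ℂ ω (chartAt ℂ w ∘ (chartAt ℂ z).symm) y := by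
  have := contDiffWithinAt_ext_coord_change (I := 𝓘(ℂ)) (n := ω) w z (y := y)
  simp at this
  exact this hy hw

/-- Consequently the vanishing of a coefficient of the Maurer–Cartan form does not depend on the
coordinate in which it is written. -/
theorem chartFactor_ne_zero (z : X) {y : ℂ} (hy : y ∈ (chartAt ℂ z).target) :
    chartFactor z y ≠ 0 := by
  set w := (chartAt ℂ z).symm y with hwdef
  have hw : w ∈ (chartAt ℂ w).source := mem_chart_source ℂ w
  have hwz : w ∈ (chartAt ℂ z).source := (chartAt ℂ z).map_target hy
  have h1 := (contDiffAt_coordChange z w hy hw).differentiableAt (by simp)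
  have hy' : (chartAt ℂ w) w ∈ (chartAt ℂ w).target := (chartAt ℂ w).map_source hw
  have h2 := (contDiffAt_coordChange w z hy'
    (by rw [(chartAt ℂ w).left_inv hw]; exact hwz)).differentiableAt (by simp)
  have h3 : (chartAt ℂ z ∘ (chartAt ℂ w).symm) ∘ (chartAt ℂ w ∘ (chartAt ℂ z).symm)
      =ᶠ[nhds y] id := by
    have hopen : (chartAt ℂ z).target ∩ (chartAt ℂ z).symm ⁻¹' (chartAt ℂ w).source ∈ nhds y :=
      ((chartAt ℂ z).isOpen_inter_preimage_symm (chartAt ℂ w).open_source).mem_nhds ⟨hy, hw⟩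
    filter_upwards [hopen] with x hx
    simp [(chartAt ℂ w).left_inv hx.2, (chartAt ℂ z).right_inv hx.1]
  have h4 := h3.deriv_eq
  have h2' : DifferentiableAt ℂ (chartAt ℂ z ∘ (chartAt ℂ w).symm)
    ((chartAt ℂ w ∘ (chartAt ℂ z).symm) y) := h2
  rw [deriv_comp y h2' h1, deriv_id] at h4
  intro h
  have : deriv (chartAt ℂ w ∘ (chartAt ℂ z).symm) y = 0 := h
  rw [this, mul_zero] at h4
  exact zero_ne_one h4

theorem contDiffOn_comp_chart_symm {f : X → ℂ} (hf : ContMDiff 𝓘(ℝ, ℂ) 𝓘(ℝ, ℂ) ∞ f) (z : X) :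
    ContDiffOn ℝ ∞ (f ∘ (chartAt ℂ z).symm) (chartAt ℂ z).target := by
  intro y hy
  refine ContDiffAt.contDiffWithinAt ?_
  refine ContDiffAt.congr_of_eventuallyEq ?_ (chart_comp_symm_eventuallyEq f z hy)
  refine ContDiffAt.comp y (contDiffAt_chart_symm hf _) ?_
  exact ((contDiffAt_coordChange z _ hy (mem_chart_source ℂ _)).restrict_scalars ℝ).of_le le_top

/-- `mfderiv` at a point refers to the preferred chart of that very point, which may jump from point
to point. The chain rule moves everything to the one fixed chart at `z`, at the cost of the factor
`chartFactor`. -/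
theorem fderiv_comp_chart_symm {f : X → ℂ} (hf : ContMDiff 𝓘(ℝ, ℂ) 𝓘(ℝ, ℂ) ∞ f) (z : X)
    {y : ℂ} (hy : y ∈ (chartAt ℂ z).target) (v : ℂ) :
    fderiv ℝ (f ∘ (chartAt ℂ z).symm) y v
      = (mfderiv 𝓘(ℝ, ℂ) 𝓘(ℝ, ℂ) f ((chartAt ℂ z).symm y) : ℂ →L[ℝ] ℂ) (chartFactor z y * v) := by
  have h1 := (contDiffAt_coordChange z _ hy
    (mem_chart_source ℂ ((chartAt ℂ z).symm y))).differentiableAt (by simp)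
  have h2 := h1.hasDerivAt.hasFDerivAt.restrictScalars ℝ
  rw [(chart_comp_symm_eventuallyEq f z hy).fderiv_eq,
    fderiv_comp y ((contDiffAt_chart_symm hf _).differentiableAt (by simp))
      (h1.restrictScalars ℝ), h2.fderiv, mfderiv_eq_fderiv_chart hf]
  simp only [ContinuousLinearMap.comp_apply]
  congr 1
  simp [chartFactor, mul_comm]

end Charts

/-! ### Frames in a coordinate, and loops on the punctured plane. -/

/-- A family of `SL(2, ℂ)`-valued maps `G · ζ` on an open set `V ⊆ ℂ` with Maurer--Cartan form
`G⁻¹ dG = [[θ, ζ⁻¹ p dy + ζ β dȳ], [ζ⁻¹ q dy + ζ γ dȳ, -θ]]`. -/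
structure IsLocalFrame (V : Set ℂ) (G : ℂ → ℂ → Mat2) (p q β γ : ℂ → ℂ) (θ : ℂ → ℂ → ℂ) :
    Prop where
  isOpen : IsOpen V
  smooth : ∀ ζ : ℂ, ζ ≠ 0 → ∀ i j, ContDiffOn ℝ ∞ (fun y => G y ζ i j) V
  det_eq_one : ∀ y ∈ V, ∀ ζ : ℂ, ζ ≠ 0 → (G y ζ).det = 1
  continuousOn : ∀ y ∈ V, ContinuousOn (G y) {0}ᶜ
  fderiv_zero : ∀ y ∈ V, ∀ ζ : ℂ, ζ ≠ 0 → ∀ v i, fderiv ℝ (fun y => G y ζ i 0) y v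
    = G y ζ i 0 * θ y v + G y ζ i 1 * (ζ⁻¹ * v * q y + ζ * conj v * γ y)
  fderiv_one : ∀ y ∈ V, ∀ ζ : ℂ, ζ ≠ 0 → ∀ v i, fderiv ℝ (fun y => G y ζ i 1) y v
    = G y ζ i 0 * (ζ⁻¹ * v * p y + ζ * conj v * β y) - G y ζ i 1 * θ y v

theorem IsUnitaryLoopStar.exists_radius {ζ : ℂ} (hζ : ζ ≠ 0) :
    ∃ r : ℝ, 0 < r ∧ r ≤ 1 ∧ ζ ∈ annulus r := by
  have h0 : 0 < ‖ζ‖ := norm_pos_iff.2 hζ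
  refine ⟨min (‖ζ‖ / 2) (1 / (‖ζ‖ + 1)), by positivity, ?_, ?_, ?_⟩
  · exact (min_le_right _ _).trans (by rw [div_le_one (by positivity)]; linarith)
  · exact (min_le_left _ _).trans_lt (by linarith)
  · rw [lt_div_iff₀ (by positivity)]
    calc ‖ζ‖ * min (‖ζ‖ / 2) (1 / (‖ζ‖ + 1)) ≤ ‖ζ‖ * (1 / (‖ζ‖ + 1)) := by
          gcongr; exact min_le_right _ _
      _ < 1 := by rw [mul_one_div, div_lt_one (by positivity)]; linarith

theorem isOpen_annulus (r : ℝ) : IsOpen (annulus r) :=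
  (isOpen_lt continuous_const continuous_norm).inter (isOpen_lt continuous_norm continuous_const)

namespace IsUnitaryLoopStar

variable {g : ℂ → Mat2}

theorem det_eq_one (hg : IsUnitaryLoopStar g) {ζ : ℂ} (hζ : ζ ≠ 0) : (g ζ).det = 1 := by
  obtain ⟨r, h0, h1, hr⟩ := exists_radius hζ
  exact (hg r h0 h1).det_eq_one ζ (Or.inr hr)

theorem twisted (hg : IsUnitaryLoopStar g) {ζ : ℂ} (hζ : ζ ≠ 0) :
    sigma3 * g (-ζ) * sigma3 = g ζ := by
  obtain ⟨r, h0, h1, hr⟩ := exists_radius hζ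
  exact (hg r h0 h1).twisted ζ (Or.inr hr)

theorem unitary (hg : IsUnitaryLoopStar g) {ζ : ℂ} (hζ : ζ ∈ circle 1) :
    g ζ ∈ Matrix.specialUnitaryGroup (Fin 2) ℂ :=
  (hg 1 one_pos le_rfl).unitary ζ hζ

theorem differentiableAt (hg : IsUnitaryLoopStar g) {ζ : ℂ} (hζ : ζ ≠ 0) (i j : Fin 2) :
    DifferentiableAt ℂ (fun ζ => g ζ i j) ζ := by
  obtain ⟨r, h0, h1, hr⟩ := exists_radius hζ
  exact ((hg r h0 h1).differentiableOn i j).differentiableAt ((isOpen_annulus r).mem_nhds hr)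

theorem differentiableOn (hg : IsUnitaryLoopStar g) (i j : Fin 2) :
    DifferentiableOn ℂ (fun ζ => g ζ i j) {0}ᶜ :=
  fun _ hζ => (hg.differentiableAt hζ i j).differentiableWithinAt

theorem analyticAt (hg : IsUnitaryLoopStar g) {ζ : ℂ} (hζ : ζ ≠ 0) (i j : Fin 2) :
    AnalyticAt ℂ (fun ζ => g ζ i j) ζ :=
  (hg.differentiableOn i j).analyticAt (isOpen_compl_singleton.mem_nhds hζ)

theorem continuousOn (hg : IsUnitaryLoopStar g) : ContinuousOn g {0}ᶜ :=
  continuousOn_pi.2 fun i => continuousOn_pi.2 fun j => (hg.differentiableOn i j).continuousOn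

end IsUnitaryLoopStar

section Frame

variable {X : Type*} [TopologicalSpace X] [ChartedSpace ℂ X]

/-- The entries of the Maurer--Cartan form of an extended frame. -/
structure IsMaurerCartan (F : X → ℂ → Mat2) (p q β γ : X → ℂ) (θ : X → ℂ → ℂ) : Prop where
  matDeriv_zero : ∀ z, ∀ ζ : ℂ, ζ ≠ 0 → ∀ v i, matDeriv (fun y => F y ζ) z v i 0
    = F z ζ i 0 * θ z v + F z ζ i 1 * (ζ⁻¹ * v * q z + ζ * conj v * γ z)
  matDeriv_one : ∀ z, ∀ ζ : ℂ, ζ ≠ 0 → ∀ v i, matDeriv (fun y => F y ζ) z v i 1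
    = F z ζ i 0 * (ζ⁻¹ * v * p z + ζ * conj v * β z) - F z ζ i 1 * θ z v

theorem IsExtendedFrame.exists_isMaurerCartan {F : X → ℂ → Mat2} (hF : IsExtendedFrame F) :
    ∃ (p q β γ : X → ℂ) (θ : X → ℂ → ℂ), IsMaurerCartan F p q β γ θ := by
  obtain ⟨a, b, α₀, ha, hb, hα, htr, h⟩ := hF.maurerCartan
  have key : ∀ z, ∀ ζ : ℂ, ζ ≠ 0 → ∀ v, matDeriv (fun y => F y ζ) z v
      = F z ζ * ((ζ⁻¹ * v) • a z + α₀ z v + (ζ * conj v) • b z) := by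
    intro z ζ hζ v
    have hd : IsUnit (F z ζ).det := by rw [(hF.loop z).det_eq_one hζ]; exact isUnit_one
    rw [← h z ζ hζ v, ← mul_assoc, Matrix.mul_nonsing_inv _ hd, one_mul]
  have htr' : ∀ z v, α₀ z v 1 1 = - α₀ z v 0 0 := by
    intro z v
    have := htr z v
    rw [Matrix.trace_fin_two] at this
    linear_combination this
  refine ⟨fun z => a z 0 1, fun z => a z 1 0, fun z => b z 0 1, fun z => b z 1 0,
    fun z v => α₀ z v 0 0, ⟨?_, ?_⟩⟩
  · intro z ζ hζ v i
    rw [key z ζ hζ v]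
    simp [Matrix.mul_apply, Fin.sum_univ_two, ha, hb, hα]
  · intro z ζ hζ v i
    rw [key z ζ hζ v]
    simp [Matrix.mul_apply, Fin.sum_univ_two, ha, hb, hα, htr']
    ring

theorem IsExtendedFrame.isLocalFrame [IsManifold 𝓘(ℂ) ω X] {F : X → ℂ → Mat2}
    (hF : IsExtendedFrame F) {p q β γ : X → ℂ} {θ : X → ℂ → ℂ}
    (h : IsMaurerCartan F p q β γ θ) (z : X) :
    IsLocalFrame (chartAt ℂ z).target (fun y => F ((chartAt ℂ z).symm y))
      (fun y => chartFactor z y * p ((chartAt ℂ z).symm y))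
      (fun y => chartFactor z y * q ((chartAt ℂ z).symm y))
      (fun y => conj (chartFactor z y) * β ((chartAt ℂ z).symm y))
      (fun y => conj (chartFactor z y) * γ ((chartAt ℂ z).symm y))
      (fun y v => θ ((chartAt ℂ z).symm y) (chartFactor z y * v)) where
  isOpen := (chartAt ℂ z).open_target
  smooth ζ hζ i j := contDiffOn_comp_chart_symm (hF.smooth ζ hζ i j) z
  det_eq_one y _ ζ hζ := (hF.loop _).det_eq_one hζ
  continuousOn y _ := (hF.loop _).continuousOn
  fderiv_zero y hy ζ hζ v i := by
    refine (fderiv_comp_chart_symm (hF.smooth ζ hζ i 0) z hy v).trans ?_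
    refine (h.matDeriv_zero ((chartAt ℂ z).symm y) ζ hζ (chartFactor z y * v) i).trans ?_
    rw [map_mul]
    ring
  fderiv_one y hy ζ hζ v i := by
    refine (fderiv_comp_chart_symm (hF.smooth ζ hζ i 1) z hy v).trans ?_
    refine (h.matDeriv_one ((chartAt ℂ z).symm y) ζ hζ (chartFactor z y * v) i).trans ?_
    rw [map_mul]
    ring

end Frame

/-! ### Regularity and uniform bounds for a local frame. -/

/-- Differentiation under a circle integral, for a family of functions with zero integral. -/
theorem circleIntegral_deriv_eq_zero {f f' : ℝ → ℂ → ℂ} {r ε B : ℝ} (hr : 0 < r) (hε : 0 < ε)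
    (hf : ∀ t ∈ Set.Ioo (-ε) ε, ContinuousOn (f t) (circle r))
    (hf' : ContinuousOn (f' 0) (circle r))
    (hd : ∀ t ∈ Set.Ioo (-ε) ε, ∀ ζ ∈ circle r, HasDerivAt (fun t => f t ζ) (f' t ζ) t)
    (hB : ∀ t ∈ Set.Ioo (-ε) ε, ∀ ζ ∈ circle r, ‖f' t ζ‖ ≤ B)
    (h0 : ∀ t ∈ Set.Ioo (-ε) ε, ∮ ζ in C(0, r), f t ζ = 0) :
    ∮ ζ in C(0, r), f' 0 ζ = 0 := by
  have hmem : ∀ s : ℝ, circleMap 0 r s ∈ circle r := by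
    intro s
    have := circleMap_mem_sphere (0 : ℂ) hr.le s
    simpa [circle] using this
  have hcont : ∀ g : ℂ → ℂ, ContinuousOn g (circle r) →
      Continuous fun s => deriv (circleMap 0 r) s • g (circleMap 0 r s) := by
    intro g hg
    have h1 : Continuous (deriv (circleMap 0 r)) := by
      have : deriv (circleMap 0 r) = fun s => circleMap 0 r s * Complex.I := by
        ext s; exact deriv_circleMap 0 r s |>.trans (by simp)
      rw [this]
      fun_prop
    exact h1.smul (hg.comp_continuous (continuous_circleMap 0 r) hmem)
  have h00 : (0 : ℝ) ∈ Set.Ioo (-ε) ε := ⟨by linarith, hε⟩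
  have hs : Set.Ioo (-ε) ε ∈ nhds (0 : ℝ) := isOpen_Ioo.mem_nhds h00
  have key := (intervalIntegral.hasDerivAt_integral_of_dominated_loc_of_deriv_le
    (μ := MeasureTheory.volume) (a := 0) (b := 2 * Real.pi)
    (F := fun t s => deriv (circleMap 0 r) s • f t (circleMap 0 r s))
    (F' := fun t s => deriv (circleMap 0 r) s • f' t (circleMap 0 r s))
    (x₀ := (0 : ℝ)) (bound := fun _ => r * B) hs
    (by
      filter_upwards [hs] with t ht
      exact (hcont _ (hf t ht)).aestronglyMeasurable)
    ((hcont _ (hf 0 h00)).intervalIntegrable _ _)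
    ((hcont _ hf').aestronglyMeasurable)
    (Filter.Eventually.of_forall fun s _ t ht => by
      rw [norm_smul]
      gcongr
      · simp [abs_of_pos hr]
      · exact hB t ht _ (hmem s))
    (by simp)
    (Filter.Eventually.of_forall fun s _ t ht => (hd t ht _ (hmem s)).const_mul _)).2
  have hz : (fun t => ∫ s in (0 : ℝ)..2 * Real.pi,
      deriv (circleMap 0 r) s • f t (circleMap 0 r s)) =ᶠ[nhds 0] fun _ => 0 := by
    filter_upwards [hs] with t ht using h0 t ht
  have := key.congr_of_eventuallyEq hz.symm
  exact (this.unique (hasDerivAt_const (0 : ℝ) (0 : ℂ)))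

section LocalFrame

variable {V : Set ℂ} {G : ℂ → ℂ → Mat2} {p q β γ : ℂ → ℂ} {θ : ℂ → ℂ → ℂ}

namespace IsLocalFrame

variable (h : IsLocalFrame V G p q β γ θ)
include h

theorem contDiffAt {y : ℂ} (hy : y ∈ V) {ζ : ℂ} (hζ : ζ ≠ 0) (i j : Fin 2) :
    ContDiffAt ℝ ∞ (fun y => G y ζ i j) y :=
  (h.smooth ζ hζ i j).contDiffAt (h.isOpen.mem_nhds hy)

theorem differentiableAt {y : ℂ} (hy : y ∈ V) {ζ : ℂ} (hζ : ζ ≠ 0) (i j : Fin 2) :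
    DifferentiableAt ℝ (fun y => G y ζ i j) y :=
  (h.contDiffAt hy hζ i j).differentiableAt (by simp)

theorem contDiffOn_fderiv {ζ : ℂ} (hζ : ζ ≠ 0) (i j : Fin 2) (v : ℂ) :
    ContDiffOn ℝ ∞ (fun y => fderiv ℝ (fun y => G y ζ i j) y v) V :=
  ((h.smooth ζ hζ i j).fderiv_of_isOpen h.isOpen (by simp)).clm_apply contDiffOn_const

theorem det_apply {y : ℂ} (hy : y ∈ V) {ζ : ℂ} (hζ : ζ ≠ 0) :
    G y ζ 0 0 * G y ζ 1 1 - G y ζ 0 1 * G y ζ 1 0 = 1 := by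
  rw [← h.det_eq_one y hy ζ hζ, Matrix.det_fin_two]

/-- The coefficients of the Maurer–Cartan form come without any regularity. Solving `dG = G ω` by
means of the adjugate expresses them through the smooth `G`, from which their smoothness is read
off. -/
theorem theta_eq {y : ℂ} (hy : y ∈ V) {ζ : ℂ} (hζ : ζ ≠ 0) (v : ℂ) :
    θ y v = G y ζ 1 1 * fderiv ℝ (fun y => G y ζ 0 0) y v
      - G y ζ 0 1 * fderiv ℝ (fun y => G y ζ 1 0) y v := by
  rw [h.fderiv_zero y hy ζ hζ, h.fderiv_zero y hy ζ hζ]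
  linear_combination - θ y v * h.det_apply hy hζ

theorem upper_eq {y : ℂ} (hy : y ∈ V) {ζ : ℂ} (hζ : ζ ≠ 0) (v : ℂ) :
    ζ⁻¹ * v * p y + ζ * conj v * β y = G y ζ 1 1 * fderiv ℝ (fun y => G y ζ 0 1) y v
      - G y ζ 0 1 * fderiv ℝ (fun y => G y ζ 1 1) y v := by
  rw [h.fderiv_one y hy ζ hζ, h.fderiv_one y hy ζ hζ]
  linear_combination - (ζ⁻¹ * v * p y + ζ * conj v * β y) * h.det_apply hy hζ

theorem lower_eq {y : ℂ} (hy : y ∈ V) {ζ : ℂ} (hζ : ζ ≠ 0) (v : ℂ) :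
    ζ⁻¹ * v * q y + ζ * conj v * γ y = G y ζ 0 0 * fderiv ℝ (fun y => G y ζ 1 0) y v
      - G y ζ 1 0 * fderiv ℝ (fun y => G y ζ 0 0) y v := by
  rw [h.fderiv_zero y hy ζ hζ, h.fderiv_zero y hy ζ hζ]
  linear_combination - (ζ⁻¹ * v * q y + ζ * conj v * γ y) * h.det_apply hy hζ

theorem contDiffOn_theta (v : ℂ) : ContDiffOn ℝ ∞ (fun y => θ y v) V :=
  ((((h.smooth 1 one_ne_zero 1 1).mul (h.contDiffOn_fderiv one_ne_zero 0 0 v))).sub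
    ((h.smooth 1 one_ne_zero 0 1).mul (h.contDiffOn_fderiv one_ne_zero 1 0 v))).congr
    fun _ hy => h.theta_eq hy one_ne_zero v

theorem contDiffOn_upper {ζ : ℂ} (hζ : ζ ≠ 0) (v : ℂ) :
    ContDiffOn ℝ ∞ (fun y => ζ⁻¹ * v * p y + ζ * conj v * β y) V :=
  ((((h.smooth ζ hζ 1 1).mul (h.contDiffOn_fderiv hζ 0 1 v))).sub
    ((h.smooth ζ hζ 0 1).mul (h.contDiffOn_fderiv hζ 1 1 v))).congr
    fun _ hy => h.upper_eq hy hζ v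

theorem contDiffOn_lower {ζ : ℂ} (hζ : ζ ≠ 0) (v : ℂ) :
    ContDiffOn ℝ ∞ (fun y => ζ⁻¹ * v * q y + ζ * conj v * γ y) V :=
  ((((h.smooth ζ hζ 0 0).mul (h.contDiffOn_fderiv hζ 1 0 v))).sub
    ((h.smooth ζ hζ 1 0).mul (h.contDiffOn_fderiv hζ 0 0 v))).congr
    fun _ hy => h.lower_eq hy hζ v

/-- The values `ζ = 1` and `ζ = i` suffice to separate `p` from `β` in `ζ⁻¹ p + ζ β`. -/
theorem contDiffOn_p : ContDiffOn ℝ ∞ p V :=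
  (contDiffOn_const.mul ((h.contDiffOn_upper one_ne_zero 1).add
    (contDiffOn_const.mul (h.contDiffOn_upper Complex.I_ne_zero 1)))).congr
    (f := fun y => (1 / 2 : ℂ) * (((1 : ℂ)⁻¹ * 1 * p y + 1 * conj (1 : ℂ) * β y)
      + Complex.I * (Complex.I⁻¹ * 1 * p y + Complex.I * conj (1 : ℂ) * β y)))
    fun y _ => by
      simp only [map_one, Complex.inv_I]
      linear_combination (p y / 2 - β y / 2) * Complex.I_sq

theorem contDiffOn_q : ContDiffOn ℝ ∞ q V :=
  (contDiffOn_const.mul ((h.contDiffOn_lower one_ne_zero 1).add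
    (contDiffOn_const.mul (h.contDiffOn_lower Complex.I_ne_zero 1)))).congr
    (f := fun y => (1 / 2 : ℂ) * (((1 : ℂ)⁻¹ * 1 * q y + 1 * conj (1 : ℂ) * γ y)
      + Complex.I * (Complex.I⁻¹ * 1 * q y + Complex.I * conj (1 : ℂ) * γ y)))
    fun y _ => by
      simp only [map_one, Complex.inv_I]
      linear_combination (q y / 2 - γ y / 2) * Complex.I_sq

theorem contDiffOn_beta : ContDiffOn ℝ ∞ β V :=
  ((h.contDiffOn_upper one_ne_zero 1).sub h.contDiffOn_p).congr fun y _ => by simp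

theorem contDiffOn_gamma : ContDiffOn ℝ ∞ γ V :=
  ((h.contDiffOn_lower one_ne_zero 1).sub h.contDiffOn_q).congr fun y _ => by simp

theorem hasDerivAt_zero {y : ℂ} {t : ℝ} (hy : y + t ∈ V) {ζ : ℂ} (hζ : ζ ≠ 0) (i : Fin 2) :
    HasDerivAt (fun t : ℝ => G (y + t) ζ i 0) (G (y + t) ζ i 0 * θ (y + t) 1
      + G (y + t) ζ i 1 * (ζ⁻¹ * q (y + t) + ζ * γ (y + t))) t := by
  have h1 := (h.differentiableAt hy hζ i 0).hasFDerivAt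
  have h2 : HasDerivAt (fun t : ℝ => y + (t : ℂ)) 1 t :=
    (Complex.ofRealCLM.hasDerivAt (x := t)).const_add y
  have h3 := h1.comp_hasDerivAt t h2
  rw [h.fderiv_zero _ hy ζ hζ] at h3
  simp only [mul_one, map_one] at h3
  exact h3

theorem hasDerivAt_one {y : ℂ} {t : ℝ} (hy : y + t ∈ V) {ζ : ℂ} (hζ : ζ ≠ 0) (i : Fin 2) :
    HasDerivAt (fun t : ℝ => G (y + t) ζ i 1) (G (y + t) ζ i 0 *
      (ζ⁻¹ * p (y + t) + ζ * β (y + t)) - G (y + t) ζ i 1 * θ (y + t) 1) t := by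
  have h1 := (h.differentiableAt hy hζ i 1).hasFDerivAt
  have h2 : HasDerivAt (fun t : ℝ => y + (t : ℂ)) 1 t :=
    (Complex.ofRealCLM.hasDerivAt (x := t)).const_add y
  have h3 := h1.comp_hasDerivAt t h2
  rw [h.fderiv_one _ hy ζ hζ] at h3
  simp only [mul_one, map_one] at h3
  exact h3

/-- Uniform bounds for a frame and its Maurer--Cartan form along a short segment. -/
theorem exists_bound {y : ℂ} (hy : y ∈ V) {r : ℝ} (hr : 0 < r) :
    ∃ ε : ℝ, 0 < ε ∧ ∃ B : ℝ, 0 ≤ B ∧ ∀ t ∈ Set.Ioo (-ε) ε, y + (t : ℂ) ∈ V ∧ ∀ ζ ∈ circle r,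
      (∀ i j, ‖G (y + t) ζ i j‖ ≤ B) ∧ ‖θ (y + t) 1‖ ≤ B ∧
      ‖ζ⁻¹ * p (y + t) + ζ * β (y + t)‖ ≤ B ∧ ‖ζ⁻¹ * q (y + t) + ζ * γ (y + t)‖ ≤ B := by
  obtain ⟨ε, hε, hball⟩ := Metric.nhds_basis_closedBall.mem_iff.1 (h.isOpen.mem_nhds hy)
  have hcomp := isCompact_closedBall y ε
  have hbd : ∀ f : ℂ → ℂ, ContDiffOn ℝ ∞ f V → ∃ C, ∀ x ∈ Metric.closedBall y ε, ‖f x‖ ≤ C :=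
    fun f hf => hcomp.exists_bound_of_continuousOn (hf.continuousOn.mono hball)
  obtain ⟨Cp, hCp⟩ := hbd _ h.contDiffOn_p
  obtain ⟨Cq, hCq⟩ := hbd _ h.contDiffOn_q
  obtain ⟨Cβ, hCβ⟩ := hbd _ h.contDiffOn_beta
  obtain ⟨Cγ, hCγ⟩ := hbd _ h.contDiffOn_gamma
  obtain ⟨Cθ, hCθ⟩ := hbd _ (h.contDiffOn_theta 1)
  have hyε : y ∈ Metric.closedBall y ε := Metric.mem_closedBall_self hε.le
  have hp0 := (norm_nonneg _).trans (hCp y hyε)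
  have hq0 := (norm_nonneg _).trans (hCq y hyε)
  have hβ0 := (norm_nonneg _).trans (hCβ y hyε)
  have hγ0 := (norm_nonneg _).trans (hCγ y hyε)
  have hθ0 := (norm_nonneg _).trans (hCθ y hyε)
  set K := Cθ + r⁻¹ * (Cp + Cq) + r * (Cβ + Cγ) with hK
  have hmem : ∀ t : ℝ, t ∈ Set.Icc (-ε) ε → y + (t : ℂ) ∈ Metric.closedBall y ε := by
    intro t ht
    rw [Metric.mem_closedBall, dist_eq_norm, add_sub_cancel_left, Complex.norm_real,
      Real.norm_eq_abs]
    exact abs_le.2 ht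
  have hr0 : ∀ ζ ∈ circle r, ζ ≠ 0 := by
    rintro ζ hζ rfl
    simp [circle] at hζ
    exact hr.ne hζ
  have hθK : ∀ t ∈ Set.Icc (-ε) ε, ‖θ (y + (t : ℝ)) 1‖ ≤ K := by
    intro t ht
    refine (hCθ _ (hmem t ht)).trans ?_
    have : 0 ≤ r⁻¹ * (Cp + Cq) + r * (Cβ + Cγ) := by positivity
    linarith
  have hPK : ∀ t ∈ Set.Icc (-ε) ε, ∀ ζ ∈ circle r,
      ‖ζ⁻¹ * p (y + (t : ℝ)) + ζ * β (y + (t : ℝ))‖ ≤ K := by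
    intro t ht ζ hζ
    have hζ' : ‖ζ‖ = r := hζ
    have h1 : ‖ζ⁻¹ * p (y + (t : ℝ)) + ζ * β (y + (t : ℝ))‖ ≤ r⁻¹ * Cp + r * Cβ := by
      refine (norm_add_le _ _).trans ?_
      rw [norm_mul, norm_mul, norm_inv, hζ']
      gcongr
      · exact hCp _ (hmem t ht)
      · exact hCβ _ (hmem t ht)
    have : 0 ≤ r⁻¹ * Cq + r * Cγ := by positivity
    rw [hK]; linarith
  have hQK : ∀ t ∈ Set.Icc (-ε) ε, ∀ ζ ∈ circle r,
      ‖ζ⁻¹ * q (y + (t : ℝ)) + ζ * γ (y + (t : ℝ))‖ ≤ K := by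
    intro t ht ζ hζ
    have hζ' : ‖ζ‖ = r := hζ
    have h1 : ‖ζ⁻¹ * q (y + (t : ℝ)) + ζ * γ (y + (t : ℝ))‖ ≤ r⁻¹ * Cq + r * Cγ := by
      refine (norm_add_le _ _).trans ?_
      rw [norm_mul, norm_mul, norm_inv, hζ']
      gcongr
      · exact hCq _ (hmem t ht)
      · exact hCγ _ (hmem t ht)
    have : 0 ≤ r⁻¹ * Cp + r * Cβ := by positivity
    rw [hK]; linarith
  have hK0 : 0 ≤ K := by positivity
  have hcirc : IsCompact (circle r) := by
    have : circle r = Metric.sphere 0 r := by ext; simp [circle]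
    rw [this]; exact isCompact_sphere 0 r
  -- Joint continuity in `(y, ζ)` is not part of the hypotheses. Continuity in `ζ` bounds the frame
  -- at the left end of the segment, and Grönwall's inequality for `G' = G Ω` carries this bound
  -- along the segment, uniformly in `ζ`.
  have hG0 : ∃ C, ∀ ζ ∈ circle r, ∀ i j, ‖G (y + (-ε : ℝ)) ζ i j‖ ≤ C := by
    have hc : ∀ i j, ContinuousOn (fun ζ => G (y + (-ε : ℝ)) ζ i j) (circle r) := by
      intro i j
      have h1 := h.continuousOn _ (hball (hmem (-ε) ⟨le_rfl, by linarith⟩))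
      exact ((continuousOn_pi.1 (continuousOn_pi.1 h1 i)) j).mono fun ζ hζ => hr0 ζ hζ
    choose C hC using fun i j => hcirc.exists_bound_of_continuousOn (hc i j)
    refine ⟨∑ i, ∑ j, |C i j|, fun ζ hζ i j => (hC i j ζ hζ).trans ((le_abs_self _).trans ?_)⟩
    exact (Finset.single_le_sum (f := fun j => |C i j|) (fun _ _ => abs_nonneg _)
      (Finset.mem_univ j)).trans (Finset.single_le_sum (f := fun i => ∑ j, |C i j|)
      (fun _ _ => Finset.sum_nonneg fun _ _ => abs_nonneg _) (Finset.mem_univ i))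
  obtain ⟨C, hC⟩ := hG0
  have hGB : ∀ t ∈ Set.Icc (-ε) ε, ∀ ζ ∈ circle r, ∀ i j,
      ‖G (y + (t : ℝ)) ζ i j‖ ≤ C * Real.exp (2 * K * (ε + ε)) := by
    intro t ht ζ hζ i j
    have hζ0 := hr0 ζ hζ
    have hC0 : 0 ≤ C := (norm_nonneg _).trans (hC ζ hζ 0 0)
    let u : ℝ → Fin 2 → Fin 2 → ℂ := fun t i j => G (y + (t : ℝ)) ζ i j
    let u' : ℝ → Fin 2 → Fin 2 → ℂ := fun t i =>
      ![G (y + t) ζ i 0 * θ (y + t) 1 + G (y + t) ζ i 1 * (ζ⁻¹ * q (y + t) + ζ * γ (y + t)),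
        G (y + t) ζ i 0 * (ζ⁻¹ * p (y + t) + ζ * β (y + t)) - G (y + t) ζ i 1 * θ (y + t) 1]
    have hu : ∀ t ∈ Set.Icc (-ε) ε, HasDerivAt u (u' t) t := by
      intro t ht
      refine hasDerivAt_pi.2 fun i => hasDerivAt_pi.2 fun j => ?_
      fin_cases j
      · exact h.hasDerivAt_zero (hball (hmem t ht)) hζ0 i
      · exact h.hasDerivAt_one (hball (hmem t ht)) hζ0 i
    have hle := norm_le_gronwallBound_of_norm_deriv_right_le (f := u) (f' := u') (δ := C)
      (K := 2 * K) (ε := 0) (a := -ε) (b := ε)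
      (fun t ht => (hu t ht).continuousAt.continuousWithinAt)
      (fun t ht => (hu t ⟨ht.1, ht.2.le⟩).hasDerivWithinAt)
      ((pi_norm_le_iff_of_nonneg hC0).2 fun i => (pi_norm_le_iff_of_nonneg hC0).2 fun j =>
        hC ζ hζ i j)
      (by
        intro t ht
        have ht' : t ∈ Set.Icc (-ε) ε := ⟨ht.1, ht.2.le⟩
        have hn : ∀ i j, ‖G (y + (t : ℝ)) ζ i j‖ ≤ ‖u t‖ := fun i j =>
          (norm_le_pi_norm (u t i) j).trans (norm_le_pi_norm (u t) i)
        have hpos : 0 ≤ 2 * K * ‖u t‖ + 0 := by positivity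
        refine (pi_norm_le_iff_of_nonneg hpos).2 fun i =>
          (pi_norm_le_iff_of_nonneg hpos).2 fun j => ?_
        fin_cases j
        · calc ‖G (y + t) ζ i 0 * θ (y + t) 1
                + G (y + t) ζ i 1 * (ζ⁻¹ * q (y + t) + ζ * γ (y + t))‖
              ≤ ‖u t‖ * K + ‖u t‖ * K := by
                refine (norm_add_le _ _).trans ?_
                rw [norm_mul, norm_mul]
                gcongr
                · exact hn i 0
                · exact hθK t ht'
                · exact hn i 1
                · exact hQK t ht' ζ hζ
            _ = 2 * K * ‖u t‖ + 0 := by ring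
        · calc ‖G (y + t) ζ i 0 * (ζ⁻¹ * p (y + t) + ζ * β (y + t))
                - G (y + t) ζ i 1 * θ (y + t) 1‖
              ≤ ‖u t‖ * K + ‖u t‖ * K := by
                refine (norm_sub_le _ _).trans ?_
                rw [norm_mul, norm_mul]
                gcongr
                · exact hn i 0
                · exact hPK t ht' ζ hζ
                · exact hn i 1
                · exact hθK t ht'
            _ = 2 * K * ‖u t‖ + 0 := by ring)
      t ht
    refine ((norm_le_pi_norm (u t i) j).trans (norm_le_pi_norm (u t) i)).trans (hle.trans ?_)
    rw [gronwallBound_ε0]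
    gcongr
    linarith [ht.2]
  refine ⟨ε, hε, max K (C * Real.exp (2 * K * (ε + ε))), hK0.trans (le_max_left _ _), ?_⟩
  intro t ht
  have ht' : t ∈ Set.Icc (-ε) ε := ⟨ht.1.le, ht.2.le⟩
  exact ⟨hball (hmem t ht'), fun ζ hζ => ⟨fun i j => (hGB t ht' ζ hζ i j).trans (le_max_right _ _),
    (hθK t ht').trans (le_max_left _ _), (hPK t ht' ζ hζ).trans (le_max_left _ _),
    (hQK t ht' ζ hζ).trans (le_max_left _ _)⟩⟩

end IsLocalFrame

end LocalFrame

/-! ### Loops which the frame conjugates into positive loops. -/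

/-- The entries of `N` are holomorphic on the disc of radius `r` and continuous up to the
boundary. -/
def PosExt (r : ℝ) (N : ℂ → Mat2) : Prop :=
  ∀ i j, DiffContOnCl ℂ (fun ζ => N ζ i j) (Metric.ball 0 r)

theorem circle_eq_sphere (r : ℝ) : circle r = Metric.sphere 0 r := by
  ext; simp [circle]

theorem ne_zero_of_mem_circle {r : ℝ} (hr : 0 < r) {ζ : ℂ} (hζ : ζ ∈ circle r) : ζ ≠ 0 := by
  rintro rfl
  simp [circle] at hζ
  exact hr.ne hζ

theorem DiffContOnCl.eqOn_of_circle {r : ℝ} (hr : 0 < r) {f g : ℂ → ℂ}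
    (hf : DiffContOnCl ℂ f (Metric.ball 0 r)) (hg : DiffContOnCl ℂ g (Metric.ball 0 r))
    (h : ∀ ζ ∈ circle r, f ζ = g ζ) : ∀ ζ ∈ Metric.closedBall (0 : ℂ) r, f ζ = g ζ := by
  have := Complex.eqOn_closure_of_eqOn_frontier Metric.isBounded_ball hf hg (by
    rw [frontier_ball _ hr.ne', ← circle_eq_sphere]; exact h)
  rw [closure_ball _ hr.ne'] at this
  exact this

/-- The first term integrates to `2πi u(0)` by Cauchy's formula and the second to `0` by Cauchy's
theorem. -/
theorem eq_zero_of_circleIntegral {r : ℝ} (hr : 0 < r) {u w : ℂ → ℂ}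
    (hu : DiffContOnCl ℂ u (Metric.ball 0 r)) (hw : DiffContOnCl ℂ w (Metric.ball 0 r))
    (h : ∮ ζ in C(0, r), (ζ⁻¹ * u ζ + w ζ) = 0) : u 0 = 0 := by
  have hsub : Metric.sphere (0 : ℂ) r ⊆ closure (Metric.ball 0 r) := by
    rw [closure_ball _ hr.ne']; exact Metric.sphere_subset_closedBall
  have h1 := hu.circleIntegral_sub_inv_smul (Metric.mem_ball_self hr)
  have h2 : ∮ ζ in C(0, r), w ζ = 0 := by
    refine Complex.circleIntegral_eq_zero_of_differentiable_on_off_countable hr.le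
      Set.countable_empty ?_ fun z hz => hw.differentiableOn.differentiableAt
        (Metric.isOpen_ball.mem_nhds hz.1)
    have := hw.continuousOn
    rwa [closure_ball _ hr.ne'] at this
  have hinv : ContinuousOn (fun ζ : ℂ => ζ⁻¹) (Metric.sphere 0 r) :=
    continuousOn_inv₀.mono fun ζ hζ => by
      rw [← circle_eq_sphere] at hζ
      exact ne_zero_of_mem_circle hr hζ
  rw [circleIntegral.integral_add] at h
  · simp only [sub_zero, smul_eq_mul] at h1
    rw [h1, h2, add_zero] at h
    simpa [Real.pi_ne_zero] using h
  · exact (hinv.mul (hu.continuousOn.mono hsub)).circleIntegrable hr.le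
  · exact (hw.continuousOn.mono hsub).circleIntegrable hr.le

/-- If `g' = g Ω` with `Ω` trace free, then `(adj g)' = -Ω (adj g)`, so the conjugate of a constant
matrix satisfies a Lax equation. With the adjugate in place of the inverse this needs no condition
on `det g`. -/
theorem hasDerivAt_adjugate_conj {g : ℝ → Mat2} {t : ℝ} {c : Mat2} {θ P Q : ℂ}
    (h0 : ∀ i, HasDerivAt (fun t => g t i 0) (g t i 0 * θ + g t i 1 * Q) t)
    (h1 : ∀ i, HasDerivAt (fun t => g t i 1) (g t i 0 * P - g t i 1 * θ) t) (i j : Fin 2) :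
    HasDerivAt (fun t => ((g t).adjugate * c * g t) i j)
      ((((g t).adjugate * c * g t) * !![θ, P; Q, -θ]
        - !![θ, P; Q, -θ] * ((g t).adjugate * c * g t)) i j) t := by
  have h00 := h0 0
  have h10 := h0 1
  have h01 := h1 0
  have h11 := h1 1
  fin_cases i <;> fin_cases j <;>
    simp only [Matrix.adjugate_fin_two, Matrix.mul_apply, Fin.sum_univ_two, Fin.zero_eta,
      Fin.mk_one, Matrix.of_apply, Matrix.cons_val', Matrix.cons_val_zero, Matrix.cons_val_one,
      Matrix.cons_val_fin_one, Matrix.sub_apply]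
  · exact ((((h11.mul_const _).add (h01.neg.mul_const _)).mul h00).add
      (((h11.mul_const _).add (h01.neg.mul_const _)).mul h10)).congr_deriv (by
        simp only [Pi.add_apply, Pi.neg_apply]; ring)
  · exact ((((h11.mul_const _).add (h01.neg.mul_const _)).mul h01).add
      (((h11.mul_const _).add (h01.neg.mul_const _)).mul h11)).congr_deriv (by
        simp only [Pi.add_apply, Pi.neg_apply]; ring)
  · exact ((((h10.neg.mul_const _).add (h00.mul_const _)).mul h00).add
      (((h10.neg.mul_const _).add (h00.mul_const _)).mul h10)).congr_deriv (by
        simp only [Pi.add_apply, Pi.neg_apply]; ring)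
  · exact ((((h10.neg.mul_const _).add (h00.mul_const _)).mul h01).add
      (((h10.neg.mul_const _).add (h00.mul_const _)).mul h11)).congr_deriv (by
        simp only [Pi.add_apply, Pi.neg_apply]; ring)

/-- Conjugation by the frame `G` turns the loop `c` on `C_r` into loops `N y` with holomorphic
extension to the disc. -/
def StabBy (V : Set ℂ) (G : ℂ → ℂ → Mat2) (r : ℝ) (c : ℂ → Mat2) (N : ℂ → ℂ → Mat2) : Prop :=
  ∀ y ∈ V, PosExt r (N y) ∧ ∀ ζ ∈ circle r, G y ζ * N y ζ = c ζ * G y ζ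

theorem norm_mul_apply_le {A B : Mat2} {a b : ℝ} (hA : ∀ i j, ‖A i j‖ ≤ a)
    (hB : ∀ i j, ‖B i j‖ ≤ b) (i j : Fin 2) : ‖(A * B) i j‖ ≤ 2 * (a * b) := by
  have ha : 0 ≤ a := (norm_nonneg _).trans (hA 0 0)
  rw [Matrix.mul_apply, Fin.sum_univ_two]
  calc ‖A i 0 * B 0 j + A i 1 * B 1 j‖ ≤ a * b + a * b := by
        refine (norm_add_le _ _).trans ?_
        rw [norm_mul, norm_mul]
        gcongr
        · exact hA i 0
        · exact hB 0 j
        · exact hA i 1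
        · exact hB 1 j
    _ = 2 * (a * b) := by ring

theorem DiffContOnCl.mul' {f g : ℂ → ℂ} {s : Set ℂ} (hf : DiffContOnCl ℂ f s)
    (hg : DiffContOnCl ℂ g s) : DiffContOnCl ℂ (fun z => f z * g z) s := hf.smul hg

theorem PosExt.mul_const {r : ℝ} {N : ℂ → Mat2} (hN : PosExt r N) (A : Mat2) :
    PosExt r fun ζ => N ζ * A := by
  intro i j
  simp only [Matrix.mul_apply, Fin.sum_univ_two]
  exact (DiffContOnCl.mul' (hN i 0) diffContOnCl_const).add
    (DiffContOnCl.mul' (hN i 1) diffContOnCl_const)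

theorem PosExt.const_mul {r : ℝ} {N : ℂ → Mat2} (hN : PosExt r N) (A : Mat2) :
    PosExt r fun ζ => A * N ζ := by
  intro i j
  simp only [Matrix.mul_apply, Fin.sum_univ_two]
  exact (DiffContOnCl.mul' diffContOnCl_const (hN 0 j)).add
    (DiffContOnCl.mul' diffContOnCl_const (hN 1 j))

theorem PosExt.sub {r : ℝ} {N N' : ℂ → Mat2} (hN : PosExt r N) (hN' : PosExt r N') :
    PosExt r fun ζ => N ζ - N' ζ :=
  fun i j => (hN i j).sub (hN' i j)

theorem PosExt.add {r : ℝ} {N N' : ℂ → Mat2} (hN : PosExt r N) (hN' : PosExt r N') :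
    PosExt r fun ζ => N ζ + N' ζ :=
  fun i j => (hN i j).add (hN' i j)

theorem PosExt.mul {r : ℝ} {N N' : ℂ → Mat2} (hN : PosExt r N) (hN' : PosExt r N') :
    PosExt r fun ζ => N ζ * N' ζ := by
  intro i j
  simp only [Matrix.mul_apply, Fin.sum_univ_two]
  exact (DiffContOnCl.mul' (hN i 0) (hN' 0 j)).add (DiffContOnCl.mul' (hN i 1) (hN' 1 j))

theorem PosExt.adjugate {r : ℝ} {N : ℂ → Mat2} (hN : PosExt r N) :
    PosExt r fun ζ => (N ζ).adjugate := by
  intro i j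
  simp only [Matrix.adjugate_fin_two]
  fin_cases i <;> fin_cases j
  · exact hN 1 1
  · exact (hN 0 1).neg
  · exact (hN 1 0).neg
  · exact hN 0 0

theorem PosExt.trace {r : ℝ} {N : ℂ → Mat2} (hN : PosExt r N) :
    DiffContOnCl ℂ (fun ζ => (N ζ).trace) (Metric.ball 0 r) := by
  simp only [Matrix.trace_fin_two]
  exact (hN 0 0).add (hN 1 1)

theorem PosExt.det {r : ℝ} {N : ℂ → Mat2} (hN : PosExt r N) :
    DiffContOnCl ℂ (fun ζ => (N ζ).det) (Metric.ball 0 r) := by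
  simp only [Matrix.det_fin_two]
  exact (DiffContOnCl.mul' (hN 0 0) (hN 1 1)).sub (DiffContOnCl.mul' (hN 0 1) (hN 1 0))

theorem PosExt.continuousOn {r : ℝ} (hr : 0 < r) {N : ℂ → Mat2} (hN : PosExt r N) (i j : Fin 2) :
    ContinuousOn (fun ζ => N ζ i j) (circle r) := by
  refine (hN i j).continuousOn.mono ?_
  rw [closure_ball _ hr.ne', circle_eq_sphere]
  exact Metric.sphere_subset_closedBall

section Stabilizer

variable {V : Set ℂ} {G : ℂ → ℂ → Mat2} {p q β γ : ℂ → ℂ} {θ : ℂ → ℂ → ℂ}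

namespace StabBy

variable {r : ℝ} {c : ℂ → Mat2} {N : ℂ → ℂ → Mat2}

theorem eq_adjugate (hc : StabBy V G r c N) (hF : IsLocalFrame V G p q β γ θ) (hr : 0 < r)
    {y : ℂ} (hy : y ∈ V) {ζ : ℂ} (hζ : ζ ∈ circle r) :
    N y ζ = (G y ζ).adjugate * c ζ * G y ζ := by
  rw [mul_assoc, ← (hc y hy).2 ζ hζ, ← mul_assoc, Matrix.adjugate_mul,
    hF.det_eq_one y hy ζ (ne_zero_of_mem_circle hr hζ), one_smul, one_mul]

theorem eq_conj (hc : StabBy V G r c N) (hF : IsLocalFrame V G p q β γ θ) (hr : 0 < r)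
    {y : ℂ} (hy : y ∈ V) {ζ : ℂ} (hζ : ζ ∈ circle r) :
    c ζ = G y ζ * N y ζ * (G y ζ).adjugate := by
  rw [(hc y hy).2 ζ hζ, mul_assoc, Matrix.mul_adjugate,
    hF.det_eq_one y hy ζ (ne_zero_of_mem_circle hr hζ), one_smul, mul_one]

/-- Nothing is assumed about `c` itself; its continuity comes from `c = G N G⁻¹` at a single point
of `V`. -/
theorem continuousOn (hc : StabBy V G r c N) (hF : IsLocalFrame V G p q β γ θ) (hr : 0 < r)
    {y : ℂ} (hy : y ∈ V) (i j : Fin 2) : ContinuousOn (fun ζ => c ζ i j) (circle r) := by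
  have hG : ContinuousOn (G y) (circle r) :=
    (hF.continuousOn y hy).mono fun ζ hζ => ne_zero_of_mem_circle hr hζ
  have hN : ContinuousOn (N y) (circle r) :=
    continuousOn_pi.2 fun i => continuousOn_pi.2 fun j => (hc y hy).1.continuousOn hr i j
  have h1 : ContinuousOn (fun ζ => G y ζ * N y ζ * (G y ζ).adjugate) (circle r) := by
    rw [continuousOn_iff_continuous_domRestrict] at hG hN ⊢
    exact (hG.matrix_mul hN).matrix_mul hG.matrix_adjugate
  have h2 : ContinuousOn c (circle r) := h1.congr fun ζ hζ => hc.eq_conj hF hr hy hζ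
  exact continuousOn_pi.1 (continuousOn_pi.1 h2 i) j

/-- The value at `0` of a positive loop conjugated by the frame commutes with the
`(1, 0)`-part of the Maurer--Cartan form. -/
theorem commute_zero (hc : StabBy V G r c N) (hF : IsLocalFrame V G p q β γ θ) (hr : 0 < r)
    {y : ℂ} (hy : y ∈ V) :
    N y 0 * !![0, p y; q y, 0] = !![0, p y; q y, 0] * N y 0 := by
  obtain ⟨ε, hε, B, hB0, hB⟩ := hF.exists_bound hy hr
  have h00 : (0 : ℝ) ∈ Set.Ioo (-ε) ε := ⟨by linarith, hε⟩
  have hcirc : IsCompact (circle r) := by rw [circle_eq_sphere]; exact isCompact_sphere 0 r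
  have hr0 : ∀ ζ ∈ circle r, ζ ≠ 0 := fun ζ hζ => ne_zero_of_mem_circle hr hζ
  obtain ⟨C, hC⟩ : ∃ C, ∀ ζ ∈ circle r, ∀ i j, ‖c ζ i j‖ ≤ C := by
    choose C hC using fun i j => hcirc.exists_bound_of_continuousOn (hc.continuousOn hF hr hy i j)
    refine ⟨∑ i, ∑ j, |C i j|, fun ζ hζ i j => (hC i j ζ hζ).trans ((le_abs_self _).trans ?_)⟩
    exact (Finset.single_le_sum (f := fun j => |C i j|) (fun _ _ => abs_nonneg _)
      (Finset.mem_univ j)).trans (Finset.single_le_sum (f := fun i => ∑ j, |C i j|)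
      (fun _ _ => Finset.sum_nonneg fun _ _ => abs_nonneg _) (Finset.mem_univ i))
  let Ω : ℝ → ℂ → Mat2 := fun t ζ =>
    !![θ (y + t) 1, ζ⁻¹ * p (y + t) + ζ * β (y + t);
      ζ⁻¹ * q (y + t) + ζ * γ (y + t), -θ (y + t) 1]
  have hN : ∀ t ∈ Set.Ioo (-ε) ε, ∀ ζ ∈ circle r, ∀ i j,
      HasDerivAt (fun t : ℝ => N (y + t) ζ i j)
        ((N (y + t) ζ * Ω t ζ - Ω t ζ * N (y + t) ζ) i j) t := by
    intro t ht ζ hζ i j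
    have h1 := hasDerivAt_adjugate_conj (g := fun t : ℝ => G (y + t) ζ) (t := t) (c := c ζ)
      (fun i => hF.hasDerivAt_zero (hB t ht).1 (hr0 ζ hζ) i)
      (fun i => hF.hasDerivAt_one (hB t ht).1 (hr0 ζ hζ) i) i j
    rw [← hc.eq_adjugate hF hr (hB t ht).1 hζ] at h1
    refine h1.congr_of_eventuallyEq ?_
    filter_upwards [isOpen_Ioo.mem_nhds ht] with s hs
    rw [hc.eq_adjugate hF hr (hB s hs).1 hζ]
  have hNB : ∀ t ∈ Set.Ioo (-ε) ε, ∀ ζ ∈ circle r, ∀ i j,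
      ‖N (y + t) ζ i j‖ ≤ 2 * (2 * (B * C) * B) := by
    intro t ht ζ hζ
    rw [hc.eq_adjugate hF hr (hB t ht).1 hζ]
    have hG := ((hB t ht).2 ζ hζ).1
    refine norm_mul_apply_le (norm_mul_apply_le ?_ (hC ζ hζ)) hG
    intro i j
    rw [Matrix.adjugate_fin_two]
    fin_cases i <;> fin_cases j <;> simp [hG]
  have hΩB : ∀ t ∈ Set.Ioo (-ε) ε, ∀ ζ ∈ circle r, ∀ i j, ‖Ω t ζ i j‖ ≤ B := by
    intro t ht ζ hζ i j
    obtain ⟨-, h1, h2, h3⟩ := (hB t ht).2 ζ hζ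
    fin_cases i <;> fin_cases j <;> simp [Ω, h1, h2, h3]
  have hpos := (hc y hy).1
  have hy0 : y + ((0 : ℝ) : ℂ) = y := by simp
  let T : Mat2 := !![θ y 1, 0; 0, -θ y 1]
  let A : Mat2 := !![0, p y; q y, 0]
  let A' : Mat2 := !![0, β y; γ y, 0]
  -- Only the part `ζ⁻¹ • A` has a pole, so `[N, Ω]` is `ζ⁻¹ [N, A]` plus a term holomorphic in the
  -- disc.
  have hsplit : ∀ ζ, Ω 0 ζ = ζ⁻¹ • A + ζ • A' + T := by
    intro ζ
    ext i j
    fin_cases i <;> fin_cases j <;> simp [Ω, A, A', T]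
  have hid : DiffContOnCl ℂ (fun ζ : ℂ => ζ) (Metric.ball 0 r) := differentiable_id.diffContOnCl
  have key : ∀ i j, (N y 0 * A - A * N y 0) i j = 0 := by
    intro i j
    have hsub : circle r ⊆ closure (Metric.ball 0 r) := by
      rw [closure_ball _ hr.ne', circle_eq_sphere]; exact Metric.sphere_subset_closedBall
    have hu : DiffContOnCl ℂ (fun ζ => (N y ζ * A - A * N y ζ) i j) (Metric.ball 0 r) :=
      ((hpos.mul_const A).sub (hpos.const_mul A)) i j
    have hw : DiffContOnCl ℂ (fun ζ => ζ * (N y ζ * A' - A' * N y ζ) i j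
        + (N y ζ * T - T * N y ζ) i j) (Metric.ball 0 r) :=
      (DiffContOnCl.mul' hid (((hpos.mul_const A').sub (hpos.const_mul A')) i j)).add
        (((hpos.mul_const T).sub (hpos.const_mul T)) i j)
    have heq : ∀ ζ, (N y ζ * Ω 0 ζ - Ω 0 ζ * N y ζ) i j = ζ⁻¹ * (N y ζ * A - A * N y ζ) i j
        + (ζ * (N y ζ * A' - A' * N y ζ) i j + (N y ζ * T - T * N y ζ) i j) := by
      intro ζ
      rw [hsplit]
      simp only [mul_add, add_mul, Matrix.mul_smul, Matrix.smul_mul, Matrix.sub_apply,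
        Matrix.add_apply, Matrix.smul_apply, smul_eq_mul]
      ring
    refine eq_zero_of_circleIntegral hr hu hw ?_
    -- For each `t` the integral of `N (y + t)` vanishes by Cauchy's theorem. Its derivative at `t =
    -- 0` is the integral of `[N, Ω]`, whose residue is the commutator at the origin.
    have := circleIntegral_deriv_eq_zero (f := fun t ζ => N (y + t) ζ i j)
      (f' := fun t ζ => (N (y + t) ζ * Ω t ζ - Ω t ζ * N (y + t) ζ) i j)
      (B := 2 * (2 * (2 * (B * C) * B) * B) + 2 * (B * (2 * (2 * (B * C) * B)))) hr hε
      (fun t ht => (hc _ (hB t ht).1).1.continuousOn hr i j) ?_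
      (fun t ht ζ hζ => hN t ht ζ hζ i j) ?_ ?_
    · simp only [hy0] at this
      exact (circleIntegral.integral_congr hr.le fun ζ _ => (heq ζ).symm).trans this
    · simp only [hy0]
      refine ContinuousOn.congr ?_ fun ζ _ => heq ζ
      refine ((continuousOn_inv₀.mono fun ζ hζ => hr0 ζ hζ).mul (hu.continuousOn.mono hsub)).add
        (hw.continuousOn.mono hsub)
    · intro t ht ζ hζ
      rw [Matrix.sub_apply]
      exact (norm_sub_le _ _).trans (add_le_add
        (norm_mul_apply_le (hNB t ht ζ hζ) (hΩB t ht ζ hζ) i j)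
        (norm_mul_apply_le (hΩB t ht ζ hζ) (hNB t ht ζ hζ) i j))
    · intro t ht
      refine Complex.circleIntegral_eq_zero_of_differentiable_on_off_countable hr.le
        Set.countable_empty ?_ fun z hz => ((hc _ (hB t ht).1).1 i j).differentiableOn.differentiableAt
          (Metric.isOpen_ball.mem_nhds hz.1)
      have := ((hc _ (hB t ht).1).1 i j).continuousOn
      rwa [closure_ball _ hr.ne'] at this
  exact sub_eq_zero.1 (Matrix.ext key)

end StabBy

end Stabilizer

theorem diffContOnCl_dslope {r : ℝ} (hr : 0 < r) {f : ℂ → ℂ}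
    (hf : DiffContOnCl ℂ f (Metric.ball 0 r)) :
    DiffContOnCl ℂ (dslope f 0) (Metric.ball 0 r) := by
  have h0 : Metric.ball (0 : ℂ) r ∈ nhds 0 := Metric.ball_mem_nhds 0 hr
  refine ⟨(Complex.differentiableOn_dslope h0).2 hf.differentiableOn, ?_⟩
  exact (continuousOn_dslope (Filter.mem_of_superset h0 subset_closure)).2
    ⟨hf.continuousOn, hf.differentiableOn.differentiableAt h0⟩

/-- Such an `f` has a zero of infinite order at the origin, so it vanishes in the disc, and on its
boundary by continuity. -/
theorem eq_zero_of_forall_pow_dvd {r : ℝ} (hr : 0 < r) {f : ℂ → ℂ}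
    (hf : DiffContOnCl ℂ f (Metric.ball 0 r))
    (h : ∀ m : ℕ, ∃ g : ℂ → ℂ, DiffContOnCl ℂ g (Metric.ball 0 r) ∧
      ∀ ζ ∈ circle r, f ζ = ζ ^ m * g ζ) : ∀ ζ ∈ circle r, f ζ = 0 := by
  have h0 : Metric.ball (0 : ℂ) r ∈ nhds 0 := Metric.ball_mem_nhds 0 hr
  have hfa : AnalyticOnNhd ℂ f (Metric.ball 0 r) :=
    hf.differentiableOn.analyticOnNhd Metric.isOpen_ball
  have hid : DiffContOnCl ℂ (fun ζ : ℂ => ζ) (Metric.ball 0 r) := differentiable_id.diffContOnCl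
  have htop : analyticOrderAt f 0 = ⊤ := by
    rw [ENat.eq_top_iff_forall_ge]
    intro m
    obtain ⟨g, hg, hfg⟩ := h m
    rw [natCast_le_analyticOrderAt (hfa 0 (Metric.mem_ball_self hr))]
    refine ⟨g, hg.differentiableOn.analyticAt h0, ?_⟩
    have hpow : DiffContOnCl ℂ (fun ζ : ℂ => ζ ^ m * g ζ) (Metric.ball 0 r) :=
      DiffContOnCl.mul' (differentiable_pow m).diffContOnCl hg
    filter_upwards [h0] with ζ hζ
    simpa using DiffContOnCl.eqOn_of_circle hr hf hpow hfg ζ (Metric.ball_subset_closedBall hζ)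
  have hz := hfa.eqOn_zero_of_preconnected_of_eventuallyEq_zero
    (convex_ball (0 : ℂ) r).isPreconnected (Metric.mem_ball_self hr)
    (analyticOrderAt_eq_top.1 htop)
  have hcl : Set.EqOn f 0 (closure (Metric.ball 0 r)) :=
    hz.of_subset_closure hf.continuousOn continuousOn_const subset_closure subset_rfl
  intro ζ hζ
  refine hcl ?_
  rw [closure_ball _ hr.ne']
  rw [circle_eq_sphere] at hζ
  exact Metric.sphere_subset_closedBall hζ

section Stabilizer

variable {V : Set ℂ} {G : ℂ → ℂ → Mat2} {p q β γ : ℂ → ℂ} {θ : ℂ → ℂ → ℂ}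

namespace StabBy

variable {r : ℝ} {c : ℂ → Mat2} {N : ℂ → ℂ → Mat2}

theorem add {c' : ℂ → Mat2} {N' : ℂ → ℂ → Mat2} (hc : StabBy V G r c N)
    (hc' : StabBy V G r c' N') :
    StabBy V G r (fun ζ => c ζ + c' ζ) (fun y ζ => N y ζ + N' y ζ) := fun y hy =>
  ⟨(hc y hy).1.add (hc' y hy).1, fun ζ hζ => by
    rw [mul_add, add_mul, (hc y hy).2 ζ hζ, (hc' y hy).2 ζ hζ]⟩

theorem sub {c' : ℂ → Mat2} {N' : ℂ → ℂ → Mat2} (hc : StabBy V G r c N)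
    (hc' : StabBy V G r c' N') :
    StabBy V G r (fun ζ => c ζ - c' ζ) (fun y ζ => N y ζ - N' y ζ) := fun y hy =>
  ⟨(hc y hy).1.sub (hc' y hy).1, fun ζ hζ => by
    rw [mul_sub, sub_mul, (hc y hy).2 ζ hζ, (hc' y hy).2 ζ hζ]⟩

/-- One division by `ζ`; `dslope` supplies the holomorphic quotient including its value at the
origin. -/
theorem divide (hc : StabBy V G r c N) (hr : 0 < r) (h0 : ∀ y ∈ V, N y 0 = 0) :
    StabBy V G r (fun ζ => ζ⁻¹ • c ζ)
      (fun y ζ => Matrix.of fun i j => dslope (fun ζ => N y ζ i j) 0 ζ) := by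
  intro y hy
  refine ⟨fun i j => diffContOnCl_dslope hr ((hc y hy).1 i j), fun ζ hζ => ?_⟩
  have hζ0 := ne_zero_of_mem_circle hr hζ
  have : (Matrix.of fun i j => dslope (fun ζ => N y ζ i j) 0 ζ) = ζ⁻¹ • N y ζ := by
    ext i j
    rw [Matrix.of_apply, dslope_of_ne _ hζ0, slope_def_field, h0 y hy]
    simp [div_eq_inv_mul]
  change G y ζ * (Matrix.of fun i j => dslope (fun ζ => N y ζ i j) 0 ζ) = ζ⁻¹ • c ζ * G y ζ
  rw [this, Matrix.mul_smul, (hc y hy).2 ζ hζ, Matrix.smul_mul]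

theorem eqOn_closedBall_trace (hc : StabBy V G r c N) (hF : IsLocalFrame V G p q β γ θ)
    (hr : 0 < r) (htr : ∀ ζ ∈ circle r, (c ζ).trace = 0) {y : ℂ} (hy : y ∈ V) :
    (N y 0).trace = 0 := by
  refine DiffContOnCl.eqOn_of_circle (f := fun ζ => (N y ζ).trace) (g := fun _ => 0) hr
    (hc y hy).1.trace diffContOnCl_const (fun ζ hζ => ?_) 0
    (Metric.mem_closedBall_self hr.le)
  rw [hc.eq_adjugate hF hr hy hζ, Matrix.trace_mul_comm, ← mul_assoc, Matrix.mul_adjugate,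
    hF.det_eq_one y hy ζ (ne_zero_of_mem_circle hr hζ), one_smul, one_mul, htr ζ hζ]

/-- On the circle both determinants equal `det c`, and the boundary values determine a holomorphic
function on the disc. -/
theorem det_zero_eq (hc : StabBy V G r c N) (hF : IsLocalFrame V G p q β γ θ)
    (hr : 0 < r) {y y' : ℂ} (hy : y ∈ V) (hy' : y' ∈ V) : (N y 0).det = (N y' 0).det := by
  refine DiffContOnCl.eqOn_of_circle (f := fun ζ => (N y ζ).det) (g := fun ζ => (N y' ζ).det) hr
    (hc y hy).1.det (hc y' hy').1.det (fun ζ hζ => ?_) 0 (Metric.mem_closedBall_self hr.le)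
  have hdet : ∀ y ∈ V, (N y ζ).det = (c ζ).det := by
    intro y hy
    have := congrArg Matrix.det ((hc y hy).2 ζ hζ)
    simpa [Matrix.det_mul, hF.det_eq_one y hy ζ (ne_zero_of_mem_circle hr hζ)] using this
  rw [hdet y hy, hdet y' hy']

/-- A trace free matrix which commutes with `[[0, p], [q, 0]]`, `p ≠ 0`, is a multiple of it. -/
theorem zero_zero_eq_zero (hc : StabBy V G r c N) (hF : IsLocalFrame V G p q β γ θ)
    (hr : 0 < r) (htr : ∀ ζ ∈ circle r, (c ζ).trace = 0) {y : ℂ} (hy : y ∈ V) (hp : p y ≠ 0) :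
    N y 0 0 0 = 0 ∧ N y 0 1 1 = 0 ∧ N y 0 0 1 * q y = N y 0 1 0 * p y := by
  have h1 := hc.commute_zero hF hr hy
  have h2 := hc.eqOn_closedBall_trace hF hr htr hy
  rw [Matrix.trace_fin_two] at h2
  have h01 := congrFun (congrFun h1 0) 1
  have h00 := congrFun (congrFun h1 0) 0
  simp only [Matrix.mul_apply, Fin.sum_univ_two, Matrix.of_apply, Matrix.cons_val', Matrix.cons_val_zero,
    Matrix.cons_val_one, Matrix.cons_val_fin_one] at h01 h00
  have h3 : N y 0 0 0 = 0 := by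
    have : N y 0 0 0 * p y = 0 := by linear_combination (1 / 2 : ℂ) * h01 + (p y / 2) * h2
    exact (mul_eq_zero.1 this).resolve_right hp
  refine ⟨h3, by linear_combination h2 - h3, by linear_combination h00⟩

/-- A nonzero trace free loop which is conjugated to positive loops by the frame can be
normalized by a power of `ζ` to have a nonzero value at the origin. -/
theorem exists_normalized (hc : StabBy V G r c N) (hF : IsLocalFrame V G p q β γ θ)
    (hr : 0 < r) (htr : ∀ ζ ∈ circle r, (c ζ).trace = 0)
    (hp : ∀ y ∈ V, p y ≠ 0) (hq : ∀ y ∈ V, q y ≠ 0) {y₁ : ℂ} (hy₁ : y₁ ∈ V)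
    (hne : ∃ ζ ∈ circle r, c ζ ≠ 0) :
    ∃ (m : ℕ) (N' : ℂ → ℂ → Mat2), StabBy V G r (fun ζ => (ζ⁻¹) ^ m • c ζ) N' ∧
      ∀ y ∈ V, N' y 0 0 0 = 0 ∧ N' y 0 1 1 = 0 ∧ N' y 0 0 1 * q y = N' y 0 1 0 * p y ∧
        N' y 0 0 1 ≠ 0 := by
  classical
  have htr' : ∀ m : ℕ, ∀ ζ ∈ circle r, (ζ⁻¹ ^ m • c ζ).trace = 0 := by
    intro m ζ hζ
    rw [Matrix.trace_smul, htr ζ hζ, smul_zero]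
  -- Division by `ζ` cannot go on forever, since a loop divisible by all powers is zero. The
  -- exponent sought is the last admissible one.
  have hex : ∃ m : ℕ, ¬ ∃ N' : ℂ → ℂ → Mat2, StabBy V G r (fun ζ => (ζ⁻¹) ^ m • c ζ) N' := by
    by_contra! hall
    obtain ⟨ζ, hζ, hcζ⟩ := hne
    apply hcζ
    have hN0 : N y₁ ζ = 0 := by
      ext i j
      refine eq_zero_of_forall_pow_dvd hr ((hc y₁ hy₁).1 i j) (fun m => ?_) ζ hζ
      obtain ⟨N', hN'⟩ := hall m
      refine ⟨_, (hN' y₁ hy₁).1 i j, fun ζ hζ => ?_⟩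
      have hζ0 := ne_zero_of_mem_circle hr hζ
      rw [hN'.eq_adjugate hF hr hy₁ hζ, hc.eq_adjugate hF hr hy₁ hζ, Matrix.mul_smul,
        Matrix.smul_mul, Matrix.smul_apply, smul_eq_mul, ← mul_assoc, ← mul_pow,
        mul_inv_cancel₀ hζ0, one_pow, one_mul]
    rw [hc.eq_conj hF hr hy₁ hζ, hN0, mul_zero, zero_mul]
  obtain ⟨m, hm⟩ : ∃ m, Nat.find hex = m + 1 := by
    refine Nat.exists_eq_succ_of_ne_zero fun h0 => ?_
    have := Nat.find_spec hex
    rw [h0] at this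
    exact this ⟨N, by simpa using hc⟩
  have hnot := Nat.find_spec hex
  have hlt := Nat.find_min hex (m := m) (by omega)
  rw [hm] at hnot
  push Not at hlt
  obtain ⟨N', hN'⟩ := hlt
  have hz := fun y hy => hN'.zero_zero_eq_zero hF hr (htr' m) (y := y) hy (hp y hy)
  refine ⟨m, N', hN', fun y hy => ⟨(hz y hy).1, (hz y hy).2.1, (hz y hy).2.2, fun h01 => ?_⟩⟩
  apply hnot
  -- The value at the origin is a multiple of `[[0, p], [q, 0]]` and has a determinant independent
  -- of the point. With `p q ≠ 0`, it vanishes everywhere on `V` as soon as it vanishes once, and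
  -- then one more division would be possible.
  have hzero : ∀ y' ∈ V, N' y' 0 = 0 := by
    intro y' hy'
    have hd := hN'.det_zero_eq hF hr hy hy'
    obtain ⟨h1, h2, h3⟩ := hz y' hy'
    rw [Matrix.det_fin_two, Matrix.det_fin_two, h1, h01, (hz y hy).1] at hd
    have h4 : N' y' 0 0 1 * N' y' 0 1 0 = 0 := by linear_combination hd
    have h5 : N' y' 0 0 1 = 0 := by
      have h6 : N' y' 0 0 1 * N' y' 0 0 1 * q y' = 0 := by
        linear_combination N' y' 0 0 1 * h3 + p y' * h4
      simpa [hq y' hy'] using h6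
    have h7 : N' y' 0 1 0 = 0 := by
      rw [h5, zero_mul] at h3
      exact (mul_eq_zero.1 h3.symm).resolve_right (hp y' hy')
    ext i j
    fin_cases i <;> fin_cases j
    · exact h1
    · exact h5
    · exact h7
    · exact h2
  have := hN'.divide hr hzero
  simp only [smul_smul, ← pow_succ'] at this
  exact ⟨_, this⟩

/-- After normalization the value at the origin is a nonzero multiple of the invertible matrix `[[0,
p], [q, 0]]`; if `det c` vanished on the whole circle, so would the determinant of that value. -/
theorem exists_det_ne_zero (hc : StabBy V G r c N) (hF : IsLocalFrame V G p q β γ θ)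
    (hr : 0 < r) (htr : ∀ ζ ∈ circle r, (c ζ).trace = 0)
    (hp : ∀ y ∈ V, p y ≠ 0) (hq : ∀ y ∈ V, q y ≠ 0) {y₁ : ℂ} (hy₁ : y₁ ∈ V)
    (hne : ∃ ζ ∈ circle r, c ζ ≠ 0) : ∃ ζ ∈ circle r, (c ζ).det ≠ 0 := by
  obtain ⟨m, N', hN', h⟩ := hc.exists_normalized hF hr htr hp hq hy₁ hne
  obtain ⟨h1, h2, h3, h4⟩ := h y₁ hy₁
  by_contra! hall
  have hd : (N' y₁ 0).det = 0 := by
    refine DiffContOnCl.eqOn_of_circle (f := fun ζ => (N' y₁ ζ).det) (g := fun _ => 0) hr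
      (hN' y₁ hy₁).1.det diffContOnCl_const (fun ζ hζ => ?_) 0 (Metric.mem_closedBall_self hr.le)
    have hζ0 := ne_zero_of_mem_circle hr hζ
    have := congrArg Matrix.det ((hN' y₁ hy₁).2 ζ hζ)
    simpa [Matrix.det_mul, hF.det_eq_one y₁ hy₁ ζ hζ0, Matrix.det_smul, hall ζ hζ] using this
  rw [Matrix.det_fin_two, h1] at hd
  have h5 : N' y₁ 0 1 0 = 0 := by
    have : N' y₁ 0 0 1 * N' y₁ 0 1 0 = 0 := by linear_combination -hd
    exact (mul_eq_zero.1 this).resolve_left h4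
  rw [h5, zero_mul] at h3
  exact (mul_ne_zero h4 (hq y₁ hy₁)) h3

/-- Two trace free loops which are conjugated to positive loops by the frame are not orthogonal
with respect to the trace form, unless one of them vanishes. -/
theorem eq_zero_or_eq_zero {c' : ℂ → Mat2} {N' : ℂ → ℂ → Mat2} (hc : StabBy V G r c N)
    (hc' : StabBy V G r c' N') (hF : IsLocalFrame V G p q β γ θ)
    (hr : 0 < r) (htr : ∀ ζ ∈ circle r, (c ζ).trace = 0)
    (htr' : ∀ ζ ∈ circle r, (c' ζ).trace = 0)
    (hp : ∀ y ∈ V, p y ≠ 0) (hq : ∀ y ∈ V, q y ≠ 0) {y₁ : ℂ} (hy₁ : y₁ ∈ V)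
    (horth : ∀ ζ ∈ circle r, (c ζ * c' ζ).trace = 0) :
    (∀ ζ ∈ circle r, c ζ = 0) ∨ ∀ ζ ∈ circle r, c' ζ = 0 := by
  by_contra! hcon
  obtain ⟨hne, hne'⟩ := hcon
  obtain ⟨m, L, hL, h⟩ := hc.exists_normalized hF hr htr hp hq hy₁ hne
  obtain ⟨m', L', hL', h'⟩ := hc'.exists_normalized hF hr htr' hp hq hy₁ hne'
  obtain ⟨h1, h2, h3, h4⟩ := h y₁ hy₁
  obtain ⟨h1', h2', h3', h4'⟩ := h' y₁ hy₁
  -- Orthogonality passes from the circle to the origin. There both normalized values are nonzero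
  -- multiples of `[[0, p], [q, 0]]`, whose square is `p q • 1`, so their product has nonzero trace.
  have hd : (L y₁ 0 * L' y₁ 0).trace = 0 := by
    refine DiffContOnCl.eqOn_of_circle (f := fun ζ => (L y₁ ζ * L' y₁ ζ).trace) (g := fun _ => 0)
      hr ((hL y₁ hy₁).1.mul (hL' y₁ hy₁).1).trace diffContOnCl_const (fun ζ hζ => ?_) 0
      (Metric.mem_closedBall_self hr.le)
    have hζ0 := ne_zero_of_mem_circle hr hζ
    have hG : G y₁ ζ * (G y₁ ζ).adjugate = 1 := by
      rw [Matrix.mul_adjugate, hF.det_eq_one y₁ hy₁ ζ hζ0, one_smul]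
    rw [hL.eq_adjugate hF hr hy₁ hζ, hL'.eq_adjugate hF hr hy₁ hζ]
    have : (G y₁ ζ).adjugate * (ζ⁻¹ ^ m • c ζ) * G y₁ ζ
        * ((G y₁ ζ).adjugate * (ζ⁻¹ ^ m' • c' ζ) * G y₁ ζ)
        = (G y₁ ζ).adjugate * ((ζ⁻¹ ^ m * ζ⁻¹ ^ m') • (c ζ * c' ζ) * G y₁ ζ) := by
      calc _ = (G y₁ ζ).adjugate * ((ζ⁻¹ ^ m • c ζ) * (G y₁ ζ * (G y₁ ζ).adjugate)
            * (ζ⁻¹ ^ m' • c' ζ) * G y₁ ζ) := by simp only [mul_assoc]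
        _ = _ := by
          rw [hG, mul_one, Matrix.smul_mul, Matrix.mul_smul, smul_smul]
    rw [this, Matrix.trace_mul_comm, mul_assoc, hG, mul_one, Matrix.trace_smul, horth ζ hζ,
      smul_zero]
  rw [Matrix.trace_fin_two] at hd
  simp only [Matrix.mul_apply, Fin.sum_univ_two, h1, h1', h2, h2'] at hd
  have h5 : L y₁ 0 0 1 * L' y₁ 0 0 1 * q y₁ = 0 := by
    linear_combination (1 / 2 : ℂ) * p y₁ * hd + (1 / 2 : ℂ) * L y₁ 0 0 1 * h3'
      + (1 / 2 : ℂ) * L' y₁ 0 0 1 * h3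
  exact mul_ne_zero (mul_ne_zero h4 h4') (hq y₁ hy₁) h5

end StabBy

end Stabilizer

/-! ### Frames whose Hopf differential vanishes. -/

theorem mem_specialUnitaryGroup_fin_two {g : Mat2}
    (hg : g ∈ Matrix.specialUnitaryGroup (Fin 2) ℂ) :
    g 1 1 = conj (g 0 0) ∧ g 1 0 = -conj (g 0 1) := by
  obtain ⟨h1, h2⟩ := Matrix.mem_specialUnitaryGroup_iff.1 hg
  have h3 : star g * g = 1 := (Matrix.mem_unitaryGroup_iff').1 h1
  have h4 : star g = g.adjugate := by
    calc star g = star g * (g * g.adjugate) := by rw [Matrix.mul_adjugate, h2, one_smul, mul_one]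
      _ = g.adjugate := by rw [← mul_assoc, h3, one_mul]
  have h5 := congrFun (congrFun h4 0) 0
  have h6 := congrFun (congrFun h4 1) 0
  simp only [Matrix.star_apply, Matrix.adjugate_fin_two, Matrix.of_apply, Matrix.cons_val',
    Matrix.cons_val_zero, Matrix.cons_val_one, Matrix.cons_val_fin_one] at h5 h6
  exact ⟨h5.symm, by rw [← neg_eq_iff_eq_neg]; exact h6.symm⟩

/-- A smooth function with `df = A dy + B dȳ` and `A B = 0` has a holomorphic `A`. -/
theorem differentiableOn_of_mul_eq_zero {V : Set ℂ} (hV : IsOpen V) {f A B : ℂ → ℂ}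
    (hf : ContDiffOn ℝ ∞ f V) (hd : ∀ y ∈ V, ∀ v, fderiv ℝ f y v = v * A y + conj v * B y)
    (hAB : ∀ y ∈ V, A y * B y = 0) : DifferentiableOn ℂ A V := by
  have hD : ∀ v : ℂ, ContDiffOn ℝ ∞ (fun y => fderiv ℝ f y v) V := fun v =>
    (hf.fderiv_of_isOpen hV (by simp)).clm_apply contDiffOn_const
  have hA : ContDiffOn ℝ ∞ A V :=
    (contDiffOn_const.mul ((hD 1).sub (contDiffOn_const.mul (hD Complex.I)))).congr
      (f := fun y => (1 / 2 : ℂ) * (fderiv ℝ f y 1 - Complex.I * fderiv ℝ f y Complex.I))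
      fun y hy => by
        rw [hd y hy, hd y hy, map_one, Complex.conj_I]
        linear_combination (A y / 2 - B y / 2) * Complex.I_sq
  have hB : ContDiffOn ℝ ∞ B V := ((hD 1).sub hA).congr fun y hy => by rw [hd y hy]; simp
  have hAd : ∀ y ∈ V, DifferentiableAt ℝ A y := fun y hy =>
    (hA.contDiffAt (hV.mem_nhds hy)).differentiableAt (by simp)
  have hBd : ∀ y ∈ V, DifferentiableAt ℝ B y := fun y hy =>
    (hB.contDiffAt (hV.mem_nhds hy)).differentiableAt (by simp)
  -- `E` is `-2i ∂̄A`. The symmetry of the second derivative of `f` turns it into `-2i ∂B` in `hEB`.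
  let E : ℂ → ℂ := fun y => fderiv ℝ A y Complex.I - Complex.I * fderiv ℝ A y 1
  have hE : ContinuousOn E V := by
    have h1 : ∀ v : ℂ, ContinuousOn (fun y => fderiv ℝ A y v) V := fun v =>
      ((hA.fderiv_of_isOpen (m := 0) hV (by simp)).clm_apply contDiffOn_const).continuousOn
    exact (h1 _).sub (continuousOn_const.mul (h1 _))
  have hEB : ∀ y ∈ V, E y = -(fderiv ℝ B y Complex.I + Complex.I * fderiv ℝ B y 1) := by
    intro y hy
    have hfy := hf.contDiffAt (hV.mem_nhds hy)
    have hsymm := hfy.isSymmSndFDerivAt (by simpa using WithTop.coe_le_coe.2 (le_top : (2 : ℕ∞) ≤ ⊤)) 1 Complex.I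
    have hdd : DifferentiableAt ℝ (fderiv ℝ f) y :=
      (hfy.fderiv_right (m := ∞) (by simp)).differentiableAt (by simp)
    have h2 : ∀ v w : ℂ, fderiv ℝ (fderiv ℝ f) y w v
        = v * fderiv ℝ A y w + conj v * fderiv ℝ B y w := by
      intro v w
      have h3 : fderiv ℝ (fun y => fderiv ℝ f y v) y w = fderiv ℝ (fderiv ℝ f) y w v := by
        rw [fderiv_clm_apply hdd (differentiableAt_const v)]
        simp
      rw [← h3]
      have h4 : (fun y => fderiv ℝ f y v) =ᶠ[nhds y] fun y => v * A y + conj v * B y := by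
        filter_upwards [hV.mem_nhds hy] with x hx using hd x hx v
      rw [h4.fderiv_eq, fderiv_fun_add ((hAd y hy).const_mul v) ((hBd y hy).const_mul _),
        fderiv_const_mul (hAd y hy), fderiv_const_mul (hBd y hy)]
      simp
    rw [h2, h2, map_one (starRingEnd ℂ), Complex.conj_I] at hsymm
    simp only [E]
    linear_combination -hsymm
  have hz : ∀ y ∈ V, E y = 0 := by
    intro y hy
    -- Where `A ≠ 0`, the function `B` vanishes nearby, hence so does `∂B`; continuity of `E` covers
    -- the closure. Off the closure `A` itself vanishes nearby.
    by_cases hcl : y ∈ closure (V ∩ {x | A x ≠ 0})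
    · have hzero : Set.EqOn E 0 (V ∩ {x | A x ≠ 0}) := by
        intro x hx
        have hBx : B =ᶠ[nhds x] fun _ => 0 := by
          have h1 : ∀ᶠ w in nhds x, A w ≠ 0 := (hAd x hx.1).continuousAt.eventually_ne hx.2
          filter_upwards [h1, hV.mem_nhds hx.1] with w hw hwV
          exact (mul_eq_zero.1 (hAB w hwV)).resolve_left hw
        rw [hEB x hx.1, hBx.fderiv_eq]
        simp
      have := hE.mono (Set.inter_subset_left : V ∩ closure (V ∩ {x | A x ≠ 0}) ⊆ V)
      exact hzero.of_subset_closure (this) continuousOn_const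
        (fun x hx => ⟨hx.1, subset_closure hx⟩) Set.inter_subset_right ⟨hy, hcl⟩
    · have hA0 : A =ᶠ[nhds y] fun _ => 0 := by
        have h1 : (closure (V ∩ {x | A x ≠ 0}))ᶜ ∈ nhds y := isClosed_closure.isOpen_compl.mem_nhds hcl
        filter_upwards [h1, hV.mem_nhds hy] with w hw hwV
        by_contra hne
        exact hw (subset_closure ⟨hwV, hne⟩)
      simp only [E]
      rw [hA0.fderiv_eq]
      simp
  intro y hy
  refine DifferentiableAt.differentiableWithinAt ?_
  rw [differentiableAt_complex_iff_differentiableAt_real]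
  exact ⟨hAd y hy, by rw [smul_eq_mul]; exact sub_eq_zero.1 (hz y hy)⟩

section LocalFrame

variable {V : Set ℂ} {G : ℂ → ℂ → Mat2} {p q β γ : ℂ → ℂ} {θ : ℂ → ℂ → ℂ}

theorem fderiv_conj_comp {f : ℂ → ℂ} {y : ℂ} (hf : DifferentiableAt ℝ f y) (v : ℂ) :
    fderiv ℝ (fun y => conj (f y)) y v = conj (fderiv ℝ f y v) := by
  have h1 : HasFDerivAt (fun y => conj (f y)) ((Complex.conjCLE : ℂ →L[ℝ] ℂ).comp (fderiv ℝ f y)) y :=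
    (Complex.conjCLE : ℂ →L[ℝ] ℂ).hasFDerivAt.comp y hf.hasFDerivAt
  rw [h1.fderiv]
  simp

namespace IsLocalFrame

variable (h : IsLocalFrame V G p q β γ θ)
  (hu : ∀ y ∈ V, G y 1 ∈ Matrix.specialUnitaryGroup (Fin 2) ℂ)
include h hu

/-- The reality conditions of the Maurer--Cartan form of a unitary frame. -/
theorem eq_neg_conj {y : ℂ} (hy : y ∈ V) : q y = -conj (β y) ∧ γ y = -conj (p y) := by
  have hnhds := h.isOpen.mem_nhds hy
  have h11 : ∀ v, fderiv ℝ (fun y => G y 1 1 1) y v = conj (fderiv ℝ (fun y => G y 1 0 0) y v) := by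
    intro v
    rw [← fderiv_conj_comp (h.differentiableAt hy one_ne_zero 0 0)]
    refine congrArg (fun L : ℂ →L[ℝ] ℂ => L v) (Filter.EventuallyEq.fderiv_eq ?_)
    filter_upwards [hnhds] with x hx using (mem_specialUnitaryGroup_fin_two (hu x hx)).1
  have h10 : ∀ v, fderiv ℝ (fun y => G y 1 1 0) y v
      = -conj (fderiv ℝ (fun y => G y 1 0 1) y v) := by
    intro v
    have h1 : fderiv ℝ (fun y => G y 1 1 0) y = fderiv ℝ (fun y => -conj (G y 1 0 1)) y := by
      refine Filter.EventuallyEq.fderiv_eq ?_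
      filter_upwards [hnhds] with x hx using (mem_specialUnitaryGroup_fin_two (hu x hx)).2
    rw [h1, fderiv_fun_neg, neg_apply,
      fderiv_conj_comp (h.differentiableAt hy one_ne_zero 0 1)]
  have key : ∀ v, v * q y + conj v * γ y = -(conj v * conj (p y) + v * conj (β y)) := by
    intro v
    have hl := h.lower_eq hy one_ne_zero v
    have hup := congrArg conj (h.upper_eq hy one_ne_zero v)
    rw [h10] at hl
    rw [h11, (mem_specialUnitaryGroup_fin_two (hu y hy)).1] at hup
    rw [(mem_specialUnitaryGroup_fin_two (hu y hy)).2] at hl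
    simp only [map_add, map_mul, map_sub, Complex.conj_conj, inv_one, one_mul] at hl hup
    linear_combination hl + hup
  have k1 := key 1
  have k2 := key Complex.I
  simp only [map_one, Complex.conj_I] at k1 k2
  constructor
  · linear_combination (1 / 2 : ℂ) * k1 - (Complex.I / 2) * k2
      + (q y / 2 - γ y / 2 + conj (β y) / 2 - conj (p y) / 2) * Complex.I_sq
  · linear_combination (1 / 2 : ℂ) * k1 + (Complex.I / 2) * k2
      - (q y / 2 - γ y / 2 + conj (β y) / 2 - conj (p y) / 2) * Complex.I_sq

/-- If `p q = 0`, then `p` and `q` are, up to nonvanishing factors, an antiholomorphic and a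
holomorphic function locally. -/
theorem exists_ball (hpq : ∀ y ∈ V, p y * q y = 0) {y₀ : ℂ} (hy₀ : y₀ ∈ V) :
    ∃ ρ > 0, Metric.ball y₀ ρ ⊆ V ∧ ∃ A B : ℂ → ℂ, DifferentiableOn ℂ A (Metric.ball y₀ ρ) ∧
      DifferentiableOn ℂ B (Metric.ball y₀ ρ) ∧
      (∀ y ∈ Metric.ball y₀ ρ, A y = 0 ↔ q y = 0) ∧ ∀ y ∈ Metric.ball y₀ ρ, B y = 0 ↔ p y = 0 := by
  set g := (G y₀ 1).adjugate with hg
  let n : Fin 2 → Fin 2 → ℂ → ℂ := fun i j y => g i 0 * G y 1 0 j + g i 1 * G y 1 1 j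
  have hmul : ∀ y i j, n i j y = (g * G y 1) i j := by
    intro y i j
    simp [n, Matrix.mul_apply, Fin.sum_univ_two]
  have hn0 : n 0 0 y₀ = 1 := by
    rw [hmul, hg, Matrix.adjugate_mul, h.det_eq_one y₀ hy₀ 1 one_ne_zero]
    simp
  have hns : ∀ i j, ContDiffOn ℝ ∞ (n i j) V := fun i j =>
    (contDiffOn_const.mul (h.smooth 1 one_ne_zero 0 j)).add
      (contDiffOn_const.mul (h.smooth 1 one_ne_zero 1 j))
  have hev : ∀ᶠ y in nhds y₀, y ∈ V ∧ n 0 0 y ≠ 0 := by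
    refine Filter.Eventually.and (h.isOpen.mem_nhds hy₀) ?_
    refine ((hns 0 0).continuousOn.continuousAt (h.isOpen.mem_nhds hy₀)).eventually_ne ?_
    rw [hn0]; exact one_ne_zero
  obtain ⟨ρ, hρ, hball⟩ := Metric.eventually_nhds_iff_ball.1 hev
  set U := Metric.ball y₀ ρ
  have hUV : U ⊆ V := fun y hy => (hball y hy).1
  have hU0 : ∀ y ∈ U, n 0 0 y ≠ 0 := fun y hy => (hball y hy).2
  have hdetn : ∀ y ∈ U, n 0 0 y * n 1 1 y - n 0 1 y * n 1 0 y = 1 := by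
    intro y hy
    simp only [hmul]
    rw [← Matrix.det_fin_two, Matrix.det_mul, h.det_eq_one y (hUV hy) 1 one_ne_zero, hg,
      Matrix.det_adjugate, h.det_eq_one y₀ hy₀ 1 one_ne_zero]
    simp
  have hfd : ∀ y ∈ U, ∀ i v, fderiv ℝ (n i 0) y v
      = n i 0 y * θ y v + n i 1 y * (v * q y + conj v * γ y) := by
    intro y hy i v
    have hd := fun k => h.differentiableAt (hUV hy) one_ne_zero k 0
    simp only [n]
    rw [fderiv_fun_add ((hd 0).const_mul _) ((hd 1).const_mul _), fderiv_const_mul (hd 0),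
      fderiv_const_mul (hd 1)]
    simp only [add_apply, smul_apply, smul_eq_mul,
      h.fderiv_zero y (hUV hy) 1 one_ne_zero]
    simp only [inv_one]
    ring
  -- In this quotient from the first column of `G(y₀)⁻¹ G(y)` the diagonal form `θ` cancels, leaving
  -- `df = (q dy + γ dȳ) / n₀₀²`. Since `γ = -conj p`, the two coefficients have product zero.
  let f : ℂ → ℂ := fun y => n 1 0 y * (n 0 0 y)⁻¹
  have hfs : ContDiffOn ℝ ∞ f U := ((hns 1 0).mono hUV).mul (((hns 0 0).mono hUV).inv hU0)
  have hff : ∀ y ∈ U, ∀ v, fderiv ℝ f y v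
      = v * (q y / n 0 0 y ^ 2) + conj v * (γ y / n 0 0 y ^ 2) := by
    intro y hy v
    have hd := fun k => ((hns k 0).contDiffAt (h.isOpen.mem_nhds (hUV hy))).differentiableAt (by simp)
    have hi : HasFDerivAt (fun y => (n 0 0 y)⁻¹) _ y :=
      ((hasDerivAt_inv (hU0 y hy)).hasFDerivAt.restrictScalars ℝ).comp y (hd 0).hasFDerivAt
    have hq : HasFDerivAt f _ y := (hd 1).hasFDerivAt.mul hi
    rw [hq.fderiv]
    have hne := hU0 y hy
    simp [hfd y hy]
    field_simp
    linear_combination (v * q y + conj v * γ y) * hdetn y hy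
  have hconj : ∀ y ∈ U, γ y = -conj (p y) := fun y hy => (h.eq_neg_conj hu (hUV hy)).2
  have hpq' : ∀ y ∈ U, p y = 0 ∨ q y = 0 := fun y hy => mul_eq_zero.1 (hpq y (hUV hy))
  refine ⟨ρ, hρ, hUV, fun y => q y / n 0 0 y ^ 2, fun y => conj (γ y / n 0 0 y ^ 2), ?_, ?_, ?_, ?_⟩
  · refine differentiableOn_of_mul_eq_zero Metric.isOpen_ball hfs hff fun y hy => ?_
    rcases hpq' y hy with h0 | h0
    · simp [hconj y hy, h0]
    · simp [h0]
  -- Conjugation of `f` exchanges the roles of its `dy` and `dȳ` coefficients.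
  · refine differentiableOn_of_mul_eq_zero (f := fun y => conj (f y))
      (B := fun y => conj (q y / n 0 0 y ^ 2)) Metric.isOpen_ball ?_ ?_ fun y hy => ?_
    · exact (Complex.conjCLE : ℂ →L[ℝ] ℂ).contDiff.comp_contDiffOn hfs
    · intro y hy v
      rw [fderiv_conj_comp ((hfs.contDiffAt (Metric.isOpen_ball.mem_nhds hy)).differentiableAt
        (by simp)), hff y hy, map_add, map_mul, map_mul, Complex.conj_conj]
      ring
    · rcases hpq' y hy with h0 | h0
      · simp [hconj y hy, h0]
      · simp [h0]
  · intro y hy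
    simp [hU0 y hy]
  · intro y hy
    simp [hU0 y hy, hconj y hy]

end IsLocalFrame

end LocalFrame

section Frame

variable {X : Type*} [TopologicalSpace X] [ChartedSpace ℂ X]

/-- A function on a connected surface with zero derivative in all charts is constant. -/
theorem eq_of_hasFDerivAt_zero [ConnectedSpace X] {g : X → ℂ}
    (h : ∀ z, ∀ y ∈ (chartAt ℂ z).target,
      HasFDerivAt (g ∘ (chartAt ℂ z).symm) (0 : ℂ →L[ℝ] ℂ) y) (z w : X) : g z = g w := by
  refine IsLocallyConstant.apply_eq_of_preconnectedSpace ?_ z w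
  rw [IsLocallyConstant.iff_eventually_eq]
  intro x
  have hx := mem_chart_source ℂ x
  have hx' := (chartAt ℂ x).map_source hx
  obtain ⟨ρ, hρ, hball⟩ := Metric.isOpen_iff.1 (chartAt ℂ x).open_target _ hx'
  have h1 : ∀ᶠ y in nhds x, chartAt ℂ x y ∈ Metric.ball (chartAt ℂ x x) ρ :=
    ((chartAt ℂ x).continuousAt hx).eventually (Metric.ball_mem_nhds _ hρ)
  filter_upwards [h1, (chartAt ℂ x).open_source.mem_nhds hx] with y hy hys
  have := Metric.isOpen_ball.is_const_of_fderiv_eq_zero (𝕜 := ℝ)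
    (f := g ∘ (chartAt ℂ x).symm) (convex_ball (chartAt ℂ x x) ρ).isPreconnected
    (fun u hu => (h x u (hball hu)).differentiableAt.differentiableWithinAt)
    (fun u hu => (h x u (hball hu)).fderiv) hy (Metric.mem_ball_self hρ)
  simpa [(chartAt ℂ x).left_inv hys, (chartAt ℂ x).left_inv hx] using this

variable [IsManifold 𝓘(ℂ) ω X] {F : X → ℂ → Mat2} {p q β γ : X → ℂ} {θ : X → ℂ → ℂ}

theorem mem_circle_one : (1 : ℂ) ∈ circle 1 := by simp [circle]

theorem IsExtendedFrame.eq_neg_conj (hF : IsExtendedFrame F) (h : IsMaurerCartan F p q β γ θ)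
    (z : X) : q z = -conj (β z) ∧ γ z = -conj (p z) := by
  have hx := mem_chart_source ℂ z
  have hx' := (chartAt ℂ z).map_source hx
  have hT := chartFactor_ne_zero z hx'
  have h1 := (hF.isLocalFrame h z).eq_neg_conj (fun y _ => (hF.loop _).unitary mem_circle_one) hx'
  simp only [(chartAt ℂ z).left_inv hx, map_mul, Complex.conj_conj] at h1
  constructor
  · refine mul_left_cancel₀ hT ?_
    linear_combination h1.1
  · refine mul_left_cancel₀ ((map_ne_zero conj).2 hT) ?_
    linear_combination h1.2

theorem eqOn_zero_ball_of_eventually {A : ℂ → ℂ} {y₀ : ℂ} {ρ : ℝ}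
    (hA : DifferentiableOn ℂ A (Metric.ball y₀ ρ)) {w : ℂ} (hw : w ∈ Metric.ball y₀ ρ)
    (h : ∀ᶠ y in nhds w, A y = 0) : ∀ y ∈ Metric.ball y₀ ρ, A y = 0 :=
  (hA.analyticOnNhd Metric.isOpen_ball).eqOn_zero_of_preconnected_of_eventuallyEq_zero
    (convex_ball y₀ ρ).isPreconnected hw h

/-- The local version of the dichotomy for frames with `p q = 0`. -/
theorem IsExtendedFrame.exists_nhds (hF : IsExtendedFrame F) (h : IsMaurerCartan F p q β γ θ)
    (hpq : ∀ z, p z * q z = 0) (z : X) : ∃ W : Set X, IsOpen W ∧ z ∈ W ∧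
      ((∃ w ∈ W, ∀ᶠ x in nhds w, p x = 0) → ∀ w ∈ W, p w = 0) ∧
      ((∃ w ∈ W, ∀ᶠ x in nhds w, q x = 0) → ∀ w ∈ W, q w = 0) ∧
      ((∀ w ∈ W, p w = 0) ∨ ∀ w ∈ W, q w = 0) := by
  set φ := chartAt ℂ z with hφ
  have hx : z ∈ φ.source := mem_chart_source ℂ z
  have hx' := φ.map_source hx
  have hloc := hF.isLocalFrame h z
  obtain ⟨ρ, hρ, hball, A, B, hA, hB, hAq, hBp⟩ := hloc.exists_ball
    (fun y _ => (hF.loop _).unitary mem_circle_one) (fun y _ => by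
      linear_combination chartFactor z y ^ 2 * hpq ((chartAt ℂ z).symm y)) hx'
  have hAq' : ∀ y ∈ Metric.ball (φ z) ρ, A y = 0 ↔ q (φ.symm y) = 0 := fun y hy => by
    rw [hAq y hy, mul_eq_zero]; simp [chartFactor_ne_zero z (hball hy), hφ]
  have hBp' : ∀ y ∈ Metric.ball (φ z) ρ, B y = 0 ↔ p (φ.symm y) = 0 := fun y hy => by
    rw [hBp y hy, mul_eq_zero]; simp [chartFactor_ne_zero z (hball hy), hφ]
  have htrans : ∀ (f : X → ℂ) (A : ℂ → ℂ), DifferentiableOn ℂ A (Metric.ball (φ z) ρ) →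
      (∀ y ∈ Metric.ball (φ z) ρ, A y = 0 ↔ f (φ.symm y) = 0) →
      (∃ w ∈ φ.source ∩ φ ⁻¹' Metric.ball (φ z) ρ, ∀ᶠ x in nhds w, f x = 0) →
      ∀ w ∈ φ.source ∩ φ ⁻¹' Metric.ball (φ z) ρ, f w = 0 := by
    rintro f A hA hAf ⟨w, hw, hwf⟩ x hx
    have hcont : ContinuousAt φ.symm (φ w) := φ.continuousAt_symm (φ.map_source hw.1)
    have h1 : ∀ᶠ y in nhds (φ w), f (φ.symm y) = 0 := by
      have := hcont.tendsto.eventually (p := fun x => f x = 0)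
      rw [φ.left_inv hw.1] at this
      exact this hwf
    have h2 : ∀ᶠ y in nhds (φ w), A y = 0 := by
      filter_upwards [h1, Metric.isOpen_ball.mem_nhds hw.2] with y hy hyb
      exact (hAf y hyb).2 hy
    have h3 := eqOn_zero_ball_of_eventually hA hw.2 h2 (φ x) hx.2
    rw [hAf _ hx.2, φ.left_inv hx.1] at h3
    exact h3
  refine ⟨φ.source ∩ φ ⁻¹' Metric.ball (φ z) ρ, φ.isOpen_inter_preimage Metric.isOpen_ball,
    ⟨hx, Metric.mem_ball_self hρ⟩, htrans p B hB hBp', htrans q A hA hAq', ?_⟩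
  have hAB : ∀ y ∈ Metric.ball (φ z) ρ, A y = 0 ∨ B y = 0 := by
    intro y hy
    rcases mul_eq_zero.1 (hpq (φ.symm y)) with h0 | h0
    · exact Or.inr ((hBp' y hy).2 h0)
    · exact Or.inl ((hAq' y hy).2 h0)
  have hself : φ z ∈ Metric.ball (φ z) ρ := Metric.mem_ball_self hρ
  -- If `A` is not identically zero, its zeros are isolated, so `B` vanishes on a punctured
  -- neighbourhood and hence on the ball.
  have hcase : (∀ y ∈ Metric.ball (φ z) ρ, A y = 0) ∨ ∀ y ∈ Metric.ball (φ z) ρ, B y = 0 := by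
    have hAa := hA.analyticAt (Metric.isOpen_ball.mem_nhds hself)
    rcases hAa.eventually_eq_zero_or_eventually_ne_zero with h0 | h0
    · exact Or.inl (eqOn_zero_ball_of_eventually hA hself h0)
    · right
      have h1 : ∀ᶠ y in nhdsWithin (φ z) {φ z}ᶜ, B y = 0 := by
        filter_upwards [h0, nhdsWithin_le_nhds (Metric.isOpen_ball.mem_nhds hself)] with y hy hyb
        exact (hAB y hyb).resolve_left hy
      exact (hB.analyticOnNhd Metric.isOpen_ball).eqOn_zero_of_preconnected_of_frequently_eq_zero
        (convex_ball _ _).isPreconnected hself h1.frequently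
  rcases hcase with h0 | h0
  · right
    intro w hw
    have := (hAq' _ hw.2).1 (h0 _ hw.2)
    rwa [φ.left_inv hw.1] at this
  · left
    intro w hw
    have := (hBp' _ hw.2).1 (h0 _ hw.2)
    rwa [φ.left_inv hw.1] at this

/-- The identity theorem on a connected surface: by the local dichotomy, the points near which `p`
(or `q`) vanishes form a clopen set, and one of the two sets is nonempty. -/
theorem IsExtendedFrame.eq_zero_or_eq_zero [ConnectedSpace X] (hF : IsExtendedFrame F)
    (h : IsMaurerCartan F p q β γ θ) (hpq : ∀ z, p z * q z = 0) :
    (∀ z, p z = 0) ∨ ∀ z, q z = 0 := by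
  have hloc := hF.exists_nhds h hpq
  have hclopen : ∀ f : X → ℂ, (∀ z, ∃ W : Set X, IsOpen W ∧ z ∈ W ∧
      ((∃ w ∈ W, ∀ᶠ x in nhds w, f x = 0) → ∀ w ∈ W, f w = 0)) →
      (∃ z, ∀ᶠ x in nhds z, f x = 0) → ∀ z, f z = 0 := by
    intro f hf hex
    have hcl : IsClopen {z | ∀ᶠ x in nhds z, f x = 0} := by
      constructor
      · rw [← isOpen_compl_iff, isOpen_iff_mem_nhds]
        intro z hz
        obtain ⟨W, hW, hzW, himp⟩ := hf z
        filter_upwards [hW.mem_nhds hzW] with w hw hwz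
        exact hz (Filter.mem_of_superset (hW.mem_nhds hzW) (himp ⟨w, hw, hwz⟩))
      · exact isOpen_setOfPred_eventually_nhds
    rcases isClopen_iff.1 hcl with h0 | h0
    · obtain ⟨z, hz⟩ := hex
      exact absurd (show z ∈ (∅ : Set X) from h0 ▸ hz) (Set.notMem_empty z)
    · intro z
      have : z ∈ {z | ∀ᶠ x in nhds z, f x = 0} := h0 ▸ Set.mem_univ z
      exact this.self_of_nhds
  obtain ⟨z⟩ := (inferInstance : Nonempty X)
  obtain ⟨W, hW, hzW, -, -, h0 | h0⟩ := hloc z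
  · left
    refine hclopen p (fun z => ?_) ⟨z, Filter.mem_of_superset (hW.mem_nhds hzW) h0⟩
    obtain ⟨W, hW, hzW, himp, -, -⟩ := hloc z
    exact ⟨W, hW, hzW, himp⟩
  · right
    refine hclopen q (fun z => ?_) ⟨z, Filter.mem_of_superset (hW.mem_nhds hzW) h0⟩
    obtain ⟨W, hW, hzW, -, himp, -⟩ := hloc z
    exact ⟨W, hW, hzW, himp⟩

/-- The expressions are the entries of `G(ζ) diag(d₁, d₂) G(1)⁻¹`. The hypotheses say that `diag(d₁,
d₂)` intertwines the Maurer–Cartan forms at `ζ` and at `1`, so this product is constant. -/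
theorem IsLocalFrame.hasFDerivAt_mul_adjugate {V : Set ℂ} {G : ℂ → ℂ → Mat2} {p q β γ : ℂ → ℂ}
    {θ : ℂ → ℂ → ℂ} (h : IsLocalFrame V G p q β γ θ) {ζ : ℂ} (hζ : ζ ≠ 0) {d₁ d₂ : ℂ}
    (hup : ∀ y ∈ V, ∀ v, d₂ * (ζ⁻¹ * v * p y + ζ * conj v * β y) = d₁ * (v * p y + conj v * β y))
    (hlow : ∀ y ∈ V, ∀ v, d₁ * (ζ⁻¹ * v * q y + ζ * conj v * γ y) = d₂ * (v * q y + conj v * γ y))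
    {y : ℂ} (hy : y ∈ V) (i : Fin 2) :
    HasFDerivAt (fun y => G y ζ i 0 * d₁ * G y 1 1 1 - G y ζ i 1 * d₂ * G y 1 1 0)
      (0 : ℂ →L[ℝ] ℂ) y ∧
    HasFDerivAt (fun y => G y ζ i 1 * d₂ * G y 1 0 0 - G y ζ i 0 * d₁ * G y 1 0 1)
      (0 : ℂ →L[ℝ] ℂ) y := by
  have hd := fun j => (h.differentiableAt hy hζ i j).hasFDerivAt
  have hd1 := fun i j => (h.differentiableAt hy one_ne_zero i j).hasFDerivAt
  constructor
  · refine ((((hd 0).mul_const d₁).mul (hd1 1 1)).sub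
      (((hd 1).mul_const d₂).mul (hd1 1 0))).congr_fderiv ?_
    ext v
    simp [h.fderiv_zero y hy ζ hζ, h.fderiv_one y hy ζ hζ, h.fderiv_zero y hy 1 one_ne_zero,
      h.fderiv_one y hy 1 one_ne_zero]
    linear_combination (-G y ζ i 0 * G y 1 1 0) * hup y hy v
      + (G y ζ i 1 * G y 1 1 1) * hlow y hy v
  · refine ((((hd 1).mul_const d₂).mul (hd1 0 0)).sub
      (((hd 0).mul_const d₁).mul (hd1 0 1))).congr_fderiv ?_
    ext v
    simp [h.fderiv_zero y hy ζ hζ, h.fderiv_one y hy ζ hζ, h.fderiv_zero y hy 1 one_ne_zero,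
      h.fderiv_one y hy 1 one_ne_zero]
    linear_combination (G y ζ i 0 * G y 1 0 0) * hup y hy v
      - (G y ζ i 1 * G y 1 0 1) * hlow y hy v

/-- If the Maurer--Cartan form is conjugate to its value at `ζ = 1` by a constant diagonal matrix,
then so is the frame; hence its diagonal entries do not depend on `ζ`. -/
theorem IsNormalizedFrame.diag_eq [ConnectedSpace X] {z₀ : X} (hF : IsNormalizedFrame F z₀)
    (h : IsMaurerCartan F p q β γ θ) {ζ : ℂ} (hζ : ζ ≠ 0) {d₁ d₂ : ℂ} (hd₁ : d₁ ≠ 0)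
    (hd₂ : d₂ ≠ 0)
    (hup : ∀ z v, d₂ * (ζ⁻¹ * v * p z + ζ * conj v * β z) = d₁ * (v * p z + conj v * β z))
    (hlow : ∀ z v, d₁ * (ζ⁻¹ * v * q z + ζ * conj v * γ z) = d₂ * (v * q z + conj v * γ z))
    (z : X) : F z ζ 0 0 = F z 1 0 0 ∧ F z ζ 1 1 = F z 1 1 1 := by
  have hloc := fun (z : X) (y : ℂ) (hy : y ∈ (chartAt ℂ z).target) (i : Fin 2) =>
    (hF.toIsExtendedFrame.isLocalFrame h z).hasFDerivAt_mul_adjugate hζ (d₁ := d₁) (d₂ := d₂)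
      (fun y _ v => by
        have := hup ((chartAt ℂ z).symm y) (chartFactor z y * v)
        rw [map_mul] at this
        linear_combination this)
      (fun y _ v => by
        have := hlow ((chartAt ℂ z).symm y) (chartFactor z y * v)
        rw [map_mul] at this
        linear_combination this) hy i
  have e0 := fun i => eq_of_hasFDerivAt_zero
    (g := fun z => F z ζ i 0 * d₁ * F z 1 1 1 - F z ζ i 1 * d₂ * F z 1 1 0)
    (fun z y hy => (hloc z y hy i).1) z z₀
  have e1 := fun i => eq_of_hasFDerivAt_zero
    (g := fun z => F z ζ i 1 * d₂ * F z 1 0 0 - F z ζ i 0 * d₁ * F z 1 0 1)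
    (fun z y hy => (hloc z y hy i).2) z z₀
  have hdet : F z 1 0 0 * F z 1 1 1 - F z 1 0 1 * F z 1 1 0 = 1 := by
    rw [← Matrix.det_fin_two, (hF.loop z).det_eq_one one_ne_zero]
  have a0 := e0 0
  have a1 := e1 0
  have b0 := e0 1
  have b1 := e1 1
  simp only [hF.base ζ hζ, hF.base 1 one_ne_zero] at a0 a1 b0 b1
  simp at a0 a1 b0 b1
  constructor
  · refine mul_left_cancel₀ hd₁ ?_
    linear_combination F z 1 0 0 * a0 + F z 1 1 0 * a1 - d₁ * F z ζ 0 0 * hdet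
  · refine mul_left_cancel₀ hd₂ ?_
    linear_combination F z 1 1 1 * b1 + F z 1 0 1 * b0 - d₂ * F z ζ 1 1 * hdet

/-- If the Hopf differential of the frame vanishes identically, then the trace of every monodromy
is constant. -/
theorem IsNormalizedFrame.exists_ne_zero [ConnectedSpace X] {z₀ : X}
    (hF : IsNormalizedFrame F z₀) (h : IsMaurerCartan F p q β γ θ) {r : ℝ} (hr : 0 < r)
    {τ : X → X} {χ : ℂ → Mat2} (hχ : IsMonodromy r τ F χ)
    (hχtr : ¬ ∃ c : ℂ, ∀ ζ ∈ circle r, (χ ζ).trace = c) : ∃ z, p z * q z ≠ 0 := by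
  by_contra! hpq
  apply hχtr
  obtain ⟨-, k, -, hk, hmon⟩ := hχ
  obtain ⟨u, hu, hku⟩ := hk z₀
  have hu0 : u ≠ 0 := by rintro rfl; simp at hu
  have hdiag : ∀ ζ : ℂ, ζ ≠ 0 → F (τ z₀) ζ 0 0 = F (τ z₀) 1 0 0 ∧ F (τ z₀) ζ 1 1 = F (τ z₀) 1 1 1 := by
    intro ζ hζ
    have hreal := hF.toIsExtendedFrame.eq_neg_conj h
    -- If `p = 0`, also `γ = 0` by reality, and the gauge is `diag(ζ, 1)`; if `q = 0`, also `β = 0`,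
    -- and the gauge is `diag(1, ζ)`.
    rcases hF.toIsExtendedFrame.eq_zero_or_eq_zero h hpq with h0 | h0
    · have hγ : ∀ z, γ z = 0 := fun z => by rw [(hreal z).2, h0 z]; simp
      refine hF.diag_eq h hζ hζ one_ne_zero (fun z v => ?_) (fun z v => ?_) _
      · rw [h0 z]; ring
      · rw [hγ z]; field_simp; ring
    · have hβ : ∀ z, β z = 0 := fun z => by
        have := (hreal z).1
        rw [h0 z, eq_comm, neg_eq_zero] at this
        exact (map_eq_zero conj).1 this
      refine hF.diag_eq h hζ one_ne_zero hζ (fun z v => ?_) (fun z v => ?_) _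
      · rw [hβ z]; field_simp; ring
      · rw [h0 z]; ring
  refine ⟨F (τ z₀) 1 0 0 * u⁻¹ + F (τ z₀) 1 1 1 * u, fun ζ hζ => ?_⟩
  have hζ0 := ne_zero_of_mem_circle hr hζ
  have h1 := hmon z₀ ζ hζ
  rw [hF.base ζ hζ0, mul_one, hku] at h1
  have h00 := congrFun (congrFun h1 0) 0
  have h11 := congrFun (congrFun h1 1) 1
  simp [Matrix.mul_apply, Fin.sum_univ_two] at h00 h11
  rw [Matrix.trace_fin_two, ← (hdiag ζ hζ0).1, ← (hdiag ζ hζ0).2, h00, h11]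
  field_simp

end Frame

/-! ### Identity theorems starting from a circle. -/

/-- A holomorphic function on a punctured disc which vanishes on the boundary circle is zero. -/
theorem eq_zero_of_eq_zero_on_circle {r : ℝ} (hr : 0 < r) {f : ℂ → ℂ}
    (hf : ContinuousOn f {ζ | ζ ≠ 0 ∧ ‖ζ‖ ≤ r}) (hd : DifferentiableOn ℂ f {ζ | ζ ≠ 0 ∧ ‖ζ‖ < r})
    (h0 : ∀ ζ ∈ circle r, f ζ = 0) {ζ : ℂ} (hζ : ζ ≠ 0) (hζr : ‖ζ‖ ≤ r) : f ζ = 0 := by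
  have hn : 0 < ‖ζ‖ := norm_pos_iff.2 hζ
  -- The exponential maps a vertical strip onto an annulus whose inner radius `‖ζ‖ / 2` keeps `ζ`
  -- off the inner boundary. In the three lines theorem the bound `0` on the outer line then enters
  -- with a positive exponent.
  set l := Real.log (‖ζ‖ / 2) with hl
  set u := Real.log r with hu
  have hlu : l < u := Real.log_lt_log (by positivity) (by linarith)
  have hexp : ∀ z : ℂ, z.re ≤ u → Complex.exp z ≠ 0 ∧ ‖Complex.exp z‖ ≤ r := by
    intro z hz
    refine ⟨Complex.exp_ne_zero z, ?_⟩
    rw [Complex.norm_exp, ← Real.exp_log hr]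
    exact Real.exp_le_exp.2 hz
  have hcont : ContinuousOn (f ∘ Complex.exp) (Complex.HadamardThreeLines.verticalClosedStrip l u) :=
    hf.comp Complex.continuous_exp.continuousOn fun z hz => hexp z hz.2
  have hclosed : IsClosed (Complex.HadamardThreeLines.verticalClosedStrip l u) :=
    isClosed_Icc.preimage Complex.continuous_re
  have hdc : DiffContOnCl ℂ (f ∘ Complex.exp) (Complex.HadamardThreeLines.verticalStrip l u) := by
    refine ⟨hd.comp Complex.differentiable_exp.differentiableOn fun z hz => ?_,
      hcont.mono (closure_minimal (Set.preimage_mono Set.Ioo_subset_Icc_self) hclosed)⟩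
    refine ⟨Complex.exp_ne_zero z, ?_⟩
    rw [Complex.norm_exp, ← Real.exp_log hr]
    exact Real.exp_lt_exp.2 hz.2
  have hK : IsCompact (Metric.closedBall (0 : ℂ) r \ Metric.ball 0 (‖ζ‖ / 2)) :=
    (isCompact_closedBall 0 r).diff Metric.isOpen_ball
  obtain ⟨C, hC⟩ := hK.exists_bound_of_continuousOn (hf.mono (by
    rintro w ⟨hw1, hw2⟩
    rw [mem_closedBall_zero_iff] at hw1
    rw [mem_ball_zero_iff, not_lt] at hw2
    exact ⟨norm_pos_iff.1 (by linarith), hw1⟩))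
  have hbd : ∀ z ∈ Complex.HadamardThreeLines.verticalClosedStrip l u,
      ‖(f ∘ Complex.exp) z‖ ≤ C := by
    intro z hz
    refine hC _ ⟨mem_closedBall_zero_iff.2 (hexp z hz.2).2, ?_⟩
    rw [mem_ball_zero_iff, not_lt, Complex.norm_exp, ← Real.exp_log (show 0 < ‖ζ‖ / 2 by positivity)]
    exact Real.exp_le_exp.2 hz.1
  have hlog : (Complex.log ζ).re = Real.log ‖ζ‖ := Complex.log_re ζ
  have hl' : l < Real.log ‖ζ‖ := Real.log_lt_log (by positivity) (by linarith)
  have hmem : Complex.log ζ ∈ Complex.HadamardThreeLines.verticalClosedStrip l u := by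
    refine ⟨?_, ?_⟩
    · rw [hlog]; exact hl'.le
    · rw [hlog]; exact Real.log_le_log hn hζr
  have key := Complex.HadamardThreeLines.norm_le_interp_of_mem_verticalClosedStrip'
    (f := f ∘ Complex.exp) (a := C) (b := 0) hlu hmem hdc
    ⟨C, by rintro _ ⟨z, hz, rfl⟩; exact hbd z hz⟩
    (fun z hz => hbd z ⟨(Set.mem_singleton_iff.1 hz).ge, (Set.mem_singleton_iff.1 hz).le.trans hlu.le⟩)
    (fun z hz => by
      rw [Function.comp_apply, h0, norm_zero]
      have : z.re = u := hz
      rw [circle, Set.mem_ofPred_eq, Complex.norm_exp, this, hu, Real.exp_log hr])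
  have ht : 0 < ((Complex.log ζ).re - l) / (u - l) := by
    rw [hlog]; exact div_pos (by linarith) (by linarith)
  rw [Real.zero_rpow ht.ne', mul_zero, Function.comp_apply, Complex.exp_log hζ] at key
  exact norm_le_zero_iff.1 key

/-- Each point of the circle is approached by other points of it. An equality on an arc, a set
without interior, is therefore enough for the identity theorem. -/
theorem tendsto_circle {r : ℝ} (hr : 0 < r) {ζ : ℂ} (hζ : ζ ∈ circle r) :
    Filter.Tendsto (fun t : ℝ => ζ * Complex.exp (t * Complex.I)) (nhdsWithin 0 {0}ᶜ)
      (nhdsWithin ζ {ζ}ᶜ ⊓ Filter.principal (circle r)) := by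
  have h1 : HasDerivAt (fun t : ℝ => ζ * Complex.exp (t * Complex.I))
      (ζ * (Complex.exp (((0 : ℝ) : ℂ) * Complex.I) * (1 * Complex.I))) 0 :=
    (((Complex.ofRealCLM.hasDerivAt (x := 0)).mul_const Complex.I).cexp).const_mul ζ
  have h2 := h1.tendsto_nhdsNE (by simp [ne_zero_of_mem_circle hr hζ])
  simp only [Complex.ofReal_zero, zero_mul, Complex.exp_zero, mul_one] at h2
  refine Filter.tendsto_inf.2 ⟨h2, Filter.tendsto_principal.2 (Filter.Eventually.of_forall ?_)⟩
  intro t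
  rw [circle, Set.mem_ofPred_eq, norm_mul, Complex.norm_exp_ofReal_mul_I, mul_one]
  exact hζ

theorem frequently_circle {r : ℝ} (hr : 0 < r) {ζ : ℂ} (hζ : ζ ∈ circle r) {P : ℂ → Prop}
    (h : ∀ᶠ w in nhdsWithin ζ (circle r), P w) : ∃ᶠ w in nhdsWithin ζ {ζ}ᶜ, P w := by
  have h1 := tendsto_circle hr hζ
  have h2 : Filter.Tendsto (fun t : ℝ => ζ * Complex.exp (t * Complex.I)) (nhdsWithin 0 {0}ᶜ)
      (nhdsWithin ζ (circle r)) :=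
    h1.mono_right (inf_le_inf_right _ nhdsWithin_le_nhds)
  have h3 : Filter.Tendsto (fun t : ℝ => ζ * Complex.exp (t * Complex.I)) (nhdsWithin 0 {0}ᶜ)
      (nhdsWithin ζ {ζ}ᶜ) := h1.mono_right inf_le_left
  exact h3.frequently (h2.eventually h).frequently

theorem isPreconnected_compl_zero : IsPreconnected ({0}ᶜ : Set ℂ) :=
  (isConnected_compl_singleton_of_one_lt_rank (by simp) 0).isPreconnected

theorem eq_of_eventually_circle {r : ℝ} (hr : 0 < r) {U : Set ℂ} (hU : IsPreconnected U)
    {f g : ℂ → ℂ} (hf : AnalyticOnNhd ℂ f U) (hg : AnalyticOnNhd ℂ g U) {ζ : ℂ}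
    (hζ : ζ ∈ circle r) (hζU : ζ ∈ U) (h : ∀ᶠ w in nhdsWithin ζ (circle r), f w = g w) :
    Set.EqOn f g U :=
  hf.eqOn_of_preconnected_of_frequently_eq hg hU hζU (frequently_circle hr hζ h)

namespace IsUnitaryLoopStar

variable {g : ℂ → Mat2}

theorem analyticOnNhd (hg : IsUnitaryLoopStar g) (i j : Fin 2) :
    AnalyticOnNhd ℂ (fun ζ => g ζ i j) {0}ᶜ := fun _ hζ => hg.analyticAt hζ i j

theorem analyticOnNhd_trace (hg : IsUnitaryLoopStar g) :
    AnalyticOnNhd ℂ (fun ζ => (g ζ).trace) {0}ᶜ := by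
  simp only [Matrix.trace_fin_two]
  exact (hg.analyticOnNhd 0 0).add (hg.analyticOnNhd 1 1)

theorem trace_eq_of_eventually (hg : IsUnitaryLoopStar g) {r : ℝ} (hr : 0 < r) {ζ c : ℂ}
    (hζ : ζ ∈ circle r) (h : ∀ᶠ w in nhdsWithin ζ (circle r), (g w).trace = c) :
    ∀ w : ℂ, w ≠ 0 → (g w).trace = c := fun _ hw =>
  eq_of_eventually_circle hr isPreconnected_compl_zero hg.analyticOnNhd_trace
    analyticOnNhd_const hζ (ne_zero_of_mem_circle hr hζ) h hw

end IsUnitaryLoopStar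

/-! ### The isotropy loop, and the commuting monodromies. -/

theorem IsPositiveLoop.posExt {r : ℝ} (hr : 0 < r) {g : ℂ → Mat2} (hg : IsPositiveLoop r g) :
    PosExt r g := fun i j => by
  refine ⟨hg.differentiableOn i j, ?_⟩
  rw [closure_ball _ hr.ne']
  exact continuousOn_pi.1 (continuousOn_pi.1 hg.continuousOn i) j

theorem IsU1.det_eq_one {k : Mat2} (hk : IsU1 k) : k.det = 1 := by
  obtain ⟨u, hu, rfl⟩ := hk
  have : u ≠ 0 := by rintro rfl; simp at hu
  simp [Matrix.det_fin_two, this]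

/-- The trace free part of a matrix. -/
def traceFree (A : Mat2) : Mat2 := A - (A.trace / 2) • (1 : Mat2)

theorem trace_traceFree (A : Mat2) : (traceFree A).trace = 0 := by
  simp [traceFree, Matrix.trace_sub, Matrix.trace_smul]

theorem PosExt.traceFree {r : ℝ} {N : ℂ → Mat2} (hN : PosExt r N) :
    PosExt r fun ζ => traceFree (N ζ) := by
  intro i j
  simp only [LoopDressing.traceFree, Matrix.sub_apply, Matrix.smul_apply, smul_eq_mul,
    div_eq_mul_inv]
  exact (hN i j).sub (DiffContOnCl.mul' (DiffContOnCl.mul' hN.trace diffContOnCl_const)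
    diffContOnCl_const)

theorem StabBy.traceFree {V : Set ℂ} {G : ℂ → ℂ → Mat2} {p q β γ : ℂ → ℂ} {θ : ℂ → ℂ → ℂ}
    {r : ℝ} {c : ℂ → Mat2} {N : ℂ → ℂ → Mat2} (hc : StabBy V G r c N)
    (hF : IsLocalFrame V G p q β γ θ) (hr : 0 < r) :
    StabBy V G r (fun ζ => traceFree (c ζ)) (fun y ζ => traceFree (N y ζ)) := by
  intro y hy
  refine ⟨(hc y hy).1.traceFree, fun ζ hζ => ?_⟩
  have htr : (N y ζ).trace = (c ζ).trace := by
    rw [hc.eq_adjugate hF hr hy hζ, Matrix.trace_mul_comm, ← mul_assoc, Matrix.mul_adjugate,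
      hF.det_eq_one y hy ζ (ne_zero_of_mem_circle hr hζ), one_smul, one_mul]
  simp only [LoopDressing.traceFree, mul_sub, sub_mul, (hc y hy).2 ζ hζ, htr, Matrix.mul_smul,
    Matrix.smul_mul, mul_one, one_mul]

theorem IsLocalFrame.mono {V V' : Set ℂ} {G : ℂ → ℂ → Mat2} {p q β γ : ℂ → ℂ} {θ : ℂ → ℂ → ℂ}
    (h : IsLocalFrame V G p q β γ θ) (hV : IsOpen V') (hVV : V' ⊆ V) :
    IsLocalFrame V' G p q β γ θ where
  isOpen := hV
  smooth ζ hζ i j := (h.smooth ζ hζ i j).mono hVV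
  det_eq_one y hy := h.det_eq_one y (hVV hy)
  continuousOn y hy := h.continuousOn y (hVV hy)
  fderiv_zero y hy := h.fderiv_zero y (hVV hy)
  fderiv_one y hy := h.fderiv_one y (hVV hy)

theorem mul_adjugate_of_det {A : Mat2} (h : A.det = 1) : A * A.adjugate = 1 := by
  rw [Matrix.mul_adjugate, h, one_smul]

theorem adjugate_mul_of_det {A : Mat2} (h : A.det = 1) : A.adjugate * A = 1 := by
  rw [Matrix.adjugate_mul, h, one_smul]

/-- The matrix `A` conjugates `B` to `-B`. -/
theorem trace_eq_zero_of_anticommute {A B : Mat2} (hA : A.det ≠ 0) (h : B * A = -(A * B)) :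
    B.trace = 0 := by
  have h1 : A.det * B.trace = -(A.det * B.trace) := by
    calc A.det * B.trace = (A.adjugate * (A * B)).trace := by
          rw [← mul_assoc, Matrix.adjugate_mul, Matrix.smul_mul, one_mul, Matrix.trace_smul,
            smul_eq_mul]
      _ = -(A.adjugate * (B * A)).trace := by rw [h, mul_neg, Matrix.trace_neg, neg_neg]
      _ = -(A.det * B.trace) := by
          rw [← mul_assoc, Matrix.trace_mul_comm, ← mul_assoc, Matrix.mul_adjugate,
            Matrix.smul_mul, one_mul, Matrix.trace_smul, smul_eq_mul]
  have h2 : A.det * B.trace = 0 := self_eq_neg.1 h1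
  exact (mul_eq_zero.1 h2).resolve_left hA

section Frame

variable {X : Type*} [TopologicalSpace X] [ChartedSpace ℂ X] [IsManifold 𝓘(ℂ) ω X]
  [ConnectedSpace X] {τ : X → X} {r : ℝ} {F F' : X → ℂ → Mat2} {z₀ : X} {χ χ' h : ℂ → Mat2}

omit [IsManifold 𝓘(ℂ) ω X] [ConnectedSpace X] in
/-- The loop which measures the failure of `h χ h⁻¹` to be a monodromy of the dressed frame
is turned into positive loops by the frame. -/
theorem exists_isotropy (hr : 0 < r) (hχ : IsMonodromy r τ F χ)
    (hh : IsPositiveLoop r h) (hF' : IsDressedFrame r h F z₀ F') (hχ' : IsMonodromy r τ F' χ') :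
    ∃ (N : X → ℂ → Mat2) (k : X → Mat2), (∀ z, PosExt r (N z)) ∧ (∀ z, (k z).det = 1) ∧
      (∀ z, ∀ ζ ∈ circle r, F (τ z) ζ = χ ζ * F z ζ * k z) ∧
      ∀ z, ∀ ζ ∈ circle r, F z ζ * N z ζ
        = ((h ζ).adjugate * (χ' ζ).adjugate * h ζ * χ ζ) * F z ζ := by
  obtain ⟨hχl, k, -, hk, hmon⟩ := hχ
  obtain ⟨hχl', k', -, hk', hmon'⟩ := hχ'
  obtain ⟨B, hB, hiw⟩ := hF'.iwasawa
  -- Computing `h (F ∘ τ)` once with `χ` and once with `χ'` leaves only the positive factors of the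
  -- Iwasawa decompositions at `z` and `τ z` and the constants `k`, `k'`.
  refine ⟨fun z ζ => (B z ζ).adjugate * k' z * B (τ z) ζ * (k z).adjugate, k, fun z => ?_,
    fun z => (hk z).det_eq_one, hmon, fun z ζ hζ => ?_⟩
  · exact ((((hB z).posExt hr).adjugate.mul_const _).mul ((hB (τ z)).posExt hr)).mul_const _
  · have hζ0 := ne_zero_of_mem_circle hr hζ
    have hζb : ζ ∈ Metric.closedBall (0 : ℂ) r :=
      Metric.sphere_subset_closedBall (circle_eq_sphere r ▸ hζ)
    have hBd := mul_adjugate_of_det ((hB z).det_eq_one ζ hζb)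
    have hhd := adjugate_mul_of_det (hh.det_eq_one ζ hζb)
    have hkd := mul_adjugate_of_det (hk z).det_eq_one
    have hχd := adjugate_mul_of_det (hχl'.det_eq_one hζ0)
    have e1 : (h ζ).adjugate * F' z ζ = F z ζ * (B z ζ).adjugate := by
      calc (h ζ).adjugate * F' z ζ = (h ζ).adjugate * (F' z ζ * B z ζ) * (B z ζ).adjugate := by
            rw [mul_assoc, mul_assoc, hBd, mul_one]
        _ = _ := by rw [← hiw z ζ hζ, ← mul_assoc, hhd, one_mul]
    have e2 : h ζ * χ ζ * F z ζ = χ' ζ * F' z ζ * k' z * B (τ z) ζ * (k z).adjugate := by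
      calc h ζ * χ ζ * F z ζ = h ζ * (χ ζ * F z ζ * k z) * (k z).adjugate := by
            simp only [mul_assoc, hkd, mul_one]
        _ = _ := by rw [← hmon z ζ hζ, hiw (τ z) ζ hζ, hmon' z ζ hζ]
    calc F z ζ * ((B z ζ).adjugate * k' z * B (τ z) ζ * (k z).adjugate)
        = (F z ζ * (B z ζ).adjugate) * (k' z * B (τ z) ζ * (k z).adjugate) := by
          simp only [mul_assoc]
      _ = (h ζ).adjugate * ((χ' ζ).adjugate * χ' ζ) * F' z ζ * k' z * B (τ z) ζ
            * (k z).adjugate := by rw [← e1, hχd]; simp only [mul_assoc, one_mul]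
      _ = (h ζ).adjugate * (χ' ζ).adjugate * (χ' ζ * F' z ζ * k' z * B (τ z) ζ
            * (k z).adjugate) := by simp only [mul_assoc]
      _ = _ := by rw [← e2]; simp only [mul_assoc]

/-- `h χ h⁻¹` commutes with the monodromy of the dressed frame on the circle. -/
theorem commute_on_circle (hr : 0 < r) (hF : IsNormalizedFrame F z₀) (hχ : IsMonodromy r τ F χ)
    (hχtr : ¬ ∃ c : ℂ, ∀ ζ : ℂ, ζ ≠ 0 → (χ ζ).trace = c)
    (hh : IsPositiveLoop r h) (hF' : IsDressedFrame r h F z₀ F') (hχ' : IsMonodromy r τ F' χ')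
    {ζ : ℂ} (hζ : ζ ∈ circle r) :
    h ζ * χ ζ * (h ζ).adjugate * χ' ζ = χ' ζ * (h ζ * χ ζ * (h ζ).adjugate) := by
  have hrc : (r : ℂ) ∈ circle r := by simp [circle, abs_of_pos hr]
  obtain ⟨p, q, β, γ, θ, hmc⟩ := hF.toIsExtendedFrame.exists_isMaurerCartan
  obtain ⟨z₁, hz₁⟩ := hF.exists_ne_zero hmc hr hχ fun ⟨c, hc⟩ =>
    hχtr ⟨c, hχ.1.trace_eq_of_eventually hr hrc (eventually_nhdsWithin_of_forall hc)⟩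
  obtain ⟨N, k, hN, hk, hmon, hc⟩ := exists_isotropy hr hχ hh hF' hχ'
  set c : ℂ → Mat2 := fun ζ => (h ζ).adjugate * (χ' ζ).adjugate * h ζ * χ ζ with hcdef
  have hloc := hF.toIsExtendedFrame.isLocalFrame hmc z₁
  set φ := chartAt ℂ z₁
  have hx : z₁ ∈ φ.source := mem_chart_source ℂ z₁
  have hx' := φ.map_source hx
  set P : ℂ → ℂ := fun y => chartFactor z₁ y * p (φ.symm y)
  set Q : ℂ → ℂ := fun y => chartFactor z₁ y * q (φ.symm y)
  set V : Set ℂ := φ.target ∩ (fun y => P y * Q y) ⁻¹' {0}ᶜ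
  -- The isotropy argument takes place near a point where both `P` and `Q` are nonzero.
  have hVopen : IsOpen V :=
    (hloc.contDiffOn_p.continuousOn.mul hloc.contDiffOn_q.continuousOn).isOpen_inter_preimage
      φ.open_target isOpen_compl_singleton
  have hV := hloc.mono hVopen Set.inter_subset_left
  have hT := chartFactor_ne_zero z₁ hx'
  have hy₁ : φ z₁ ∈ V := by
    refine ⟨hx', ?_⟩
    simp only [P, Q, Set.mem_preimage, Set.mem_compl_iff, Set.mem_singleton_iff, φ.left_inv hx]
    have := mul_ne_zero_iff.1 hz₁
    exact mul_ne_zero (mul_ne_zero hT this.1) (mul_ne_zero hT this.2)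
  have hP : ∀ y ∈ V, P y ≠ 0 := fun y hy => (mul_ne_zero_iff.1 hy.2).1
  have hQ : ∀ y ∈ V, Q y ≠ 0 := fun y hy => (mul_ne_zero_iff.1 hy.2).2
  have hχd : ∀ ζ ∈ circle r, (χ ζ).adjugate * χ ζ = 1 := fun ζ hζ =>
    adjugate_mul_of_det (hχ.1.det_eq_one (ne_zero_of_mem_circle hr hζ))
  have hχd' : ∀ ζ ∈ circle r, χ ζ * (χ ζ).adjugate = 1 := fun ζ hζ =>
    mul_adjugate_of_det (hχ.1.det_eq_one (ne_zero_of_mem_circle hr hζ))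
  have hs1 : StabBy V (fun y => F (φ.symm y)) r c (fun y => N (φ.symm y)) :=
    fun y _ => ⟨hN _, fun ζ hζ => hc _ ζ hζ⟩
  -- The isotropy relation at `τ z`, pulled back by `F (τ z) = χ F k`, shows that `χ⁻¹ c χ` belongs
  -- to the same class as `c`.
  have hs2 : StabBy V (fun y => F (φ.symm y)) r (fun ζ => (χ ζ).adjugate * c ζ * χ ζ)
      (fun y ζ => k (φ.symm y) * N (τ (φ.symm y)) ζ * (k (φ.symm y)).adjugate) := by
    intro y _
    refine ⟨((hN _).const_mul _).mul_const _, fun ζ hζ => ?_⟩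
    set z := φ.symm y
    have hkd := mul_adjugate_of_det (hk z)
    have e1 : F z ζ * k z = (χ ζ).adjugate * F (τ z) ζ := by
      rw [hmon z ζ hζ, ← mul_assoc, ← mul_assoc, hχd ζ hζ, one_mul]
    calc F z ζ * (k z * N (τ z) ζ * (k z).adjugate)
        = (F z ζ * k z) * N (τ z) ζ * (k z).adjugate := by simp only [mul_assoc]
      _ = (χ ζ).adjugate * (F (τ z) ζ * N (τ z) ζ) * (k z).adjugate := by
          rw [e1]; simp only [mul_assoc]
      _ = (χ ζ).adjugate * c ζ * χ ζ * F z ζ * (k z * (k z).adjugate) := by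
          rw [hc (τ z) ζ hζ, hmon z ζ hζ]; simp only [mul_assoc, hcdef]
      _ = _ := by rw [hkd, mul_one]
  have ht1 := hs1.traceFree hV hr
  have ht2 := hs2.traceFree hV hr
  have hconj : ∀ ζ ∈ circle r, traceFree ((χ ζ).adjugate * c ζ * χ ζ)
      = (χ ζ).adjugate * traceFree (c ζ) * χ ζ := by
    intro ζ hζ
    have : ((χ ζ).adjugate * c ζ * χ ζ).trace = (c ζ).trace := by
      rw [Matrix.trace_mul_comm, ← mul_assoc, hχd' ζ hζ, one_mul]
    simp only [traceFree, this, mul_sub, sub_mul, Matrix.mul_smul, Matrix.smul_mul, mul_one,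
      hχd ζ hζ]
  have hsum := ht1.add ht2
  have hdiff := ht1.sub ht2
  -- With `a` the trace free part of `c` and `a' = χ⁻¹ a χ`, one has `tr (a + a')(a - a') = tr a² -
  -- tr a'² = 0`, so `a' = a` or `a' = -a` on the whole circle.
  have hcomm : ∀ ζ ∈ circle r, traceFree (c ζ) - traceFree ((χ ζ).adjugate * c ζ * χ ζ) = 0 := by
    rcases hsum.eq_zero_or_eq_zero hdiff hV hr
      (fun ζ _ => by rw [Matrix.trace_add, trace_traceFree, trace_traceFree, add_zero])
      (fun ζ _ => by rw [Matrix.trace_sub, trace_traceFree, trace_traceFree, sub_zero])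
      hP hQ hy₁ (fun ζ hζ => by
        set a := traceFree (c ζ)
        rw [hconj ζ hζ]
        have e1 : ((χ ζ).adjugate * a * χ ζ) * ((χ ζ).adjugate * a * χ ζ)
            = (χ ζ).adjugate * (a * a) * χ ζ := by
          calc _ = (χ ζ).adjugate * a * (χ ζ * (χ ζ).adjugate) * a * χ ζ := by
                simp only [mul_assoc]
            _ = _ := by rw [hχd' ζ hζ]; simp only [mul_assoc, one_mul]
        have e2 : ((χ ζ).adjugate * (a * a) * χ ζ).trace = (a * a).trace := by
          rw [Matrix.trace_mul_comm, ← mul_assoc, hχd' ζ hζ, one_mul]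
        rw [add_mul, mul_sub, mul_sub, e1, Matrix.trace_add, Matrix.trace_sub, Matrix.trace_sub,
          e2, Matrix.trace_mul_comm a ((χ ζ).adjugate * a * χ ζ)]
        ring) with h0 | h0
    · by_cases hzero : ∀ ζ ∈ circle r, traceFree (c ζ) = 0
      · intro ζ hζ
        rw [hconj ζ hζ, hzero ζ hζ]
        simp
      · push Not at hzero
        exfalso
        obtain ⟨ζ, hζ, hdet⟩ := ht1.exists_det_ne_zero hV hr (fun ζ _ => trace_traceFree _)
          hP hQ hy₁ hzero
        apply hχtr
        -- Here `χ` anticommutes with `a`, which is invertible along an arc, so `tr χ` vanishes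
        -- there and then on `ℂ*`.
        refine ⟨0, hχ.1.trace_eq_of_eventually hr hζ ?_⟩
        have hcont : ContinuousOn (fun ζ => (traceFree (c ζ)).det) (circle r) := by
          have := fun i j => ht1.continuousOn hV hr hy₁ i j
          simp only [Matrix.det_fin_two]
          exact ((this 0 0).mul (this 1 1)).sub ((this 0 1).mul (this 1 0))
        filter_upwards [(hcont ζ hζ).eventually_ne hdet, self_mem_nhdsWithin] with w hw hwr
        refine trace_eq_zero_of_anticommute hw ?_
        have h1 : traceFree (c w) + traceFree ((χ w).adjugate * c w * χ w) = 0 := h0 w hwr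
        rw [hconj w hwr] at h1
        have h2 := congrArg (fun A => χ w * A) h1
        simp only [mul_add, mul_zero, ← mul_assoc, hχd' w hwr, one_mul] at h2
        exact eq_neg_of_add_eq_zero_left h2
    · exact h0
  have hcχ : ∀ ζ ∈ circle r, χ ζ * c ζ = c ζ * χ ζ := by
    intro ζ hζ
    have h1 := hcomm ζ hζ
    rw [hconj ζ hζ, sub_eq_zero] at h1
    have h2 : χ ζ * traceFree (c ζ) = traceFree (c ζ) * χ ζ := by
      conv_lhs => rw [h1]
      rw [← mul_assoc, ← mul_assoc, hχd' ζ hζ, one_mul]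
    simpa only [traceFree, mul_sub, sub_mul, Matrix.mul_smul, Matrix.smul_mul, mul_one, one_mul,
      sub_left_inj] using h2
  have hζb : ζ ∈ Metric.closedBall (0 : ℂ) r :=
    Metric.sphere_subset_closedBall (circle_eq_sphere r ▸ hζ)
  have hhd := mul_adjugate_of_det (hh.det_eq_one ζ hζb)
  have hd1 := mul_adjugate_of_det (hχ'.1.det_eq_one (ne_zero_of_mem_circle hr hζ))
  have hd2 := adjugate_mul_of_det (hχ'.1.det_eq_one (ne_zero_of_mem_circle hr hζ))
  have e := hcχ ζ hζ
  simp only [hcdef] at e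
  have e3 : h ζ * χ ζ * (h ζ).adjugate * (χ' ζ).adjugate
      = (χ' ζ).adjugate * (h ζ * χ ζ * (h ζ).adjugate) := by
    calc h ζ * χ ζ * (h ζ).adjugate * (χ' ζ).adjugate
        = h ζ * (χ ζ * ((h ζ).adjugate * (χ' ζ).adjugate * h ζ * χ ζ)) * (χ ζ).adjugate
            * (h ζ).adjugate := by
          calc _ = h ζ * χ ζ * (h ζ).adjugate * (χ' ζ).adjugate * (h ζ * (χ ζ * (χ ζ).adjugate)
                * (h ζ).adjugate) := by rw [hχd' ζ hζ, mul_one, hhd, mul_one]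
            _ = _ := by simp only [mul_assoc]
      _ = (h ζ * (h ζ).adjugate) * (χ' ζ).adjugate * h ζ * χ ζ * (χ ζ * (χ ζ).adjugate)
            * (h ζ).adjugate := by rw [e]; simp only [mul_assoc]
      _ = _ := by rw [hhd, hχd' ζ hζ, one_mul, mul_one]; simp only [mul_assoc]
  set K := h ζ * χ ζ * (h ζ).adjugate
  calc K * χ' ζ = χ' ζ * ((χ' ζ).adjugate * K) * χ' ζ := by
        rw [← mul_assoc, hd1, one_mul]
    _ = χ' ζ * K * ((χ' ζ).adjugate * χ' ζ) := by rw [← e3]; simp only [mul_assoc]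
    _ = χ' ζ * K := by rw [hd2, mul_one]

end Frame

/-! ### Domains with symmetries and reflection in the unit circle. -/

/-- The open sets on which reflection in the unit circle, rotation by `-1`, and the radial
deformation to the unit circle are defined. -/
structure IsSymmetricDomain (D : Set ℂ) : Prop where
  isOpen : IsOpen D
  ne_zero : ∀ ζ ∈ D, ζ ≠ 0
  circle_subset : circle 1 ⊆ D
  neg_mem : ∀ ζ ∈ D, -ζ ∈ D
  inv_conj_mem : ∀ ζ ∈ D, 1 / conj ζ ∈ D
  radial_mem : ∀ ζ ∈ D, ∀ t ∈ Set.Icc (0 : ℝ) 1, (((1 - t) / ‖ζ‖ + t : ℝ) : ℂ) * ζ ∈ D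

/-- The reflection `f^*(ζ) = conj f(1/conj ζ)` of a function in the unit circle. -/
def reflect (f : ℂ → ℂ) (ζ : ℂ) : ℂ := conj (f (1 / conj ζ))

theorem one_div_conj_one_div_conj (ζ : ℂ) : 1 / conj (1 / conj ζ) = ζ := by simp

theorem one_div_conj_of_mem_circle {ζ : ℂ} (hζ : ζ ∈ circle 1) : 1 / conj ζ = ζ := by
  have h1 : ‖ζ‖ = 1 := hζ
  have h0 : ζ ≠ 0 := ne_zero_of_mem_circle one_pos hζ
  have h2 : ζ * conj ζ = 1 := by rw [Complex.mul_conj, Complex.normSq_eq_norm_sq, h1]; simp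
  rw [one_div, inv_eq_of_mul_eq_one_left h2]

theorem reflect_reflect (f : ℂ → ℂ) : reflect (reflect f) = f := by
  funext ζ
  simp [reflect]

theorem reflect_of_mem_circle (f : ℂ → ℂ) {ζ : ℂ} (hζ : ζ ∈ circle 1) :
    reflect f ζ = conj (f ζ) := by rw [reflect, one_div_conj_of_mem_circle hζ]

theorem differentiableAt_reflect {f : ℂ → ℂ} {ζ : ℂ} (hζ : ζ ≠ 0)
    (hf : DifferentiableAt ℂ f (1 / conj ζ)) : DifferentiableAt ℂ (reflect f) ζ := by
  have hc : conj ζ ≠ 0 := (map_ne_zero _).2 hζ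
  have h1 : DifferentiableAt ℂ (fun w : ℂ => f (1 / w)) (conj ζ) :=
    DifferentiableAt.comp (conj ζ) hf (by fun_prop (disch := exact hc))
  have h2 := h1.conj_conj
  rw [Complex.conj_conj] at h2
  exact h2

namespace IsSymmetricDomain

variable {D : Set ℂ} (hD : IsSymmetricDomain D)
include hD

theorem norm_pos {ζ : ℂ} (hζ : ζ ∈ D) : 0 < ‖ζ‖ := norm_pos_iff.2 (hD.ne_zero ζ hζ)

theorem analyticOnNhd_iff {f : ℂ → ℂ} : AnalyticOnNhd ℂ f D ↔ DifferentiableOn ℂ f D :=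
  Complex.analyticOnNhd_iff_differentiableOn hD.isOpen

theorem analyticOnNhd_reflect {f : ℂ → ℂ} (hf : AnalyticOnNhd ℂ f D) :
    AnalyticOnNhd ℂ (reflect f) D := by
  rw [hD.analyticOnNhd_iff]
  intro ζ hζ
  exact (differentiableAt_reflect (hD.ne_zero ζ hζ)
    (hf _ (hD.inv_conj_mem ζ hζ)).differentiableAt).differentiableWithinAt

theorem analyticOnNhd_neg {f : ℂ → ℂ} (hf : AnalyticOnNhd ℂ f D) :
    AnalyticOnNhd ℂ (fun ζ => f (-ζ)) D := by
  intro ζ hζ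
  exact (hf _ (hD.neg_mem ζ hζ)).comp_of_eq analyticAt_id.neg rfl

theorem isConnected : IsConnected D := by
  have h1 : IsConnected (circle 1) := by
    rw [circle_eq_sphere]
    exact isConnected_sphere (by simp) 0 zero_le_one
  refine ⟨h1.nonempty.mono hD.circle_subset, ?_⟩
  obtain ⟨w, hw⟩ := h1.nonempty
  refine isPreconnected_of_forall w fun ζ hζ => ?_
  set γ : ℝ → ℂ := fun t => (((1 - t) / ‖ζ‖ + t : ℝ) : ℂ) * ζ
  have hγ : Continuous γ := by fun_prop
  have hpos := hD.norm_pos hζ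
  have h0 : γ 0 ∈ circle 1 := by
    simp [γ, circle, hpos.ne']
  refine ⟨circle 1 ∪ γ '' Set.Icc 0 1, Set.union_subset hD.circle_subset ?_, Or.inl hw,
    Or.inr ⟨1, by simp, by simp [γ]⟩, ?_⟩
  · rintro _ ⟨t, ht, rfl⟩
    exact hD.radial_mem ζ hζ t ht
  · exact h1.isPreconnected.union (γ 0) h0 ⟨0, by simp, rfl⟩
      (isPreconnected_Icc.image _ hγ.continuousOn)

theorem eqOn_of_circle {f g : ℂ → ℂ} (hf : AnalyticOnNhd ℂ f D) (hg : AnalyticOnNhd ℂ g D)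
    (h : ∀ ζ ∈ circle 1, f ζ = g ζ) : ∀ ζ ∈ D, f ζ = g ζ :=
  eq_of_eventually_circle one_pos hD.isConnected.isPreconnected hf hg mem_circle_one
    (hD.circle_subset mem_circle_one) (eventually_nhdsWithin_of_forall h)

theorem reflect_eq {f : ℂ → ℂ} (hf : AnalyticOnNhd ℂ f D) (h : ∀ ζ ∈ circle 1, conj (f ζ) = f ζ) :
    ∀ ζ ∈ D, reflect f ζ = f ζ :=
  hD.eqOn_of_circle (hD.analyticOnNhd_reflect hf) hf fun ζ hζ => by
    rw [reflect_of_mem_circle f hζ, h ζ hζ]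

theorem eq_zero_or_eq_zero_of_mul {f g : ℂ → ℂ} (hf : AnalyticOnNhd ℂ f D)
    (hg : AnalyticOnNhd ℂ g D) (h : ∀ ζ ∈ D, f ζ * g ζ = 0) :
    (∀ ζ ∈ D, f ζ = 0) ∨ ∀ ζ ∈ D, g ζ = 0 := by
  by_cases h0 : ∀ ζ ∈ D, f ζ = 0
  · exact Or.inl h0
  right
  push Not at h0
  obtain ⟨w, hw, hfw⟩ := h0
  refine fun ζ hζ => hg.eqOn_zero_of_preconnected_of_eventuallyEq_zero
    hD.isConnected.isPreconnected hw ?_ hζ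
  filter_upwards [(hf w hw).continuousAt.eventually_ne hfw, hD.isOpen.mem_nhds hw] with z hz hzD
  exact (mul_eq_zero.1 (h z hzD)).resolve_left hz

end IsSymmetricDomain

theorem isSymmetricDomain_compl_zero : IsSymmetricDomain ({0}ᶜ : Set ℂ) where
  isOpen := isOpen_compl_singleton
  ne_zero _ hζ := hζ
  circle_subset _ hζ := ne_zero_of_mem_circle one_pos hζ
  neg_mem _ hζ := neg_ne_zero.2 hζ
  inv_conj_mem ζ hζ := one_div_ne_zero ((map_ne_zero _).2 hζ)
  radial_mem ζ hζ t ht := by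
    have hn : 0 < ‖ζ‖ := norm_pos_iff.2 hζ
    refine mul_ne_zero (Complex.ofReal_ne_zero.2 (ne_of_gt ?_)) hζ
    rcases eq_or_lt_of_le ht.1 with h | h
    · rw [← h]; simp [hn]
    · have := div_nonneg (sub_nonneg.2 ht.2) hn.le
      linarith

/-- `N^*(ζ) = adj N(ζ)`, where `N^*(ζ)` is the conjugate transpose of `N(1/conj ζ)`. -/
def QuatOn (N : ℂ → Mat2) (D : Set ℂ) : Prop :=
  ∀ ζ ∈ D, (N (1 / conj ζ))ᴴ = (N ζ).adjugate

theorem quat_of_mem_specialUnitaryGroup {g : Mat2}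
    (hg : g ∈ Matrix.specialUnitaryGroup (Fin 2) ℂ) : gᴴ = g.adjugate := by
  rw [Matrix.mem_specialUnitaryGroup_iff] at hg
  have h1 : gᴴ * g = 1 := Matrix.mem_unitaryGroup_iff'.1 hg.1
  calc gᴴ = gᴴ * (g * g.adjugate) := by rw [mul_adjugate_of_det hg.2, mul_one]
    _ = _ := by rw [← mul_assoc, h1, one_mul]

theorem mem_specialUnitaryGroup_of_quat {g : Mat2} (h : gᴴ = g.adjugate) (hd : g.det = 1) :
    g ∈ Matrix.specialUnitaryGroup (Fin 2) ℂ := by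
  rw [Matrix.mem_specialUnitaryGroup_iff, Matrix.mem_unitaryGroup_iff]
  exact ⟨by rw [Matrix.star_eq_conjTranspose, h, mul_adjugate_of_det hd], hd⟩

/-- Both sides are holomorphic in `ζ`, because the reflection undoes the conjugation; the identity
theorem spreads the relation from the unit circle. -/
theorem IsSymmetricDomain.quatOn {D : Set ℂ} (hD : IsSymmetricDomain D) {N : ℂ → Mat2}
    (hN : ∀ i j, AnalyticOnNhd ℂ (fun ζ => N ζ i j) D) (h : ∀ ζ ∈ circle 1, (N ζ)ᴴ = (N ζ).adjugate) :
    QuatOn N D := by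
  have key : ∀ i j, ∀ ζ ∈ D, reflect (fun w => N w j i) ζ = (N ζ).adjugate i j := by
    intro i j
    refine hD.eqOn_of_circle (hD.analyticOnNhd_reflect (hN j i)) ?_ fun ζ hζ => ?_
    · simp only [Matrix.adjugate_fin_two]
      fin_cases i <;> fin_cases j
      · exact hN 1 1
      · exact (hN 0 1).neg
      · exact (hN 1 0).neg
      · exact hN 0 0
    · rw [reflect_of_mem_circle _ hζ, ← h ζ hζ]
      rfl
  intro ζ hζ
  ext i j
  exact key i j ζ hζ

theorem traceFree_apply (A : Mat2) : traceFree A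
    = !![(A 0 0 - A 1 1) / 2, A 0 1; A 1 0, (A 1 1 - A 0 0) / 2] := by
  ext i j
  fin_cases i <;> fin_cases j <;> simp [traceFree, Matrix.trace_fin_two] <;> ring

theorem det_traceFree (A : Mat2) : (traceFree A).det = A.det - A.trace ^ 2 / 4 := by
  rw [traceFree_apply, Matrix.det_fin_two, Matrix.det_fin_two, Matrix.trace_fin_two]
  simp
  ring

theorem traceFree_add_trace (A : Mat2) : traceFree A + (A.trace / 2) • (1 : Mat2) = A := by
  simp [traceFree]

theorem sq_of_trace_eq_zero {A : Mat2} (h : A.trace = 0) : A * A = -(A.det • (1 : Mat2)) := by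
  rw [Matrix.trace_fin_two] at h
  have h1 : A 1 1 = -A 0 0 := eq_neg_of_add_eq_zero_right h
  ext i j
  fin_cases i <;> fin_cases j <;>
    simp [Matrix.mul_apply, Fin.sum_univ_two, Matrix.det_fin_two, h1] <;> ring

theorem QuatOn.traceFree {N : ℂ → Mat2} {D : Set ℂ} (h : QuatOn N D) :
    QuatOn (fun ζ => traceFree (N ζ)) D := by
  intro ζ hζ
  have h1 := h ζ hζ
  have e := fun i j => congrFun (congrFun h1 i) j
  simp only [Matrix.conjTranspose_apply, Matrix.adjugate_fin_two] at e
  have e00 := e 0 0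
  have e01 := e 0 1
  have e10 := e 1 0
  have e11 := e 1 1
  simp at e00 e01 e10 e11
  simp only [traceFree_apply, Matrix.adjugate_fin_two]
  ext i j
  fin_cases i <;> fin_cases j <;> simp [*]

namespace IsUnitaryLoopStar

variable {g : ℂ → Mat2}

theorem quatOn (hg : IsUnitaryLoopStar g) : QuatOn g {0}ᶜ :=
  isSymmetricDomain_compl_zero.quatOn hg.analyticOnNhd fun _ hζ =>
    quat_of_mem_specialUnitaryGroup (hg.unitary hζ)

theorem trace_inv_conj (hg : IsUnitaryLoopStar g) {ζ : ℂ} (hζ : ζ ≠ 0) :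
    (g (1 / conj ζ)).trace = conj (g ζ).trace := by
  have h := congrArg Matrix.trace (hg.quatOn ζ hζ)
  rw [Matrix.trace_conjTranspose] at h
  rw [← Complex.conj_conj (g (1 / conj ζ)).trace]
  congr 1
  refine h.trans ?_
  rw [Matrix.adjugate_fin_two, Matrix.trace_fin_two, Matrix.trace_fin_two]
  simp [add_comm]

theorem trace_neg (hg : IsUnitaryLoopStar g) {ζ : ℂ} (hζ : ζ ≠ 0) :
    (g (-ζ)).trace = (g ζ).trace := by
  rw [← hg.twisted hζ, Matrix.trace_mul_comm, ← mul_assoc,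
    show sigma3 * sigma3 = 1 by simp [sigma3, Matrix.one_fin_two], one_mul]

/-- A loop whose squared trace is that of a positive loop has constant trace. -/
theorem trace_const_of_sq (hg : IsUnitaryLoopStar g) {r : ℝ} (hr : 0 < r) {n : ℂ → ℂ}
    (hn : DiffContOnCl ℂ n (Metric.ball 0 r))
    (h : ∀ ζ ∈ circle r, (g ζ).trace ^ 2 = n ζ ^ 2) :
    ∃ c : ℂ, ∀ ζ : ℂ, ζ ≠ 0 → (g ζ).trace = c := by
  set t : ℂ → ℂ := fun ζ => (g ζ).trace
  have hta : AnalyticOnNhd ℂ t {0}ᶜ := hg.analyticOnNhd_trace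
  have hnc : ContinuousOn n (Metric.closedBall 0 r) := by
    rw [← closure_ball _ hr.ne']; exact hn.continuousOn
  have heq : ∀ ζ : ℂ, ζ ≠ 0 → ‖ζ‖ ≤ r → t ζ ^ 2 = n ζ ^ 2 := by
    intro ζ hζ hζr
    refine sub_eq_zero.1 (eq_zero_of_eq_zero_on_circle (f := fun ζ => t ζ ^ 2 - n ζ ^ 2) hr ?_ ?_
      (fun w hw => sub_eq_zero.2 (h w hw)) hζ hζr)
    · exact ((hta.continuousOn.mono fun w hw => hw.1).pow 2).sub
        ((hnc.mono fun w hw => mem_closedBall_zero_iff.2 hw.2).pow 2)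
    · exact ((hta.differentiableOn.mono fun w hw => hw.1).pow 2).sub
        ((hn.differentiableOn.mono fun w hw => mem_ball_zero_iff.2 hw.2).pow 2)
  -- The squared trace agrees with `n²` on the punctured disc, so it extends over the origin to an
  -- entire function. The reflection symmetry of the trace bounds it near infinity by its values
  -- near `0`, and Liouville's theorem applies.
  set f : ℂ → ℂ := Function.update (fun ζ => t ζ ^ 2) 0 (n 0 ^ 2) with hf
  have hf0 : ∀ ζ, ζ ≠ 0 → f ζ = t ζ ^ 2 := fun ζ hζ => Function.update_of_ne hζ _ _
  have hfn : ∀ ζ : ℂ, ‖ζ‖ ≤ r → f ζ = n ζ ^ 2 := by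
    intro ζ hζ
    rcases eq_or_ne ζ 0 with rfl | h0
    · exact Function.update_self _ _ _
    · rw [hf0 ζ h0, heq ζ h0 hζ]
  have hfd : Differentiable ℂ f := by
    intro ζ
    rcases eq_or_ne ζ 0 with rfl | h0
    · have hb : Metric.ball (0 : ℂ) r ∈ nhds 0 := Metric.ball_mem_nhds 0 hr
      refine DifferentiableAt.congr_of_eventuallyEq
        ((hn.differentiableOn.differentiableAt hb).pow 2) ?_
      filter_upwards [hb] with w hw
      exact hfn w (mem_ball_zero_iff.1 hw).le
    · refine DifferentiableAt.congr_of_eventuallyEq ((hta ζ h0).differentiableAt.pow 2) ?_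
      filter_upwards [isOpen_compl_singleton.mem_nhds h0] with w hw
      exact hf0 w hw
  have hbd : Bornology.IsBounded (Set.range f) := by
    set R := max 1 (1 / r)
    obtain ⟨C, hC⟩ := (isCompact_closedBall (0 : ℂ) R).exists_bound_of_continuousOn
      hfd.continuous.continuousOn
    refine isBounded_iff_forall_norm_le.2 ⟨C, ?_⟩
    rintro _ ⟨ζ, rfl⟩
    by_cases hζ : ‖ζ‖ ≤ R
    · exact hC ζ (mem_closedBall_zero_iff.2 hζ)
    · push Not at hζ
      have h1 : 1 < ‖ζ‖ := (le_max_left _ _).trans_lt hζ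
      have h0 : ζ ≠ 0 := norm_pos_iff.1 (one_pos.trans h1)
      have h2 : ‖1 / conj ζ‖ ≤ R := by
        rw [norm_div, norm_one, Complex.norm_conj]
        exact ((div_le_one (one_pos.trans h1)).2 h1.le).trans (le_max_left _ _)
      have h3 := hC _ (mem_closedBall_zero_iff.2 h2)
      rw [hf0 _ (one_div_ne_zero ((map_ne_zero _).2 h0))] at h3
      rw [hf0 ζ h0]
      simpa only [t, hg.trace_inv_conj h0, norm_pow, Complex.norm_conj] using h3
  have hconst : ∀ ζ : ℂ, ζ ≠ 0 → (t ζ - t 1) * (t ζ + t 1) = 0 := by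
    intro ζ hζ
    have := hfd.apply_eq_apply_of_bounded hbd ζ 1
    rw [hf0 ζ hζ, hf0 1 one_ne_zero] at this
    linear_combination this
  rcases isSymmetricDomain_compl_zero.eq_zero_or_eq_zero_of_mul (hta.sub analyticOnNhd_const)
    (hta.add analyticOnNhd_const) hconst with h1 | h1
  · exact ⟨t 1, fun ζ hζ => sub_eq_zero.1 (h1 ζ hζ)⟩
  · exact ⟨-t 1, fun ζ hζ => eq_neg_of_add_eq_zero_left (h1 ζ hζ)⟩

theorem det_traceFree (hg : IsUnitaryLoopStar g) {ζ : ℂ} (hζ : ζ ≠ 0) :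
    (LoopDressing.traceFree (g ζ)).det = 1 - (g ζ).trace ^ 2 / 4 := by
  rw [LoopDressing.det_traceFree, hg.det_eq_one hζ]

-- On the unit circle `N^* N = adj N · N = det N • 1 = 0`, which forces `N = 0` there and then
-- everywhere.
open scoped ComplexOrder in
theorem traceFree_eq_zero (hg : IsUnitaryLoopStar g)
    (h : ∀ ζ : ℂ, ζ ≠ 0 → (LoopDressing.traceFree (g ζ)).det = 0) :
    ∀ ζ : ℂ, ζ ≠ 0 → LoopDressing.traceFree (g ζ) = 0 := by
  set N : ℂ → Mat2 := fun ζ => LoopDressing.traceFree (g ζ) with hN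
  have hNa : ∀ i j, AnalyticOnNhd ℂ (fun ζ => N ζ i j) {0}ᶜ := by
    have e := hg.analyticOnNhd
    intro i j
    simp only [hN, traceFree_apply]
    fin_cases i <;> fin_cases j
    · exact ((e 0 0).sub (e 1 1)).div analyticOnNhd_const fun _ _ => two_ne_zero
    · exact e 0 1
    · exact e 1 0
    · exact ((e 1 1).sub (e 0 0)).div analyticOnNhd_const fun _ _ => two_ne_zero
  have hc : ∀ ζ ∈ circle 1, N ζ = 0 := by
    intro ζ hζ
    have hζ0 := ne_zero_of_mem_circle one_pos hζ
    have h1 := hg.quatOn.traceFree ζ hζ0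
    rw [one_div_conj_of_mem_circle hζ] at h1
    rw [← Matrix.conjTranspose_mul_self_eq_zero, h1, Matrix.adjugate_mul, h ζ hζ0, zero_smul]
  intro ζ hζ
  ext i j
  exact isSymmetricDomain_compl_zero.eqOn_of_circle (hNa i j) analyticOnNhd_const
    (g := fun _ => 0) (fun w hw => by rw [hc w hw]; rfl) ζ hζ

end IsUnitaryLoopStar

section Frame

variable {X : Type*} [TopologicalSpace X] [ChartedSpace ℂ X]
  {τ : X → X} {r : ℝ} {F F' : X → ℂ → Mat2} {z₀ : X} {χ χ' h : ℂ → Mat2}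

/-- The monodromy of the dressed frame is not a constant multiple of the identity. -/
theorem exists_det_traceFree_ne_zero (hr : 0 < r) (hF : IsNormalizedFrame F z₀)
    (hχ : IsMonodromy r τ F χ) (hχtr : ¬ ∃ c : ℂ, ∀ ζ : ℂ, ζ ≠ 0 → (χ ζ).trace = c)
    (hh : IsPositiveLoop r h) (hF' : IsDressedFrame r h F z₀ F') (hχ' : IsMonodromy r τ F' χ') :
    ∃ ζ : ℂ, ζ ≠ 0 ∧ (traceFree (χ' ζ)).det ≠ 0 := by
  by_contra hcon
  push Not at hcon
  obtain ⟨N, k, hN, -, -, hc⟩ := exists_isotropy hr hχ hh hF' hχ'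
  -- If `χ'` were scalar, it would be `±1`. At the base point, where `F = 1`, the isotropy loop is
  -- then `±χ`, so `(tr χ)²` is the square of the trace of a positive loop.
  refine hχtr (hχ.1.trace_const_of_sq hr (hN z₀).trace fun ζ hζ => ?_)
  have hζ0 := ne_zero_of_mem_circle hr hζ
  have hζb : ζ ∈ Metric.closedBall (0 : ℂ) r :=
    Metric.sphere_subset_closedBall (circle_eq_sphere r ▸ hζ)
  have h1 := hc z₀ ζ hζ
  rw [hF.base ζ hζ0, one_mul, mul_one] at h1
  have h2 := traceFree_add_trace (χ' ζ)
  rw [hχ'.1.traceFree_eq_zero hcon ζ hζ0, zero_add] at h2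
  have h3 := hcon ζ hζ0
  rw [hχ'.1.det_traceFree hζ0] at h3
  set t' := (χ' ζ).trace
  have hadj : (χ' ζ).adjugate = (t' / 2) • (1 : Mat2) := by
    rw [← h2, Matrix.adjugate_fin_two]
    ext i j
    fin_cases i <;> fin_cases j <;> simp
  rw [h1, hadj, Matrix.mul_smul, mul_one, Matrix.smul_mul,
    adjugate_mul_of_det (hh.det_eq_one ζ hζb), Matrix.smul_mul, one_mul, Matrix.trace_smul,
    smul_eq_mul]
  linear_combination (χ ζ).trace ^ 2 * h3

end Frame

/-! ### Branch points and cut planes. -/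

/-- The zeros of a nonzero holomorphic function on the punctured plane are finite in number in each
closed annulus. -/
theorem finite_zeros {f : ℂ → ℂ} (hf : AnalyticOnNhd ℂ f {0}ᶜ) (hne : ∃ ζ : ℂ, ζ ≠ 0 ∧ f ζ ≠ 0)
    {s : ℝ} (hs : 0 < s) : {ζ : ℂ | s ≤ ‖ζ‖ ∧ ‖ζ‖ ≤ 1 / s ∧ f ζ = 0}.Finite := by
  by_contra hinf
  have hK : IsCompact (Metric.closedBall (0 : ℂ) (1 / s) \ Metric.ball 0 s) :=
    (isCompact_closedBall 0 _).diff Metric.isOpen_ball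
  obtain ⟨x, hx, hacc⟩ := Set.Infinite.exists_accPt_of_subset_isCompact hinf hK (by
    rintro ζ ⟨h1, h2, -⟩
    exact ⟨mem_closedBall_zero_iff.2 h2, by rw [mem_ball_zero_iff]; exact not_lt.2 h1⟩)
  have hx0 : x ≠ 0 := by
    rintro rfl
    exact hx.2 (Metric.mem_ball_self hs)
  obtain ⟨ζ, hζ, hfζ⟩ := hne
  refine hfζ (hf.eqOn_zero_of_preconnected_of_frequently_eq_zero isPreconnected_compl_zero hx0 ?_ hζ)
  exact (accPt_iff_frequently_nhdsNE.1 hacc).mono fun z hz => hz.2.2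

section Order

variable {f : ℂ → ℂ} {α : ℂ} {n : ℕ}

theorem analyticOrderAt_neg_eq (hf : AnalyticAt ℂ f α) (hn : analyticOrderAt f α = n)
    (heven : ∀ᶠ w in nhds (-α), f (-w) = f w) : analyticOrderAt f (-α) = n := by
  obtain ⟨g, hg, hg0, hfg⟩ := hf.analyticOrderAt_eq_natCast.1 hn
  have hneg : Filter.Tendsto (fun w : ℂ => -w) (nhds (-α)) (nhds α) := by
    simpa using (continuous_neg (G := ℂ)).tendsto (-α)
  have hga : AnalyticAt ℂ (fun w => g (-w)) (-α) :=
    hg.comp_of_eq analyticAt_id.neg (by simp)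
  have hfa : AnalyticAt ℂ f (-α) := by
    refine (hf.comp_of_eq (f := fun w : ℂ => -w) analyticAt_id.neg (by simp)).congr ?_
    exact heven
  rw [hfa.analyticOrderAt_eq_natCast]
  refine ⟨fun w => (-1) ^ n * g (-w), analyticAt_const.mul hga, by simp [hg0], ?_⟩
  filter_upwards [heven, hneg.eventually hfg] with w h1 h2
  rw [← h1, h2, smul_eq_mul, smul_eq_mul, ← mul_assoc, ← mul_pow]
  ring

theorem analyticOrderAt_inv_conj_eq (hα : α ≠ 0) (hf : AnalyticAt ℂ f α)
    (hn : analyticOrderAt f α = n) (href : ∀ᶠ w in nhds (1 / conj α), reflect f w = f w) :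
    analyticOrderAt f (1 / conj α) = n := by
  have hcα : conj α ≠ 0 := (map_ne_zero _).2 hα
  have h0 : 1 / conj α ≠ 0 := one_div_ne_zero hcα
  obtain ⟨g, hg, hg0, hfg⟩ := hf.analyticOrderAt_eq_natCast.1 hn
  have htend : Filter.Tendsto (fun w : ℂ => 1 / conj w) (nhds (1 / conj α)) (nhds α) := by
    have h1 : ContinuousAt (fun w : ℂ => 1 / conj w) (1 / conj α) := by
      refine ContinuousAt.div₀ continuousAt_const Complex.continuous_conj.continuousAt ?_
      exact (map_ne_zero _).2 h0
    have h2 := h1.tendsto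
    rwa [one_div_conj_one_div_conj] at h2
  have hra : ∀ {u : ℂ → ℂ}, AnalyticAt ℂ u α → AnalyticAt ℂ (reflect u) (1 / conj α) := by
    intro u hu
    rw [Complex.analyticAt_iff_eventually_differentiableAt] at hu ⊢
    filter_upwards [htend.eventually hu, isOpen_compl_singleton.mem_nhds h0] with w hw hw0
    exact differentiableAt_reflect hw0 hw
  have hfa : AnalyticAt ℂ f (1 / conj α) := (hra hf).congr href
  rw [hfa.analyticOrderAt_eq_natCast]
  -- The factor comes from `conj (1 / conj w - α) = -(conj α / w) (w - 1 / conj α)`.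
  refine ⟨fun w => (-(conj α / w)) ^ n * reflect g w, ?_, ?_, ?_⟩
  · exact ((analyticAt_const.div analyticAt_id h0).neg.pow n).mul (hra hg)
  · refine mul_ne_zero (pow_ne_zero _ (neg_ne_zero.2 (div_ne_zero hcα h0))) ?_
    rw [reflect, one_div_conj_one_div_conj]
    exact (map_ne_zero _).2 hg0
  · filter_upwards [href, htend.eventually hfg, isOpen_compl_singleton.mem_nhds h0]
      with w h1 h2 hw
    have hw0 : w ≠ 0 := hw
    rw [← h1, reflect, h2, smul_eq_mul, smul_eq_mul, map_mul, map_pow, ← mul_assoc, ← mul_pow,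
      reflect]
    congr 2
    simp only [map_sub, map_div₀, map_one, Complex.conj_conj]
    field_simp
    ring

end Order

namespace IsUnitaryLoopStar

variable {g : ℂ → Mat2} (hg : IsUnitaryLoopStar g)
include hg

theorem analyticOnNhd_disc : AnalyticOnNhd ℂ (fun ζ => (g ζ).trace ^ 2 - 4) {0}ᶜ :=
  (hg.analyticOnNhd_trace.pow 2).sub analyticOnNhd_const

theorem neg_mem_branchPoints {α : ℂ} (hα : α ∈ branchPoints g) : -α ∈ branchPoints g := by
  obtain ⟨h0, n, hn, hord⟩ := hα
  refine ⟨neg_ne_zero.2 h0, n, hn, analyticOrderAt_neg_eq (hg.analyticOnNhd_disc α h0) hord ?_⟩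
  filter_upwards [isOpen_compl_singleton.mem_nhds (neg_ne_zero.2 h0)] with w hw
  simp only [hg.trace_neg hw]

theorem inv_conj_mem_branchPoints {α : ℂ} (hα : α ∈ branchPoints g) :
    1 / conj α ∈ branchPoints g := by
  obtain ⟨h0, n, hn, hord⟩ := hα
  have h1 : 1 / conj α ≠ 0 := one_div_ne_zero ((map_ne_zero _).2 h0)
  refine ⟨h1, n, hn, analyticOrderAt_inv_conj_eq h0 (hg.analyticOnNhd_disc α h0) hord ?_⟩
  filter_upwards [isOpen_compl_singleton.mem_nhds h1] with w hw
  rw [reflect, hg.trace_inv_conj hw, map_sub, map_pow, Complex.conj_conj, map_ofNat]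

theorem finite_branchPoints {s : ℝ} (hs : 0 < s) : (branchPoints g ∩ annulus s).Finite := by
  by_cases hne : ∃ ζ : ℂ, ζ ≠ 0 ∧ (g ζ).trace ^ 2 - 4 ≠ 0
  · refine (finite_zeros hg.analyticOnNhd_disc hne hs).subset ?_
    rintro α ⟨⟨h0, n, hn, hord⟩, h1, h2⟩
    refine ⟨h1.le, h2.le, ?_⟩
    refine apply_eq_zero_of_analyticOrderAt_ne_zero
      (f := fun ζ => (g ζ).trace ^ 2 - 4) ?_
    rw [hord]
    exact_mod_cast hn.pos.ne'
  · push Not at hne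
    convert Set.finite_empty
    refine Set.eq_empty_of_forall_notMem ?_
    rintro α ⟨⟨h0, n, hn, hord⟩, -⟩
    have : analyticOrderAt (fun ζ => (g ζ).trace ^ 2 - 4) α = ⊤ := by
      rw [analyticOrderAt_eq_top]
      filter_upwards [isOpen_compl_singleton.mem_nhds h0] with w hw
      exact hne w hw
    rw [this] at hord
    exact ENat.top_ne_natCast n hord

/-- A cut meets the annulus only if its branch point lies in it, because the cut runs away from the
unit circle. So finitely many cuts matter, and each of them is closed. -/
theorem isOpen_cutPlane_inter {s : ℝ} (hs : 0 < s) : IsOpen (cutPlane g ∩ annulus s) := by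
  have heq : cutPlane g ∩ annulus s = annulus s ∩ ⋂ α ∈ branchPoints g ∩ annulus s,
      ((fun ζ => ζ / α) ⁻¹' (Complex.ofReal '' {t | (‖α‖ < 1 ∧ 0 ≤ t ∧ t ≤ 1) ∨
        (1 < ‖α‖ ∧ 1 ≤ t)})ᶜ) := by
    ext ζ
    simp only [Set.mem_inter_iff, Set.mem_iInter]
    constructor
    · rintro ⟨⟨h0, hc⟩, ha⟩
      refine ⟨ha, ?_⟩
      rintro α ⟨hα, -⟩ ⟨t, ht, hte⟩
      have hα0 : α ≠ 0 := hα.1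
      have hζ : ζ = t * α := by rw [hte]; field_simp
      rcases ht with ⟨h1, h2, h3⟩ | ⟨h1, h2⟩
      · exact (hc α hα).1 h1 t h2 h3 hζ
      · exact (hc α hα).2 h1 t h2 hζ
    · rintro ⟨ha, hc⟩
      refine ⟨⟨norm_pos_iff.1 (hs.trans ha.1), fun α hα => ⟨fun h1 t ht0 ht1 hζ => ?_,
        fun h1 t ht1 hζ => ?_⟩⟩, ha⟩
      · have hn : ‖ζ‖ = t * ‖α‖ := by rw [hζ, norm_mul, Complex.norm_real, Real.norm_of_nonneg ht0]
        have hle : ‖ζ‖ ≤ ‖α‖ := by rw [hn]; exact mul_le_of_le_one_left (norm_nonneg _) ht1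
        have hαs : α ∈ annulus s := by
          refine ⟨ha.1.trans_le hle, h1.trans ?_⟩
          have := ha.1.trans ha.2
          rw [lt_div_iff₀ hs] at this ⊢
          nlinarith
        refine hc α ⟨hα, hαs⟩ ⟨t, Or.inl ⟨h1, ht0, ht1⟩, ?_⟩
        have hα0 : α ≠ 0 := hα.1
        simp only [hζ]; field_simp
      · have hn : ‖ζ‖ = t * ‖α‖ := by
          rw [hζ, norm_mul, Complex.norm_real, Real.norm_of_nonneg (by linarith)]
        have hle : ‖α‖ ≤ ‖ζ‖ := by rw [hn]; exact le_mul_of_one_le_left (norm_nonneg _) ht1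
        have hαs : α ∈ annulus s := by
          refine ⟨?_, hle.trans_lt ha.2⟩
          have := ha.1.trans ha.2
          rw [lt_div_iff₀ hs] at this
          nlinarith
        refine hc α ⟨hα, hαs⟩ ⟨t, Or.inr ⟨h1, ht1⟩, ?_⟩
        have hα0 : α ≠ 0 := hα.1
        simp only [hζ]; field_simp
  rw [heq]
  refine (isOpen_annulus s).inter ((hg.finite_branchPoints hs).isOpen_biInter fun α hα => ?_)
  refine IsOpen.preimage (by fun_prop) (IsClosed.isOpen_compl (self := ?_))
  refine Complex.isometry_ofReal.isClosedEmbedding.isClosedMap _ ?_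
  have : {t : ℝ | (‖α‖ < 1 ∧ 0 ≤ t ∧ t ≤ 1) ∨ (1 < ‖α‖ ∧ 1 ≤ t)}
      = ({t | ‖α‖ < 1} ∩ Set.Icc 0 1) ∪ ({t | 1 < ‖α‖} ∩ Set.Ici 1) := rfl
  rw [this]
  exact (isClosed_const.inter isClosed_Icc).union (isClosed_const.inter isClosed_Ici)

theorem neg_mem_cutPlane {ζ : ℂ} (hζ : ζ ∈ cutPlane g) : -ζ ∈ cutPlane g := by
  refine ⟨neg_ne_zero.2 hζ.1, fun α hα => ?_⟩
  have h := hζ.2 _ (hg.neg_mem_branchPoints hα)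
  rw [norm_neg] at h
  refine ⟨fun h1 t h2 h3 he => h.1 h1 t h2 h3 ?_, fun h1 t h2 he => h.2 h1 t h2 ?_⟩ <;>
  · rw [mul_neg, ← he, neg_neg]

/-- Reflection exchanges the branch points inside and outside the circle, and keeps each ray while
inverting the modulus, so inner and outer cuts correspond. -/
theorem inv_conj_mem_cutPlane {ζ : ℂ} (hζ : ζ ∈ cutPlane g) : 1 / conj ζ ∈ cutPlane g := by
  have hζ0 : ζ ≠ 0 := hζ.1
  refine ⟨one_div_ne_zero ((map_ne_zero _).2 hζ0), fun α hα => ?_⟩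
  have hα0 : 0 < ‖α‖ := norm_pos_iff.2 hα.1
  have hn : ‖1 / conj α‖ = 1 / ‖α‖ := by rw [norm_div, norm_one, Complex.norm_conj]
  have h := hζ.2 _ (hg.inv_conj_mem_branchPoints hα)
  rw [hn] at h
  have key : ∀ t : ℝ, 1 / conj ζ = t * α → ζ = ((1 / t : ℝ) : ℂ) * (1 / conj α) := by
    intro t he
    rw [← one_div_conj_one_div_conj ζ, he]
    simp [mul_comm]
  refine ⟨fun h1 t h2 h3 he => ?_, fun h1 t h2 he => ?_⟩
  · have ht : 0 < t := by
      rcases h2.eq_or_lt with h2 | h2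
      · rw [← h2] at he
        simp [hζ0] at he
      · exact h2
    exact h.2 ((lt_div_iff₀ hα0).2 (by linarith)) (1 / t) ((le_div_iff₀ ht).2 (by linarith))
      (key t he)
  · have ht : 0 < t := by linarith
    exact h.1 ((div_lt_one hα0).2 h1) (1 / t) (by positivity) ((div_le_one ht).2 h2) (key t he)

omit hg in
theorem circle_subset_cutPlane : circle 1 ⊆ cutPlane g := by
  intro ζ hζ
  have hn : ‖ζ‖ = 1 := hζ
  refine ⟨ne_zero_of_mem_circle one_pos hζ, fun α hα => ⟨fun h1 t h2 h3 he => ?_,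
    fun h1 t h2 he => ?_⟩⟩
  · rw [he, norm_mul, Complex.norm_real, Real.norm_of_nonneg h2] at hn
    nlinarith [norm_nonneg α]
  · rw [he, norm_mul, Complex.norm_real, Real.norm_of_nonneg (by linarith)] at hn
    nlinarith

-- A radial motion towards the unit circle cannot run into a cut, since every cut continues radially
-- away from the circle.
omit hg in
theorem radial_mem_cutPlane {ζ : ℂ} (hζ : ζ ∈ cutPlane g) {t : ℝ} (ht : t ∈ Set.Icc (0 : ℝ) 1) :
    (((1 - t) / ‖ζ‖ + t : ℝ) : ℂ) * ζ ∈ cutPlane g := by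
  have hpos : 0 < ‖ζ‖ := norm_pos_iff.2 hζ.1
  obtain ⟨ht0, ht1⟩ := ht
  set c := (1 - t) / ‖ζ‖ + t with hc
  have hcn : c * ‖ζ‖ = 1 - t + t * ‖ζ‖ := by rw [hc]; field_simp
  have hcpos : 0 < c := by
    have : 0 < c * ‖ζ‖ := by
      rw [hcn]
      rcases ht0.eq_or_lt with h | h
      · rw [← h]; norm_num
      · nlinarith
    exact pos_of_mul_pos_left this hpos.le
  have hc0 : (c : ℂ) ≠ 0 := Complex.ofReal_ne_zero.2 hcpos.ne'
  refine ⟨mul_ne_zero hc0 hζ.1, fun α hα => ?_⟩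
  have key : ∀ t' : ℝ, (c : ℂ) * ζ = t' * α →
      ζ = ((t' / c : ℝ) : ℂ) * α ∧ c * ‖ζ‖ = |t'| * ‖α‖ := by
    intro t' he
    constructor
    · push_cast
      field_simp
      linear_combination he
    · have := congrArg norm he
      rwa [norm_mul, norm_mul, Complex.norm_real, Complex.norm_real, Real.norm_of_nonneg hcpos.le]
        at this
  refine ⟨fun h1 t' h2 h3 he => ?_, fun h1 t' h2 he => ?_⟩
  · obtain ⟨k1, k2⟩ := key t' he
    rw [abs_of_nonneg h2] at k2
    have hlt : c * ‖ζ‖ < 1 := by rw [k2]; nlinarith [norm_nonneg α]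
    have hζ1 : ‖ζ‖ < 1 := by
      by_contra hcon
      push Not at hcon
      nlinarith
    have hc1 : 1 ≤ c := by
      have : 1 * ‖ζ‖ ≤ c * ‖ζ‖ := by rw [hcn]; nlinarith
      exact le_of_mul_le_mul_right this hpos
    exact (hζ.2 α hα).1 h1 (t' / c) (by positivity) ((div_le_one hcpos).2 (h3.trans hc1)) k1
  · obtain ⟨k1, k2⟩ := key t' he
    rw [abs_of_nonneg (by linarith)] at k2
    have hlt : 1 < c * ‖ζ‖ := by rw [k2]; nlinarith
    have hζ1 : 1 < ‖ζ‖ := by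
      by_contra hcon
      push Not at hcon
      nlinarith
    have hc1 : c ≤ 1 := by
      have : c * ‖ζ‖ ≤ 1 * ‖ζ‖ := by rw [hcn]; nlinarith
      exact le_of_mul_le_mul_right this hpos
    exact (hζ.2 α hα).2 h1 (t' / c) ((one_le_div hcpos).2 (hc1.trans h2)) k1

end IsUnitaryLoopStar

theorem isSymmetricDomain_cut {g g' : ℂ → Mat2} (hg : IsUnitaryLoopStar g)
    (hg' : IsUnitaryLoopStar g') {s : ℝ} (hs : 0 < s) (hs1 : s < 1) :
    IsSymmetricDomain (cutPlane g ∩ cutPlane g' ∩ annulus s) where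
  isOpen := by
    have h := (hg.isOpen_cutPlane_inter hs).inter (hg'.isOpen_cutPlane_inter hs)
    rwa [← Set.inter_inter_distrib_right] at h
  ne_zero ζ hζ := hζ.1.1.1
  circle_subset ζ hζ := by
    have hn : ‖ζ‖ = 1 := hζ
    refine ⟨⟨IsUnitaryLoopStar.circle_subset_cutPlane hζ,
      IsUnitaryLoopStar.circle_subset_cutPlane hζ⟩, ?_, ?_⟩
    · rw [hn]; exact hs1
    · rw [hn]; exact (one_lt_div hs).2 hs1
  neg_mem ζ hζ := ⟨⟨hg.neg_mem_cutPlane hζ.1.1, hg'.neg_mem_cutPlane hζ.1.2⟩, by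
    simpa [annulus] using hζ.2⟩
  inv_conj_mem ζ hζ := by
    refine ⟨⟨hg.inv_conj_mem_cutPlane hζ.1.1, hg'.inv_conj_mem_cutPlane hζ.1.2⟩, ?_⟩
    have hpos : 0 < ‖ζ‖ := norm_pos_iff.2 hζ.1.1.1
    obtain ⟨h1, h2⟩ := hζ.2
    have hn : ‖1 / conj ζ‖ = 1 / ‖ζ‖ := by rw [norm_div, norm_one, Complex.norm_conj]
    rw [annulus, Set.mem_ofPred_eq, hn]
    exact ⟨(lt_div_iff₀ hpos).2 (by rw [lt_div_iff₀ hs] at h2; linarith),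
      one_div_lt_one_div_of_lt hs h1⟩
  radial_mem ζ hζ t ht := by
    refine ⟨⟨IsUnitaryLoopStar.radial_mem_cutPlane hζ.1.1 ht,
      IsUnitaryLoopStar.radial_mem_cutPlane hζ.1.2 ht⟩, ?_⟩
    have hpos : 0 < ‖ζ‖ := norm_pos_iff.2 hζ.1.1.1
    obtain ⟨h1, h2⟩ := hζ.2
    obtain ⟨ht0, ht1⟩ := ht
    have hs1' : 1 < 1 / s := (one_lt_div hs).2 hs1
    have hn : ‖(((1 - t) / ‖ζ‖ + t : ℝ) : ℂ) * ζ‖ = 1 - t + t * ‖ζ‖ := by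
      rw [norm_mul, Complex.norm_real, Real.norm_of_nonneg
        (add_nonneg (div_nonneg (sub_nonneg.2 ht1) hpos.le) ht0)]
      field_simp
    rw [annulus, Set.mem_ofPred_eq, hn]
    rcases ht0.eq_or_lt with h | h
    · rw [← h]; simp [hs1]
      simpa using hs1'
    · constructor <;> nlinarith

/-! ### Square roots and factorizations of functions nonnegative on the circle. -/

/-- A continuous square root of a nonvanishing holomorphic function is holomorphic. -/
theorem differentiableAt_of_sq {w q : ℂ → ℂ} {a : ℂ} (hw : ContinuousAt w a)
    (hq : DifferentiableAt ℂ q a) (hwa : w a ≠ 0) (h : ∀ᶠ z in nhds a, w z ^ 2 = q z) :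
    DifferentiableAt ℂ w a := by
  have hsum : Filter.Tendsto (fun z => w z + w a) (nhdsWithin a {a}ᶜ) (nhds (w a + w a)) :=
    (hw.tendsto.add_const (w a)).mono_left nhdsWithin_le_nhds
  have h2 : w a + w a ≠ 0 := by rw [← two_mul]; exact mul_ne_zero two_ne_zero hwa
  refine HasDerivAt.differentiableAt (f' := deriv q a / (w a + w a)) ?_
  rw [hasDerivAt_iff_tendsto_slope]
  refine ((hasDerivAt_iff_tendsto_slope.1 hq.hasDerivAt).div hsum h2).congr' ?_
  filter_upwards [nhdsWithin_le_nhds h, hsum.eventually_ne h2, self_mem_nhdsWithin] with z hz hne hza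
  have hza' : z - a ≠ 0 := sub_ne_zero.2 hza
  simp only [slope_def_field, Pi.div_apply]
  rw [← hz, ← h.self_of_nhds]
  field_simp
  ring

/-- A holomorphic function without zeros which is positive on the unit circle has a holomorphic
square root which is positive on the unit circle. -/
theorem IsSymmetricDomain.exists_sqrt {D : Set ℂ} (hD : IsSymmetricDomain D) {q : ℂ → ℂ}
    (hq : AnalyticOnNhd ℂ q D) (h0 : ∀ ζ ∈ D, q ζ ≠ 0)
    (hpos : ∀ ζ ∈ circle 1, (q ζ).im = 0 ∧ 0 < (q ζ).re) :
    ∃ w : ℂ → ℂ, AnalyticOnNhd ℂ w D ∧ (∀ ζ ∈ D, w ζ ^ 2 = q ζ) ∧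
      ∀ ζ ∈ circle 1, (w ζ).im = 0 ∧ 0 < (w ζ).re := by
  classical
  have hqc : Continuous fun a : D => q a := hq.continuousOn.domRestrict
  have hcirc : ∀ ζ ∈ D, (((1 - 0) / ‖ζ‖ + 0 : ℝ) : ℂ) * ζ ∈ circle 1 := by
    intro ζ hζ
    have := hD.norm_pos hζ
    simp [circle, this.ne']
  have hn : ∀ a : D, ‖(a : ℂ)‖ ≠ 0 := fun a => (hD.norm_pos a.2).ne'
  -- The radial retraction: time `0` lies on the unit circle and time `1` is the identity. The
  -- domain `D` need not be simply connected, but a logarithm of `q` exists on the circle, namely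
  -- the real one, and lifts along the retraction.
  let γ : unitInterval × D → D := fun x =>
    ⟨(((1 - (x.1 : ℝ)) / ‖(x.2 : ℂ)‖ + x.1 : ℝ) : ℂ) * x.2, hD.radial_mem _ x.2.2 _ x.1.2⟩
  have hγ : Continuous γ := by
    refine Continuous.subtype_mk ?_ _
    have h1 : Continuous fun x : unitInterval × D => (1 - (x.1 : ℝ)) / ‖(x.2 : ℂ)‖ + x.1 :=
      ((by fun_prop : Continuous fun x : unitInterval × D => 1 - (x.1 : ℝ)).div
        (by fun_prop : Continuous fun x : unitInterval × D => ‖(x.2 : ℂ)‖) fun x => hn x.2).add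
        (by fun_prop)
    exact (Complex.continuous_ofReal.comp h1).mul (by fun_prop)
  let H : C(unitInterval × D, {z : ℂ // z ≠ 0}) :=
    ⟨fun x => ⟨q (γ x), h0 _ (γ x).2⟩, (hqc.comp hγ).subtype_mk _⟩
  have hγ0 : ∀ a : D, ((γ (0, a) : D) : ℂ) ∈ circle 1 := fun a => hcirc a a.2
  have hre : ∀ a : D, (q (γ (0, a))) = ((q (γ (0, a))).re : ℂ) := fun a =>
    Complex.ext (by simp) (by simp [(hpos _ (hγ0 a)).1])
  have hrc : Continuous fun a : D => (q (γ (0, a))).re :=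
    Complex.continuous_re.comp (hqc.comp (hγ.comp (by fun_prop)))
  let f : C(D, ℂ) := ⟨fun a => (Real.log (q (γ (0, a))).re : ℂ),
    Complex.continuous_ofReal.comp (hrc.log fun a => (hpos _ (hγ0 a)).2.ne')⟩
  have hf : ∀ a, H (0, a) = (⟨_, (f a).exp_ne_zero⟩ : {z : ℂ // z ≠ 0}) := by
    intro a
    refine Subtype.ext ?_
    change q (γ (0, a)) = Complex.exp (Real.log (q (γ (0, a))).re : ℂ)
    rw [← Complex.ofReal_exp, Real.exp_log (hpos _ (hγ0 a)).2, ← hre]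
  let L := Complex.isCoveringMap_exp.liftHomotopy H f hf
  have hL : ∀ x, Complex.exp (L x) = q (γ x) := fun x =>
    congrArg Subtype.val (congrFun (Complex.isCoveringMap_exp.liftHomotopy_lifts H f hf) x)
  have hγ1 : ∀ a : D, γ (1, a) = a := fun a => Subtype.ext (by simp [γ])
  have hLcirc : ∀ a : D, (a : ℂ) ∈ circle 1 → L (1, a) = f a := by
    intro a ha
    have hna : ‖(a : ℂ)‖ = 1 := ha
    -- Points of the unit circle do not move, so there the lift keeps its real initial value and the
    -- root is positive.
    have hconst : H.comp ((ContinuousMap.id unitInterval).prodMk (.const unitInterval a))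
        = .const unitInterval (H (0, a)) := by
      ext t
      simp [H, γ, hna]
    change Complex.isCoveringMap_exp.liftPath
      (H.comp ((ContinuousMap.id unitInterval).prodMk (.const unitInterval a))) (f a) (hf a) 1 = f a
    have key : (ContinuousMap.const unitInterval (f a)) = Complex.isCoveringMap_exp.liftPath
        (H.comp ((ContinuousMap.id unitInterval).prodMk (.const unitInterval a))) (f a) (hf a) := by
      refine (Complex.isCoveringMap_exp.eq_liftPath_iff' _).2 ⟨?_, rfl⟩
      rw [hconst]
      funext t
      exact (hf a).symm
    rw [← key]
    rfl
  let w : ℂ → ℂ := fun ζ => if h : ζ ∈ D then Complex.exp (L (1, ⟨ζ, h⟩) / 2) else 0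
  have hwD : ∀ a : D, w a = Complex.exp (L (1, a) / 2) := fun a => dif_pos a.2
  have hsq : ∀ ζ ∈ D, w ζ ^ 2 = q ζ := by
    intro ζ hζ
    rw [hwD ⟨ζ, hζ⟩, ← Complex.exp_nat_mul]
    have := hL (1, ⟨ζ, hζ⟩)
    rw [hγ1] at this
    rw [← this]
    congr 1
    push_cast
    ring
  have hwc : ContinuousOn w D := by
    rw [continuousOn_iff_continuous_domRestrict]
    have h1 : Set.domRestrict D w = fun a : D => Complex.exp (L (1, a) / 2) := funext hwD
    rw [h1]
    have h2 : Continuous fun a : D => L (1, a) := L.continuous.comp (by fun_prop)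
    fun_prop
  refine ⟨w, ?_, hsq, fun ζ hζ => ?_⟩
  · rw [hD.analyticOnNhd_iff]
    intro ζ hζ
    have hmem := hD.isOpen.mem_nhds hζ
    refine (differentiableAt_of_sq (hwc.continuousAt hmem) (hq ζ hζ).differentiableAt ?_ ?_
      ).differentiableWithinAt
    · rw [hwD ⟨ζ, hζ⟩]
      exact Complex.exp_ne_zero _
    · filter_upwards [hmem] with z hz
      exact hsq z hz
  · have hζD := hD.circle_subset hζ
    have h1 : w ζ = ((Real.exp (Real.log (q (γ (0, ⟨ζ, hζD⟩))).re / 2) : ℝ) : ℂ) := by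
      rw [hwD ⟨ζ, hζD⟩, hLcirc ⟨ζ, hζD⟩ hζ]
      simp [f]
    rw [h1]
    exact ⟨Complex.ofReal_im _, by rw [Complex.ofReal_re]; exact Real.exp_pos _⟩

/-- Even holomorphic functions on `D` which are nonnegative on the unit circle. -/
structure IsNonnegEven (D : Set ℂ) (f : ℂ → ℂ) : Prop where
  analyticOnNhd : AnalyticOnNhd ℂ f D
  even : ∀ ζ ∈ D, f (-ζ) = f ζ
  nonneg : ∀ ζ ∈ circle 1, (f ζ).im = 0 ∧ 0 ≤ (f ζ).re

theorem exists_eq_sub_mul {D : Set ℂ} (hD : IsOpen D) {f : ℂ → ℂ} (hf : AnalyticOnNhd ℂ f D)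
    {v : ℂ} (hv : v ∈ D) (hfv : f v = 0) :
    ∃ g : ℂ → ℂ, AnalyticOnNhd ℂ g D ∧ ∀ ζ, f ζ = (ζ - v) * g ζ := by
  refine ⟨dslope f v, ?_, fun ζ => ?_⟩
  · rw [Complex.analyticOnNhd_iff_differentiableOn hD,
      Complex.differentiableOn_dslope (hD.mem_nhds hv)]
    exact hf.differentiableOn
  · have := sub_smul_dslope f v ζ
    rw [hfv, sub_zero, smul_eq_mul] at this
    exact this.symm

/-- The product of the factors belonging to the zeros `±u`, `±1/conj u`; it is `|ζ² - u²|²` on the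
unit circle. -/
def quadFactor (u ζ : ℂ) : ℂ := (ζ ^ 2 - u ^ 2) * (1 - conj u ^ 2 * ζ ^ 2) / ζ ^ 2

theorem quadFactor_of_mem_circle (u : ℂ) {ζ : ℂ} (hζ : ζ ∈ circle 1) :
    quadFactor u ζ = (Complex.normSq (ζ ^ 2 - u ^ 2) : ℂ) := by
  have h0 := ne_zero_of_mem_circle one_pos hζ
  have h1 := one_div_conj_of_mem_circle hζ
  have hc : conj ζ = ζ⁻¹ := by
    rw [← inv_inv (conj ζ), ← one_div (conj ζ), h1]
  rw [quadFactor, ← Complex.mul_conj, map_sub, map_pow, map_pow, hc]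
  field_simp

namespace IsSymmetricDomain

variable {D : Set ℂ} (hD : IsSymmetricDomain D) {f : ℂ → ℂ}
include hD

/-- By evenness `-u` is a zero as well, and it differs from `u` because `0 ∉ D`. -/
theorem exists_eq_sq_sub_mul (hf : AnalyticOnNhd ℂ f D) (he : ∀ ζ ∈ D, f (-ζ) = f ζ)
    {u : ℂ} (hu : u ∈ D) (hfu : f u = 0) :
    ∃ g : ℂ → ℂ, AnalyticOnNhd ℂ g D ∧ (∀ ζ ∈ D, g (-ζ) = g ζ) ∧
      ∀ ζ, f ζ = (ζ ^ 2 - u ^ 2) * g ζ := by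
  have hu0 := hD.ne_zero u hu
  obtain ⟨g₁, hg₁, h₁⟩ := exists_eq_sub_mul hD.isOpen hf hu hfu
  have h2 : g₁ (-u) = 0 := by
    have h3 := h₁ (-u)
    rw [he u hu, hfu] at h3
    refine (mul_eq_zero.1 h3.symm).resolve_left ?_
    rw [← neg_add', neg_eq_zero, ← two_mul]
    exact mul_ne_zero two_ne_zero hu0
  obtain ⟨g, hg, h₂⟩ := exists_eq_sub_mul hD.isOpen hg₁ (hD.neg_mem u hu) h2
  have hfg : ∀ ζ, f ζ = (ζ ^ 2 - u ^ 2) * g ζ := fun ζ => by rw [h₁, h₂]; ring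
  refine ⟨g, hg, ?_, hfg⟩
  have hprod : ∀ ζ ∈ D, (ζ ^ 2 - u ^ 2) * (g (-ζ) - g ζ) = 0 := by
    intro ζ hζ
    have h3 := he ζ hζ
    rw [hfg, hfg] at h3
    linear_combination h3
  rcases hD.eq_zero_or_eq_zero_of_mul ((analyticOnNhd_id.pow 2).sub analyticOnNhd_const)
    ((hD.analyticOnNhd_neg hg).sub hg) hprod with h | h
  · exfalso
    have h1 := h 1 (hD.circle_subset mem_circle_one)
    have hI := h Complex.I (hD.circle_subset (by simp [circle]))
    simp only [Pi.pow_apply, Pi.sub_apply, one_pow, Complex.I_sq] at h1 hI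
    have : (2 : ℂ) = 0 := by linear_combination h1 - hI
    exact two_ne_zero this
  · exact fun ζ hζ => sub_eq_zero.1 (h ζ hζ)

theorem analyticOnNhd_quadFactor (u : ℂ) : AnalyticOnNhd ℂ (quadFactor u) D := by
  intro ζ hζ
  have h0 := pow_ne_zero 2 (hD.ne_zero ζ hζ)
  unfold quadFactor
  fun_prop (disch := exact h0)

theorem analyticOrderAt_ne_top (hf : AnalyticOnNhd ℂ f D) (hne : ∃ ζ ∈ D, f ζ ≠ 0) {u : ℂ}
    (hu : u ∈ D) : analyticOrderAt f u ≠ ⊤ := by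
  obtain ⟨ζ, hζ, hfζ⟩ := hne
  intro h
  exact hfζ (hf.eqOn_zero_of_preconnected_of_eventuallyEq_zero hD.isConnected.isPreconnected hu
    (analyticOrderAt_eq_top.1 h) hζ)

omit hD in
theorem exists_quadFactor_ne_zero (u : ℂ) : ∃ ζ ∈ circle 1, quadFactor u ζ ≠ 0 := by
  by_contra h
  push Not at h
  have h1 := h 1 mem_circle_one
  have hI := h Complex.I (by simp [circle])
  rw [quadFactor_of_mem_circle u mem_circle_one] at h1
  rw [quadFactor_of_mem_circle u (by simp [circle])] at hI
  simp only [Complex.ofReal_eq_zero, map_eq_zero, one_pow, Complex.I_sq] at h1 hI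
  have : (2 : ℂ) = 0 := by linear_combination h1 - hI
  exact two_ne_zero this

end IsSymmetricDomain

theorem isClosed_nonneg : IsClosed {z : ℂ | z.im = 0 ∧ 0 ≤ z.re} :=
  (isClosed_eq Complex.continuous_im continuous_const).inter
    (isClosed_le continuous_const Complex.continuous_re)

theorem nonneg_of_ofReal_mul {c : ℝ} (hc : 0 < c) {z : ℂ}
    (h : ((c : ℂ) * z).im = 0 ∧ 0 ≤ ((c : ℂ) * z).re) : z.im = 0 ∧ 0 ≤ z.re := by
  rw [Complex.im_ofReal_mul, Complex.re_ofReal_mul] at h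
  exact ⟨(mul_eq_zero.1 h.1).resolve_left hc.ne', nonneg_of_mul_nonneg_right h.2 hc⟩

namespace IsNonnegEven

variable {D : Set ℂ} {f : ℂ → ℂ}

theorem reflect_eq (hf : IsNonnegEven D f) (hD : IsSymmetricDomain D) :
    ∀ ζ ∈ D, reflect f ζ = f ζ :=
  hD.reflect_eq hf.analyticOnNhd fun ζ hζ => Complex.conj_eq_iff_im.2 (hf.nonneg ζ hζ).1

/-- A factor which changes sign along the unit circle comes with a zero of the other one. -/
theorem eq_zero_of_mul (hf : IsNonnegEven D f) (hD : IsSymmetricDomain D) {g : ℂ → ℂ}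
    (hg : AnalyticOnNhd ℂ g D) {u : ℂ} (hu : u ∈ circle 1)
    (hfg : ∀ ζ, f ζ = (ζ ^ 2 - u ^ 2) * g ζ) : g u = 0 := by
  have hu0 := ne_zero_of_mem_circle one_pos hu
  -- Along `θ ↦ u exp(iθ)` one has `f = sin θ · W(θ)` with `W` continuous. Nonnegativity of `f`
  -- gives `W ≥ 0` for small `θ > 0` and `W ≤ 0` for small `θ < 0`, hence `W(0) = 0`.
  set W : ℝ → ℂ := fun θ => 2 * Complex.I * u ^ 2 * Complex.exp (θ * Complex.I) *
    g (u * Complex.exp (θ * Complex.I)) with hW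
  have hfW : ∀ θ : ℝ, f (u * Complex.exp (θ * Complex.I)) = ((Real.sin θ : ℝ) : ℂ) * W θ := by
    intro θ
    rw [hfg, hW]
    simp only
    have h1 : (u * Complex.exp (θ * Complex.I)) ^ 2 - u ^ 2
        = 2 * Complex.I * u ^ 2 * Complex.exp (θ * Complex.I) * Real.sin θ := by
      have h2 : (Real.cos θ : ℂ) ^ 2 + (Real.sin θ : ℂ) ^ 2 = 1 := by
        exact_mod_cast Real.cos_sq_add_sin_sq θ
      rw [Complex.exp_mul_I, ← Complex.ofReal_cos, ← Complex.ofReal_sin]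
      linear_combination u ^ 2 * h2 - (u ^ 2 * (Real.sin θ : ℂ) ^ 2) * Complex.I_sq
    rw [h1]
    ring
  have hmem : ∀ θ : ℝ, u * Complex.exp (θ * Complex.I) ∈ circle 1 := by
    intro θ
    rw [circle, Set.mem_ofPred_eq, norm_mul, Complex.norm_exp_ofReal_mul_I, mul_one]
    exact hu
  have hcont : ContinuousAt W 0 := by
    have h1 : ContinuousAt g (u * Complex.exp (((0 : ℝ) : ℂ) * Complex.I)) :=
      (hg _ (hD.circle_subset (hmem 0))).continuousAt
    have h2 : ContinuousAt (fun θ : ℝ => u * Complex.exp (θ * Complex.I)) 0 := by fun_prop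
    have h3 : ContinuousAt (fun θ : ℝ => 2 * Complex.I * u ^ 2 * Complex.exp (θ * Complex.I)) 0 := by
      fun_prop
    exact h3.mul (ContinuousAt.comp (f := fun θ : ℝ => u * Complex.exp (θ * Complex.I)) h1 h2)
  have hpos : (W 0).im = 0 ∧ 0 ≤ (W 0).re := by
    refine isClosed_nonneg.mem_of_tendsto
      (hcont.tendsto.mono_left (nhdsWithin_le_nhds (s := Set.Ioi 0))) ?_
    filter_upwards [Ioo_mem_nhdsGT Real.pi_pos] with θ hθ
    exact nonneg_of_ofReal_mul (Real.sin_pos_of_mem_Ioo hθ)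
      (hfW θ ▸ hf.nonneg _ (hmem θ))
  have hneg : (-W 0).im = 0 ∧ 0 ≤ (-W 0).re := by
    refine isClosed_nonneg.mem_of_tendsto
      (hcont.neg.tendsto.mono_left (nhdsWithin_le_nhds (s := Set.Iio 0))) ?_
    filter_upwards [Ioo_mem_nhdsLT (show -Real.pi < 0 by linarith [Real.pi_pos])] with θ hθ
    refine nonneg_of_ofReal_mul (c := -Real.sin θ)
      (neg_pos.2 (Real.sin_neg_of_neg_of_neg_pi_lt hθ.2 hθ.1)) ?_
    rw [Complex.ofReal_neg, neg_mul, Pi.neg_apply, mul_neg, neg_neg, ← hfW θ]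
    exact hf.nonneg _ (hmem θ)
  have hW0 : W 0 = 0 := by
    refine Complex.ext (le_antisymm ?_ hpos.2) hpos.1
    simpa using hneg.2
  simp only [hW, Complex.ofReal_zero, zero_mul, Complex.exp_zero, mul_one] at hW0
  exact (mul_eq_zero.1 hW0).resolve_left
    (mul_ne_zero (mul_ne_zero two_ne_zero Complex.I_ne_zero) (pow_ne_zero 2 hu0))

/-- A zero can be split off together with its mirror images. -/
theorem exists_eq_quadFactor_mul (hf : IsNonnegEven D f) (hD : IsSymmetricDomain D) {u : ℂ}
    (hu : u ∈ D) (hfu : f u = 0) :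
    ∃ g, IsNonnegEven D g ∧ ∀ ζ ∈ D, f ζ = quadFactor u ζ * g ζ := by
  have hu0 := hD.ne_zero u hu
  have hcu : conj u ≠ 0 := (map_ne_zero _).2 hu0
  obtain ⟨g₁, hg₁, he₁, h₁⟩ := hD.exists_eq_sq_sub_mul hf.analyticOnNhd hf.even hu hfu
  -- Off the circle this is a further zero, by reflection. On the circle it coincides with `u`, and
  -- positivity makes the zero a multiple one.
  have hv : g₁ (1 / conj u) = 0 := by
    by_cases hn : u ∈ circle 1
    · rw [one_div_conj_of_mem_circle hn]
      exact hf.eq_zero_of_mul hD hg₁ hn h₁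
    · have h2 : f (1 / conj u) = 0 := by
        have h3 := hf.reflect_eq hD u hu
        rw [reflect, hfu] at h3
        exact (map_eq_zero _).1 h3
      rw [h₁] at h2
      refine (mul_eq_zero.1 h2).resolve_left fun h3 => hn ?_
      have h4 : ‖u‖ ^ 2 * ‖u‖ ^ 2 = 1 := by
        have h5 := congrArg norm (sub_eq_zero.1 h3)
        rw [norm_pow, norm_pow, norm_div, norm_one, Complex.norm_conj] at h5
        have := hD.norm_pos hu
        field_simp at h5
        nlinarith [h5]
      have h5 : (‖u‖ ^ 2) = 1 := by nlinarith [sq_nonneg ‖u‖]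
      have := hD.norm_pos hu
      rw [circle, Set.mem_ofPred_eq]
      nlinarith
  obtain ⟨g₂, hg₂, he₂, h₂⟩ := hD.exists_eq_sq_sub_mul hg₁ he₁ (hD.inv_conj_mem u hu) hv
  set g : ℂ → ℂ := fun ζ => -(1 / conj u ^ 2) * ζ ^ 2 * g₂ ζ with hg
  have hga : AnalyticOnNhd ℂ g D :=
    (analyticOnNhd_const.mul (analyticOnNhd_id.pow 2)).mul hg₂
  have hfg : ∀ ζ ∈ D, f ζ = quadFactor u ζ * g ζ := by
    intro ζ hζ
    have hζ0 := hD.ne_zero ζ hζ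
    rw [h₁, h₂, quadFactor, hg]
    field_simp
    ring
  refine ⟨g, ⟨hga, fun ζ hζ => ?_, fun ζ hζ => ?_⟩, hfg⟩
  · simp only [hg, he₂ ζ hζ, neg_sq]
  · have hζD := hD.circle_subset hζ
    have ht := tendsto_circle one_pos hζ
    have hq : ∀ᶠ w in nhdsWithin ζ {ζ}ᶜ, quadFactor u w ≠ 0 := by
      rcases (hD.analyticOnNhd_quadFactor u ζ hζD).eventually_eq_zero_or_eventually_ne_zero with h | h
      · exfalso
        obtain ⟨w, hw, hne⟩ := IsSymmetricDomain.exists_quadFactor_ne_zero u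
        exact hne ((hD.analyticOnNhd_quadFactor u).eqOn_zero_of_preconnected_of_eventuallyEq_zero
          hD.isConnected.isPreconnected hζD h (hD.circle_subset hw))
      · exact h
    -- The quotient by `quadFactor`, which is nonnegative on the circle, is nonnegative wherever the
    -- factor is nonzero, and at its zeros by a limit along the circle.
    refine isClosed_nonneg.mem_of_tendsto
      ((hga ζ hζD).continuousAt.tendsto.comp (ht.mono_right (inf_le_left.trans nhdsWithin_le_nhds)))
      ?_
    filter_upwards [(ht.mono_right inf_le_left).eventually hq,
      (ht.mono_right inf_le_right).eventually (Filter.eventually_principal.2 fun x hx => hx)]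
      with t h1 h2
    set w := ζ * Complex.exp (t * Complex.I)
    rw [quadFactor_of_mem_circle u h2] at h1
    refine nonneg_of_ofReal_mul (c := Complex.normSq (w ^ 2 - u ^ 2))
      (lt_of_le_of_ne (Complex.normSq_nonneg _) fun h => h1 (by rw [← h]; simp)) ?_
    have := hf.nonneg w h2
    rwa [hfg w (hD.circle_subset h2), quadFactor_of_mem_circle u h2] at this

/-- Induction on the number of zeros. -/
theorem induction (hD : IsSymmetricDomain D) {motive Inv : (ℂ → ℂ) → Prop}
    (base : ∀ f, IsNonnegEven D f → (∀ ζ ∈ D, f ζ ≠ 0) → motive f)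
    (step : ∀ f, IsNonnegEven D f → Inv f → (∃ ζ ∈ D, f ζ ≠ 0) → ∀ u ∈ D, f u = 0 →
      ∃ L g, IsNonnegEven D g ∧ Inv g ∧ AnalyticOnNhd ℂ L D ∧ L u = 0 ∧
        (∀ ζ ∈ D, f ζ = L ζ * g ζ) ∧ (motive g → motive f))
    (hf : IsNonnegEven D f) (hI : Inv f) (hne : ∃ ζ ∈ D, f ζ ≠ 0)
    (hfin : {ζ ∈ D | f ζ = 0}.Finite) : motive f := by
  -- The finite set `Z` stays fixed while `f` is replaced by its factors. The sum of the orders over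
  -- `Z` decreases strictly, since the factor `L` vanishes at `u ∈ Z`.
  obtain ⟨Z, hZD, hZ⟩ : ∃ Z : Finset ℂ, (∀ ζ ∈ Z, ζ ∈ D) ∧ ∀ ζ ∈ D, f ζ = 0 → ζ ∈ Z :=
    ⟨hfin.toFinset, fun ζ hζ => ((Set.Finite.mem_toFinset hfin).1 hζ).1,
      fun ζ hζ h => (Set.Finite.mem_toFinset hfin).2 ⟨hζ, h⟩⟩
  obtain ⟨n, hn⟩ : ∃ n, n = ∑ ζ ∈ Z, analyticOrderNatAt f ζ := ⟨_, rfl⟩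
  clear hfin
  induction n using Nat.strong_induction_on generalizing f with
  | _ n ih =>
    by_cases hz : ∀ ζ ∈ D, f ζ ≠ 0
    · exact base f hf hz
    push Not at hz
    obtain ⟨u, hu, hfu⟩ := hz
    obtain ⟨L, g, hg, hIg, hL, hLu, hfLg, hmot⟩ := step f hf hI hne u hu hfu
    have hneg : ∃ ζ ∈ D, g ζ ≠ 0 := by
      obtain ⟨w, hw, hfw⟩ := hne
      exact ⟨w, hw, fun h => hfw (by rw [hfLg w hw, h, mul_zero])⟩
    have hneL : ∃ ζ ∈ D, L ζ ≠ 0 := by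
      obtain ⟨w, hw, hfw⟩ := hne
      exact ⟨w, hw, fun h => hfw (by rw [hfLg w hw, h, zero_mul])⟩
    have hord : ∀ w ∈ D, analyticOrderNatAt f w = analyticOrderNatAt L w + analyticOrderNatAt g w := by
      intro w hw
      rw [← analyticOrderNatAt_mul (hL w hw) (hg.analyticOnNhd w hw)
        (hD.analyticOrderAt_ne_top hL hneL hw)
        (hD.analyticOrderAt_ne_top hg.analyticOnNhd hneg hw)]
      unfold analyticOrderNatAt
      rw [analyticOrderAt_congr]
      filter_upwards [hD.isOpen.mem_nhds hw] with z hz using hfLg z hz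
    refine hmot (ih _ ?_ hg hIg hneg (fun ζ hζ h => hZ ζ hζ (by rw [hfLg ζ hζ, h, mul_zero])) rfl)
    rw [hn]
    refine Finset.sum_lt_sum (fun w hw => ?_) ⟨u, hZ u hu hfu, ?_⟩
    · rw [hord w (hZD w hw)]; exact Nat.le_add_left _ _
    · rw [hord u hu]
      have h1 : analyticOrderAt L u ≠ 0 := (hL u hu).analyticOrderAt_ne_zero.2 hLu
      have h2 := Nat.cast_analyticOrderNatAt (hD.analyticOrderAt_ne_top hL hneL hu)
      have h3 : analyticOrderNatAt L u ≠ 0 := fun h => h1 (by rw [← h2, h]; rfl)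
      omega

end IsNonnegEven

theorem reflect_quadFactor (u ζ : ℂ) (hζ : ζ ≠ 0) : reflect (quadFactor u) ζ = quadFactor u ζ := by
  have hc : conj ζ ≠ 0 := (map_ne_zero _).2 hζ
  simp only [reflect, quadFactor, map_div₀, map_mul, map_sub, map_pow, map_one, Complex.conj_conj]
  field_simp

theorem quadFactor_neg (u ζ : ℂ) : quadFactor u (-ζ) = quadFactor u ζ := by
  simp only [quadFactor, neg_sq]

theorem quadFactor_self (u : ℂ) : quadFactor u u = 0 := by simp [quadFactor]

theorem analyticOrderAt_quadFactor {u : ℂ} (hu : u ≠ 0) (hn : ‖u‖ ≠ 1) :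
    analyticOrderAt (quadFactor u) u = 1 := by
  have hu2 : u ^ 2 ≠ 0 := pow_ne_zero 2 hu
  have ha : AnalyticAt ℂ (quadFactor u) u := by
    unfold quadFactor
    fun_prop (disch := exact hu2)
  have key : analyticOrderAt (quadFactor u) u = (1 : ℕ) := by
    rw [ha.analyticOrderAt_eq_natCast]
    refine ⟨fun ζ => (ζ + u) * (1 - conj u ^ 2 * ζ ^ 2) / ζ ^ 2, ?_, ?_, ?_⟩
    · fun_prop (disch := exact hu2)
    · refine div_ne_zero (mul_ne_zero ?_ ?_) hu2
      · rw [← two_mul]; exact mul_ne_zero two_ne_zero hu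
      · rw [← mul_pow, mul_comm, Complex.mul_conj, Complex.normSq_eq_norm_sq]
        intro h
        have h1 : (‖u‖ ^ 2) ^ 2 = (1 : ℝ) := by
          have := sub_eq_zero.1 h
          exact_mod_cast this.symm
        have h2 : ‖u‖ ^ 2 = 1 := by nlinarith [sq_nonneg ‖u‖]
        exact hn (by nlinarith [norm_nonneg u])
    · refine Filter.Eventually.of_forall fun ζ => ?_
      rw [quadFactor, smul_eq_mul]
      ring
  simpa using key

/-- A real square root of the factor `quadFactor u` for `|u| = 1`. -/
def unitFactor (u ζ : ℂ) : ℂ := Complex.I * conj u * (ζ ^ 2 - u ^ 2) / ζ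

theorem unitFactor_neg (u ζ : ℂ) : unitFactor u (-ζ) = -unitFactor u ζ := by
  simp only [unitFactor, neg_sq, div_neg]

theorem unitFactor_self (u : ℂ) : unitFactor u u = 0 := by simp [unitFactor]

theorem conj_mul_self_of_mem_circle {u : ℂ} (hu : u ∈ circle 1) : conj u * u = 1 := by
  have h1 : ‖u‖ = 1 := hu
  rw [mul_comm, Complex.mul_conj, Complex.normSq_eq_norm_sq, h1]
  simp

theorem unitFactor_sq {u : ℂ} (hu : u ∈ circle 1) (ζ : ℂ) :
    unitFactor u ζ ^ 2 = quadFactor u ζ := by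
  have h1 := conj_mul_self_of_mem_circle hu
  rw [unitFactor, quadFactor, div_pow]
  congr 1
  linear_combination (conj u ^ 2 * (ζ ^ 2 - u ^ 2) ^ 2) * Complex.I_sq
    + (ζ ^ 2 - u ^ 2) * (conj u * u + 1) * h1

theorem reflect_unitFactor {u : ℂ} (hu : u ∈ circle 1) {ζ : ℂ} (hζ : ζ ≠ 0) :
    reflect (unitFactor u) ζ = unitFactor u ζ := by
  have h1 := conj_mul_self_of_mem_circle hu
  have hc : conj ζ ≠ 0 := (map_ne_zero _).2 hζ
  simp only [reflect, unitFactor, map_div₀, map_mul, map_sub, map_pow, map_one, Complex.conj_conj,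
    Complex.conj_I]
  field_simp
  linear_combination (ζ ^ 2 * conj u + u) * h1

/-- The factor of `quadFactor u` which is interchanged with its reflection by `ζ ↦ -ζ`. -/
def skewFactor (u ζ : ℂ) : ℂ := (ζ - u) * (1 + conj u * ζ) / ζ

theorem reflect_skewFactor (u : ℂ) {ζ : ℂ} (hζ : ζ ≠ 0) :
    reflect (skewFactor u) ζ = skewFactor u (-ζ) := by
  have hc : conj ζ ≠ 0 := (map_ne_zero _).2 hζ
  simp only [reflect, skewFactor, map_div₀, map_mul, map_sub, map_add, map_one, Complex.conj_conj]
  field_simp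
  ring

theorem skewFactor_mul_neg (u : ℂ) {ζ : ℂ} (hζ : ζ ≠ 0) :
    skewFactor u ζ * skewFactor u (-ζ) = quadFactor u ζ := by
  simp only [skewFactor, quadFactor]
  field_simp
  ring

theorem sub_mul_reflect_sub (u : ℂ) {ζ : ℂ} (hζ : ζ ≠ 0) :
    (ζ ^ 2 - u ^ 2) * reflect (fun ζ => ζ ^ 2 - u ^ 2) ζ = quadFactor u ζ := by
  have hc : conj ζ ≠ 0 := (map_ne_zero _).2 hζ
  simp only [reflect, quadFactor, map_div₀, map_sub, map_pow, map_one, Complex.conj_conj]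
  field_simp

theorem reflect_mul (f g : ℂ → ℂ) (ζ : ℂ) :
    reflect (fun w => f w * g w) ζ = reflect f ζ * reflect g ζ := map_mul _ _ _

namespace IsNonnegEven

variable {D : Set ℂ} {f : ℂ → ℂ}

/-- A nonvanishing function has an even square root, real on the unit circle. -/
theorem exists_sqrt_of_ne_zero (hf : IsNonnegEven D f) (hD : IsSymmetricDomain D)
    (h0 : ∀ ζ ∈ D, f ζ ≠ 0) :
    ∃ w : ℂ → ℂ, AnalyticOnNhd ℂ w D ∧ (∀ ζ ∈ D, w ζ ^ 2 = f ζ) ∧ (∀ ζ ∈ D, w (-ζ) = w ζ) ∧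
      ∀ ζ ∈ D, reflect w ζ = w ζ := by
  obtain ⟨w, hw, hsq, hpos⟩ := hD.exists_sqrt hf.analyticOnNhd h0 fun ζ hζ => by
    obtain ⟨h1, h2⟩ := hf.nonneg ζ hζ
    refine ⟨h1, h2.lt_of_ne fun h => h0 ζ (hD.circle_subset hζ) (Complex.ext h.symm h1)⟩
  refine ⟨w, hw, hsq, hD.eqOn_of_circle (hD.analyticOnNhd_neg hw) hw fun ζ hζ => ?_,
    hD.reflect_eq hw fun ζ hζ => Complex.conj_eq_iff_im.2 (hpos ζ hζ).1⟩
  have hζD := hD.circle_subset hζ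
  -- Evenness of `f` leaves `w(-ζ) = ±w(ζ)`, and positivity on the circle excludes the minus sign.
  have h1 : (w (-ζ) - w ζ) * (w (-ζ) + w ζ) = 0 := by
    have h2 := hsq (-ζ) (hD.neg_mem ζ hζD)
    rw [hf.even ζ hζD, ← hsq ζ hζD] at h2
    linear_combination h2
  rcases mul_eq_zero.1 h1 with h | h
  · exact sub_eq_zero.1 h
  · exfalso
    have h3 := congrArg Complex.re h
    rw [Complex.add_re, Complex.zero_re] at h3
    have h4 := (hpos ζ hζ).2
    have h5 := (hpos (-ζ) (by simpa [circle] using hζ)).2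
    linarith

/-- An even function, nonnegative on the unit circle, of the form `g g^*`. -/
theorem exists_mul_reflect (hf : IsNonnegEven D f) (hD : IsSymmetricDomain D)
    (hne : ∃ ζ ∈ D, f ζ ≠ 0) (hfin : {ζ ∈ D | f ζ = 0}.Finite) (ε : ℂ) (hε : ε = 1 ∨ ε = -1) :
    ∃ g : ℂ → ℂ, AnalyticOnNhd ℂ g D ∧ (∀ ζ ∈ D, g ζ * reflect g ζ = f ζ) ∧
      (ε = 1 → ∀ ζ ∈ D, g (-ζ) = g ζ) ∧ (ε = -1 → ∀ ζ ∈ D, g (-ζ) = reflect g ζ) := by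
  refine IsNonnegEven.induction (Inv := fun _ => True) (motive := fun f => ∃ g : ℂ → ℂ,
    AnalyticOnNhd ℂ g D ∧ (∀ ζ ∈ D, g ζ * reflect g ζ = f ζ) ∧
      (ε = 1 → ∀ ζ ∈ D, g (-ζ) = g ζ) ∧ (ε = -1 → ∀ ζ ∈ D, g (-ζ) = reflect g ζ))
    hD ?_ ?_ hf trivial hne hfin
  · intro f hf h0
    obtain ⟨w, hw, hsq, he, hr⟩ := hf.exists_sqrt_of_ne_zero hD h0
    refine ⟨w, hw, fun ζ hζ => by rw [hr ζ hζ, ← hsq ζ hζ, sq], fun _ => he, fun _ ζ hζ => ?_⟩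
    rw [he ζ hζ, hr ζ hζ]
  · intro f hf _ _ u hu hfu
    obtain ⟨f₁, hf₁, hff₁⟩ := hf.exists_eq_quadFactor_mul hD hu hfu
    refine ⟨quadFactor u, f₁, hf₁, trivial, hD.analyticOnNhd_quadFactor u, quadFactor_self u, hff₁,
      ?_⟩
    rintro ⟨g, hg, hgf, he, hs⟩
    -- Both `ζ² - u²` and `skewFactor u` give `quadFactor u` when multiplied by their reflections.
    -- The former is even, while the latter is reflected by `ζ ↦ -ζ`; the choice follows the
    -- required symmetry.
    rcases hε with rfl | rfl
    · refine ⟨fun ζ => (ζ ^ 2 - u ^ 2) * g ζ,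
        ((analyticOnNhd_id.pow 2).sub analyticOnNhd_const).mul hg, fun ζ hζ => ?_,
        fun _ ζ hζ => ?_, fun h => ?_⟩
      · rw [reflect_mul (fun ζ => ζ ^ 2 - u ^ 2) g, hff₁ ζ hζ, ← hgf ζ hζ,
          ← sub_mul_reflect_sub u (hD.ne_zero ζ hζ)]
        ring
      · beta_reduce
        rw [neg_sq, he rfl ζ hζ]
      · exact absurd h (by norm_num)
    · refine ⟨fun ζ => skewFactor u ζ * g ζ, AnalyticOnNhd.mul (fun ζ hζ => ?_) hg, fun ζ hζ => ?_,
        fun h => ?_, fun _ ζ hζ => ?_⟩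
      · have h0 := hD.ne_zero ζ hζ
        unfold skewFactor
        fun_prop (disch := exact h0)
      · rw [reflect_mul (skewFactor u) g, hff₁ ζ hζ, ← hgf ζ hζ,
          reflect_skewFactor u (hD.ne_zero ζ hζ), ← skewFactor_mul_neg u (hD.ne_zero ζ hζ)]
        ring
      · exact absurd h (by norm_num)
      · beta_reduce
        rw [reflect_mul (skewFactor u) g, hs rfl ζ hζ, reflect_skewFactor u (hD.ne_zero ζ hζ)]

/-- An even function, nonnegative on the unit circle, whose zeros off the unit circle are of even
order, has a square root which is real on the unit circle. -/
theorem exists_sqrt (hf : IsNonnegEven D f) (hD : IsSymmetricDomain D)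
    (hne : ∃ ζ ∈ D, f ζ ≠ 0) (hfin : {ζ ∈ D | f ζ = 0}.Finite)
    (hord : ∀ w ∈ D, ‖w‖ ≠ 1 → ∀ n : ℕ, Odd n → analyticOrderAt f w ≠ n) :
    ∃ (δ : ℂ → ℂ) (ε : ℂ), AnalyticOnNhd ℂ δ D ∧ (∀ ζ ∈ D, δ ζ ^ 2 = f ζ) ∧ (ε = 1 ∨ ε = -1) ∧
      (∀ ζ ∈ D, δ (-ζ) = ε * δ ζ) ∧ ∀ ζ ∈ D, reflect δ ζ = δ ζ := by
  refine IsNonnegEven.induction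
    (Inv := fun f => ∀ w ∈ D, ‖w‖ ≠ 1 → ∀ n : ℕ, Odd n → analyticOrderAt f w ≠ n)
    (motive := fun f => ∃ (δ : ℂ → ℂ) (ε : ℂ), AnalyticOnNhd ℂ δ D ∧ (∀ ζ ∈ D, δ ζ ^ 2 = f ζ) ∧
      (ε = 1 ∨ ε = -1) ∧ (∀ ζ ∈ D, δ (-ζ) = ε * δ ζ) ∧ ∀ ζ ∈ D, reflect δ ζ = δ ζ)
    hD ?_ ?_ hf hord hne hfin
  · intro f hf h0
    obtain ⟨w, hw, hsq, he, hr⟩ := hf.exists_sqrt_of_ne_zero hD h0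
    exact ⟨w, 1, hw, hsq, Or.inl rfl, fun ζ hζ => by rw [he ζ hζ, one_mul], hr⟩
  · intro f hf hI hne u hu hfu
    obtain ⟨l, η, g, hg, hl, hlu, hη, hln, hlr, hfg⟩ : ∃ (l : ℂ → ℂ) (η : ℂ) (g : ℂ → ℂ),
        IsNonnegEven D g ∧ AnalyticOnNhd ℂ l D ∧ l u = 0 ∧ (η = 1 ∨ η = -1) ∧
        (∀ ζ ∈ D, l (-ζ) = η * l ζ) ∧ (∀ ζ ∈ D, reflect l ζ = l ζ) ∧
        ∀ ζ ∈ D, f ζ = l ζ ^ 2 * g ζ := by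
      obtain ⟨f₁, hf₁, hff₁⟩ := hf.exists_eq_quadFactor_mul hD hu hfu
      -- On the circle `quadFactor u` is already the square of `unitFactor u`, which is odd. Off the
      -- circle `u` is a simple zero of it, so the even order of `f` at `u` lets `quadFactor u` be
      -- split off twice.
      by_cases hn : ‖u‖ = 1
      · refine ⟨unitFactor u, -1, f₁, hf₁, fun ζ hζ => ?_, unitFactor_self u, Or.inr rfl,
          fun ζ _ => by rw [unitFactor_neg, neg_one_mul],
          fun ζ hζ => reflect_unitFactor hn (hD.ne_zero ζ hζ),
          fun ζ hζ => by rw [unitFactor_sq hn, hff₁ ζ hζ]⟩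
        have h0 := hD.ne_zero ζ hζ
        unfold unitFactor
        fun_prop (disch := exact h0)
      · have hf₁u : f₁ u = 0 := by
          by_contra hcon
          refine hI u hu hn 1 odd_one ?_
          have h1 : analyticOrderAt f u = analyticOrderAt (quadFactor u * f₁) u :=
            analyticOrderAt_congr (by
              filter_upwards [hD.isOpen.mem_nhds hu] with z hz using hff₁ z hz)
          rw [h1, analyticOrderAt_mul (hD.analyticOnNhd_quadFactor u u hu) (hf₁.analyticOnNhd u hu),
            analyticOrderAt_quadFactor (hD.ne_zero u hu) hn,
            (hf₁.analyticOnNhd u hu).analyticOrderAt_eq_zero.2 hcon]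
          simp
        obtain ⟨f₂, hf₂, hff₂⟩ := hf₁.exists_eq_quadFactor_mul hD hu hf₁u
        refine ⟨quadFactor u, 1, f₂, hf₂, hD.analyticOnNhd_quadFactor u, quadFactor_self u,
          Or.inl rfl, fun ζ _ => by rw [quadFactor_neg, one_mul],
          fun ζ hζ => reflect_quadFactor u ζ (hD.ne_zero ζ hζ),
          fun ζ hζ => by rw [hff₁ ζ hζ, hff₂ ζ hζ]; ring⟩
    refine ⟨fun ζ => l ζ ^ 2, g, hg, ?_, hl.pow 2, by simp [hlu], hfg, ?_⟩
    · intro w hw hwn n hn hgn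
      have hnel : ∃ ζ ∈ D, l ζ ≠ 0 := by
        obtain ⟨z, hz, hfz⟩ := hne
        exact ⟨z, hz, fun h => hfz (by rw [hfg z hz, h]; simp)⟩
      have h1 : analyticOrderAt f w = analyticOrderAt (l ^ 2 * g) w :=
        analyticOrderAt_congr (by
          filter_upwards [hD.isOpen.mem_nhds hw] with z hz using hfg z hz)
      have h2 := Nat.cast_analyticOrderNatAt (hD.analyticOrderAt_ne_top hl hnel hw)
      refine hI w hw hwn (2 * analyticOrderNatAt l w + n) ((even_two_mul _).add_odd hn) ?_
      rw [h1, analyticOrderAt_mul ((hl w hw).pow 2) (hg.analyticOnNhd w hw),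
        analyticOrderAt_pow (hl w hw), hgn, ← h2, Nat.cast_add, Nat.cast_mul, nsmul_eq_mul]
    · rintro ⟨δ, ε, hδ, hsq, hε, hδn, hδr⟩
      refine ⟨fun ζ => l ζ * δ ζ, η * ε, hl.mul hδ, fun ζ hζ => ?_, ?_, fun ζ hζ => ?_,
        fun ζ hζ => ?_⟩
      · rw [mul_pow, hsq ζ hζ, hfg ζ hζ]
      · rcases hη with rfl | rfl <;> rcases hε with rfl | rfl <;> simp
      · beta_reduce
        rw [hln ζ hζ, hδn ζ hζ]; ring
      · rw [reflect_mul, hlr ζ hζ, hδr ζ hζ]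

end IsNonnegEven

/-! ### Meromorphic functions in normal form. -/

section NormalForm

variable {f g p : ℂ → ℂ} {U : Set ℂ} {x : ℂ}

theorem toMeromorphicNFOn_eventuallyEq (hf : MeromorphicOn f U) (hx : x ∈ U)
    (ha : AnalyticAt ℂ f x) : toMeromorphicNFOn f U =ᶠ[nhds x] f := by
  have h := toMeromorphicNFOn_eq_toMeromorphicNFAt_on_nhds hf hx
  rwa [toMeromorphicNFAt_eq_self.2 ha.meromorphicNFAt] at h

theorem analyticAt_toMeromorphicNFOn (hf : MeromorphicOn f U) (hx : x ∈ U)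
    (h : 0 ≤ meromorphicOrderAt f x) : AnalyticAt ℂ (toMeromorphicNFOn f U) x := by
  rw [← (meromorphicNFOn_toMeromorphicNFOn f U hx).meromorphicOrderAt_nonneg_iff_analyticAt,
    meromorphicOrderAt_congr (hf.toMeromorphicNFOn_eq_self_on_nhdsNE hx)]
  exact h

theorem eq_of_eventually_nhdsNE (hf : ContinuousAt f x) (hg : ContinuousAt g x)
    (h : ∀ᶠ w in nhdsWithin x {x}ᶜ, f w = g w) : f x = g x :=
  tendsto_nhds_unique_of_eventuallyEq (hf.tendsto.mono_left nhdsWithin_le_nhds)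
    (hg.tendsto.mono_left nhdsWithin_le_nhds) h

/-- A meromorphic function whose square is holomorphic has a holomorphic extension. It is enough to
know its square on a small open set. -/
theorem exists_analyticOnNhd_of_sq (hU : IsPreconnected U) (hf : MeromorphicOn f U)
    (hp : AnalyticOnNhd ℂ p U) {W : Set ℂ} (hW : IsOpen W) (hWU : W ⊆ U) (hne : W.Nonempty)
    (hfW : AnalyticOnNhd ℂ f W) (hsq : ∀ ζ ∈ W, f ζ ^ 2 = p ζ) :
    ∃ F : ℂ → ℂ, AnalyticOnNhd ℂ F U ∧ (∀ ζ ∈ U, F ζ ^ 2 = p ζ) ∧ ∀ ζ ∈ W, F ζ = f ζ := by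
  have hpm : MeromorphicOn p U := fun x hx => (hp x hx).meromorphicAt
  have hdm : MeromorphicOn (f ^ 2 - p) U := (hf.pow 2).sub hpm
  obtain ⟨w, hw⟩ := hne
  -- This is the identity theorem for meromorphic functions: the relation holds near a point of `W`,
  -- hence off isolated points in the connected set `U`.
  have htop : ∀ x ∈ U, meromorphicOrderAt (f ^ 2 - p) x = ⊤ := by
    intro x hx
    by_contra hcon
    refine hdm.meromorphicOrderAt_ne_top_of_isPreconnected hU hx (hWU hw) hcon ?_
    rw [meromorphicOrderAt_eq_top_iff]
    filter_upwards [nhdsWithin_le_nhds (hW.mem_nhds hw)] with z hz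
    exact sub_eq_zero.2 (hsq z hz)
  have hev : ∀ x ∈ U, ∀ᶠ z in nhdsWithin x {x}ᶜ, f z ^ 2 = p z := by
    intro x hx
    filter_upwards [meromorphicOrderAt_eq_top_iff.1 (htop x hx)] with z hz
    exact sub_eq_zero.1 hz
  -- A pole of `f` would give a pole of `f²` of twice the order.
  have hnn : ∀ x ∈ U, 0 ≤ meromorphicOrderAt f x := by
    intro x hx
    have h1 : meromorphicOrderAt (f ^ 2) x = meromorphicOrderAt p x :=
      meromorphicOrderAt_congr (hev x hx)
    have h2 := (hp x hx).meromorphicOrderAt_nonneg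
    rw [← h1, sq, meromorphicOrderAt_mul (hf x hx) (hf x hx)] at h2
    by_contra hcon
    push Not at hcon
    have h3 : meromorphicOrderAt f x + meromorphicOrderAt f x < 0 := by
      lift meromorphicOrderAt f x to ℤ using hcon.ne_top with n
      norm_cast at hcon ⊢
      omega
    exact absurd h2 (not_le.2 h3)
  have hFa : AnalyticOnNhd ℂ (toMeromorphicNFOn f U) U := fun x hx =>
    analyticAt_toMeromorphicNFOn hf hx (hnn x hx)
  refine ⟨toMeromorphicNFOn f U, hFa, fun x hx => ?_, fun x hx =>
    (toMeromorphicNFOn_eventuallyEq hf (hWU hx) (hfW x hx)).self_of_nhds⟩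
  refine eq_of_eventually_nhdsNE (f := fun x => toMeromorphicNFOn f U x ^ 2)
    ((hFa x hx).continuousAt.pow 2) (hp x hx).continuousAt ?_
  filter_upwards [hev x hx, hf.toMeromorphicNFOn_eq_self_on_nhdsNE hx] with z h1 h2
  rw [h2, h1]

end NormalForm

/-- Properties of functions which are inherited by sums and products. -/
structure IsFunctionRing (P : (ℂ → ℂ) → Prop) : Prop where
  const : ∀ c, P fun _ => c
  add : ∀ f g, P f → P g → P fun ζ => f ζ + g ζ
  mul : ∀ f g, P f → P g → P fun ζ => f ζ * g ζ

theorem isFunctionRing_analyticOnNhd (U : Set ℂ) :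
    IsFunctionRing fun f => AnalyticOnNhd ℂ f U :=
  ⟨fun _ => analyticOnNhd_const, fun _ _ => AnalyticOnNhd.add, fun _ _ => AnalyticOnNhd.mul⟩

theorem isFunctionRing_meromorphicOn (U : Set ℂ) : IsFunctionRing fun f => MeromorphicOn f U :=
  ⟨fun c => MeromorphicOn.const c, fun _ _ => MeromorphicOn.add, fun _ _ => MeromorphicOn.mul⟩

theorem isFunctionRing_continuousOn_differentiableOn (U V : Set ℂ) :
    IsFunctionRing fun f => ContinuousOn f U ∧ DifferentiableOn ℂ f V :=
  ⟨fun _ => ⟨continuousOn_const, differentiableOn_const _⟩,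
    fun _ _ hf hg => ⟨hf.1.add hg.1, hf.2.add hg.2⟩,
    fun _ _ hf hg => ⟨hf.1.mul hg.1, hf.2.mul hg.2⟩⟩

namespace IsFunctionRing

variable {P : (ℂ → ℂ) → Prop} (hP : IsFunctionRing P) {f : ℂ → ℂ} {N N' : ℂ → Mat2}
include hP

theorem neg (hf : P f) : P fun ζ => -f ζ := by
  simpa using hP.mul _ _ (hP.const (-1)) hf

theorem sub {g : ℂ → ℂ} (hf : P f) (hg : P g) : P fun ζ => f ζ - g ζ := by
  simpa [sub_eq_add_neg] using hP.add _ _ hf (hP.neg hg)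

theorem pow_two (hf : P f) : P fun ζ => f ζ ^ 2 := by
  simpa [sq] using hP.mul _ _ hf hf

theorem mat_const (A : Mat2) (i j : Fin 2) : P fun _ => A i j := hP.const _

theorem mat_mul (hN : ∀ i j, P fun ζ => N ζ i j) (hN' : ∀ i j, P fun ζ => N' ζ i j) (i j : Fin 2) :
    P fun ζ => (N ζ * N' ζ) i j := by
  simp only [Matrix.mul_apply, Fin.sum_univ_two]
  exact hP.add _ _ (hP.mul _ _ (hN i 0) (hN' 0 j)) (hP.mul _ _ (hN i 1) (hN' 1 j))

theorem mat_add (hN : ∀ i j, P fun ζ => N ζ i j) (hN' : ∀ i j, P fun ζ => N' ζ i j) (i j : Fin 2) :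
    P fun ζ => (N ζ + N' ζ) i j := hP.add _ _ (hN i j) (hN' i j)

theorem mat_sub (hN : ∀ i j, P fun ζ => N ζ i j) (hN' : ∀ i j, P fun ζ => N' ζ i j) (i j : Fin 2) :
    P fun ζ => (N ζ - N' ζ) i j := hP.sub (hN i j) (hN' i j)

theorem mat_smul (hf : P f) (hN : ∀ i j, P fun ζ => N ζ i j) (i j : Fin 2) :
    P fun ζ => (f ζ • N ζ) i j := hP.mul _ _ hf (hN i j)

theorem mat_adjugate (hN : ∀ i j, P fun ζ => N ζ i j) (i j : Fin 2) :
    P fun ζ => (N ζ).adjugate i j := by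
  simp only [Matrix.adjugate_fin_two]
  fin_cases i <;> fin_cases j
  · exact hN 1 1
  · exact hP.neg (hN 0 1)
  · exact hP.neg (hN 1 0)
  · exact hN 0 0

theorem trace (hN : ∀ i j, P fun ζ => N ζ i j) : P fun ζ => (N ζ).trace := by
  simp only [Matrix.trace_fin_two]
  exact hP.add _ _ (hN 0 0) (hN 1 1)

theorem det (hN : ∀ i j, P fun ζ => N ζ i j) : P fun ζ => (N ζ).det := by
  simp only [Matrix.det_fin_two]
  exact hP.sub (hP.mul _ _ (hN 0 0) (hN 1 1)) (hP.mul _ _ (hN 0 1) (hN 1 0))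

theorem mat_traceFree (hN : ∀ i j, P fun ζ => N ζ i j) (i j : Fin 2) :
    P fun ζ => (traceFree (N ζ)) i j := by
  simp only [traceFree, div_eq_mul_inv]
  exact hP.mat_sub hN (hP.mat_smul (hP.mul _ _ (hP.trace hN) (hP.const _)) (hP.mat_const 1)) i j

end IsFunctionRing

/-- Twisted unitary functions with finitely many singularities, brought into normal form. -/
theorem IsSymmetricDomain.exists_isTwistedSUMeromorphicOn {D : Set ℂ} (hD : IsSymmetricDomain D)
    {M : ℂ → Mat2} {Z : Set ℂ} (hZ : Z.Finite) (hZn : ∀ ζ ∈ D, -ζ ∈ Z → ζ ∈ Z)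
    (hZc : ∀ ζ ∈ D, 1 / conj ζ ∈ Z → ζ ∈ Z) (hM : MatMeromorphicOn M D)
    (ha : ∀ ζ ∈ D, ζ ∉ Z → MatAnalyticAt M ζ) (hdet : ∀ ζ ∈ D, ζ ∉ Z → (M ζ).det = 1)
    (htw : ∀ ζ ∈ D, ζ ∉ Z → sigma3 * M (-ζ) * sigma3 = M ζ)
    (hst : ∀ ζ ∈ D, ζ ∉ Z → (M (1 / conj ζ))ᴴ = (M ζ).adjugate) :
    ∃ M' : ℂ → Mat2, IsTwistedSUMeromorphicOn M' D ∧
      ∀ ζ ∈ D, ζ ∉ Z → MatAnalyticAt M' ζ ∧ M' ζ = M ζ := by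
  -- At points of `Z` the values of `M` are arbitrary. The normal form replaces them by the limits
  -- wherever these are finite, so the identities extend there by continuity.
  set M' : ℂ → Mat2 := fun ζ => Matrix.of fun i j => toMeromorphicNFOn (fun w => M w i j) D ζ with hM'
  have hev : ∀ ζ ∈ D, ζ ∉ Z → ∀ i j, (fun w => M' w i j) =ᶠ[nhds ζ] fun w => M w i j :=
    fun ζ hζ hζZ i j => toMeromorphicNFOn_eventuallyEq (hM i j) hζ (ha ζ hζ hζZ i j)
  have heq : ∀ ζ ∈ D, ζ ∉ Z → M' ζ = M ζ := fun ζ hζ hζZ => by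
    ext i j
    exact (hev ζ hζ hζZ i j).self_of_nhds
  have hmem : ∀ ζ ∈ D, ∀ᶠ w in nhdsWithin ζ {ζ}ᶜ, w ∈ D ∧ w ∉ Z := by
    intro ζ hζ
    filter_upwards [nhdsWithin_le_nhds (hD.isOpen.mem_nhds hζ),
      (hZ.subset Set.sdiff_subset : (Z \ {ζ}).Finite).isClosed.isOpen_compl.mem_nhds
        (show ζ ∈ (Z \ {ζ})ᶜ from fun h => h.2 rfl) |> fun h => nhdsWithin_le_nhds h,
      self_mem_nhdsWithin] with w h1 h2 h3
    exact ⟨h1, fun h => h2 ⟨h, h3⟩⟩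
  have hmero : MatMeromorphicOn M' D := fun i j =>
    (meromorphicNFOn_toMeromorphicNFOn (fun w => M w i j) D).meromorphicOn
  have hdet' : ∀ ζ ∈ D, MatAnalyticAt M' ζ → (M' ζ).det = 1 := by
    intro ζ hζ hζa
    refine eq_of_eventually_nhdsNE (f := fun w => (M' w).det) (g := fun _ => 1) ?_
      continuousAt_const ?_
    · simp only [Matrix.det_fin_two]
      exact ((hζa 0 0).continuousAt.mul (hζa 1 1).continuousAt).sub
        ((hζa 0 1).continuousAt.mul (hζa 1 0).continuousAt)
    · filter_upwards [hmem ζ hζ] with w hw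
      rw [heq w hw.1 hw.2, hdet w hw.1 hw.2]
  have hst' : ∀ ζ ∈ D, MatAnalyticAt M' ζ → MatAnalyticAt M' (1 / conj ζ) →
      (M' (1 / conj ζ))ᴴ = (M' ζ)⁻¹ := by
    intro ζ hζ h1 h2
    have hζ0 := hD.ne_zero ζ hζ
    have hinv : (M' ζ)⁻¹ = (M' ζ).adjugate :=
      Matrix.inv_eq_right_inv (mul_adjugate_of_det (hdet' ζ hζ h1))
    rw [hinv]
    ext i j
    refine eq_of_eventually_nhdsNE (f := fun w => (M' (1 / conj w))ᴴ i j)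
      (g := fun w => (M' w).adjugate i j) ?_ ?_ ?_
    · have hc : ContinuousAt (fun w : ℂ => 1 / conj w) ζ :=
        ContinuousAt.div₀ continuousAt_const Complex.continuous_conj.continuousAt
          ((map_ne_zero _).2 hζ0)
      exact Complex.continuous_conj.continuousAt.comp
        (ContinuousAt.comp (f := fun w : ℂ => 1 / conj w) (h2 j i).continuousAt hc)
    · simp only [Matrix.adjugate_fin_two]
      fin_cases i <;> fin_cases j
      · exact (h1 1 1).continuousAt
      · exact (h1 0 1).continuousAt.neg
      · exact (h1 1 0).continuousAt.neg
      · exact (h1 0 0).continuousAt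
    · filter_upwards [hmem ζ hζ] with w hw
      have h3 : 1 / conj w ∉ Z := fun h => hw.2 (hZc w hw.1 h)
      rw [heq w hw.1 hw.2, heq _ (hD.inv_conj_mem w hw.1) h3, hst w hw.1 hw.2]
  -- Entries of unitary matrices have modulus at most `1`, so nearby values along the circle rule
  -- out a pole.
  have hcirc : ∀ ζ ∈ circle 1, MatAnalyticAt M' ζ := by
    intro ζ hζ i j
    have hζD := hD.circle_subset hζ
    refine analyticAt_toMeromorphicNFOn (hM i j) hζD ?_
    by_contra hcon
    push Not at hcon
    have h1 := tendsto_norm_cobounded_atTop.comp (tendsto_cobounded_of_meromorphicOrderAt_neg hcon)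
    have ht := tendsto_circle one_pos hζ
    have h2 := h1.comp (ht.mono_right inf_le_left)
    obtain ⟨t, h3, h4, h5⟩ := ((h2.eventually_gt_atTop 1).and
      (((ht.mono_right inf_le_left).eventually (hmem ζ hζD)).and
      ((ht.mono_right inf_le_right).eventually
        (Filter.eventually_principal.2 fun x hx => hx)))).exists
    refine absurd h3 (not_lt.2 (entry_norm_bound_of_unitary ?_ i j))
    refine (Matrix.mem_specialUnitaryGroup_iff.1
      (mem_specialUnitaryGroup_of_quat ?_ (hdet _ h4.1 h4.2))).1
    have h6 := hst _ h4.1 h4.2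
    rwa [one_div_conj_of_mem_circle h5] at h6
  refine ⟨M', ⟨hmero, hdet', ?_, hst', hcirc, ?_⟩, fun ζ hζ hζZ =>
    ⟨fun i j => (ha ζ hζ hζZ i j).congr (hev ζ hζ hζZ i j).symm, heq ζ hζ hζZ⟩⟩
  · intro ζ hζ h1 h2
    ext i j
    refine eq_of_eventually_nhdsNE (f := fun w => (sigma3 * M' (-w) * sigma3) i j)
      (g := fun w => M' w i j) ?_ (h1 i j).continuousAt ?_
    · have hn : ∀ k l, ContinuousAt (fun w => M' (-w) k l) ζ := fun k l =>
        ContinuousAt.comp (f := fun w : ℂ => -w) (h2 k l).continuousAt continuousAt_neg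
      simp only [Matrix.mul_apply, Fin.sum_univ_two]
      have hc : ∀ c : ℂ, ContinuousAt (fun _ : ℂ => c) ζ := fun c => continuousAt_const
      exact ((((hc _).mul (hn 0 0)).add ((hc _).mul (hn 1 0))).mul (hc _)).add
        ((((hc _).mul (hn 0 1)).add ((hc _).mul (hn 1 1))).mul (hc _))
    · filter_upwards [hmem ζ hζ] with w hw
      have h3 : -w ∉ Z := fun h => hw.2 (hZn w hw.1 h)
      rw [heq w hw.1 hw.2, heq _ (hD.neg_mem w hw.1) h3, htw w hw.1 hw.2]
  · intro ζ hζ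
    have hζD := hD.circle_subset hζ
    have hd := hdet' ζ hζD (hcirc ζ hζ)
    have h1 := hst' ζ hζD (hcirc ζ hζ)
    rw [one_div_conj_of_mem_circle hζ] at h1
    refine mem_specialUnitaryGroup_of_quat ((h1 (hcirc ζ hζ)).trans ?_) hd
    exact Matrix.inv_eq_right_inv (mul_adjugate_of_det hd)

/-! ### Intertwining matrices and a quaternionic basis. -/

section Algebra

variable {A B X : Mat2} {ρ : ℂ}

/-- The element which intertwines `A` and a multiple of `B`. -/
def intertwiner (ρ : ℂ) (A B X : Mat2) : Mat2 := (A.det * B.det) • X - ρ • (B * X * A)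

/-- By Cayley–Hamilton `A² = -det A` and `B² = -det B`. Hence right multiplication by `A` and left
multiplication by `B` both exchange, up to scalars, the span of `X` and `B X A` with that of `X A`
and `B X`; the coefficients are matched by `ρ²`. -/
theorem intertwiner_mul (hA : A.trace = 0) (hB : B.trace = 0) (hρ : ρ ^ 2 = A.det * B.det) :
    B.det • (intertwiner ρ A B X * A) = ρ • (B * intertwiner ρ A B X) := by
  have h1 := sq_of_trace_eq_zero hA
  have h2 := sq_of_trace_eq_zero hB
  have e1 : B * X * A * A = -(A.det • (B * X)) := by
    rw [mul_assoc, h1, mul_neg, Matrix.mul_smul, mul_one]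
  have e2 : B * (B * X * A) = -(B.det • (X * A)) := by
    rw [← mul_assoc, ← mul_assoc, h2, neg_mul, neg_mul, Matrix.smul_mul, Matrix.smul_mul, one_mul]
  rw [intertwiner, sub_mul, mul_sub, Matrix.smul_mul, Matrix.smul_mul, Matrix.mul_smul,
    Matrix.mul_smul, e1, e2]
  simp only [smul_sub, smul_neg, smul_smul]
  rw [show ρ * (ρ * B.det) = B.det * (A.det * B.det) by rw [← hρ]; ring]
  rw [show B.det * (ρ * A.det) = ρ * (A.det * B.det) by ring]
  abel

theorem det_intertwiner (hX : X.det = 1) (hρ : ρ ^ 2 = A.det * B.det) :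
    (intertwiner ρ A B X).det
      = (A.det * B.det) * (2 * (A.det * B.det) - ρ * (X.adjugate * B * X * A).trace) := by
  have key : (intertwiner ρ A B X).det = (A.det * B.det) ^ 2 * X.det
      - (A.det * B.det) * ρ * (X.adjugate * B * X * A).trace + ρ ^ 2 * (B.det * X.det * A.det) := by
    -- The determinant of `2 × 2` matrices is a quadratic form with polar form `tr (adj U · V)`.
    have h1 : ∀ (a b : ℂ) (U V : Mat2), (a • U - b • V).det
        = a ^ 2 * U.det - a * b * (U.adjugate * V).trace + b ^ 2 * V.det := by
      intro a b U V
      simp only [Matrix.det_fin_two, Matrix.trace_fin_two, Matrix.adjugate_fin_two,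
        Matrix.mul_apply, Fin.sum_univ_two, Matrix.sub_apply, Matrix.smul_apply, smul_eq_mul]
      simp
      ring
    rw [intertwiner, h1, Matrix.det_mul, Matrix.det_mul]
    simp only [mul_assoc]
  rw [key, hX]
  linear_combination (A.det * B.det) * hρ

theorem det_smul_one_add_smul (hA : A.trace = 0) (α β : ℂ) :
    (α • (1 : Mat2) + β • A).det = α ^ 2 + β ^ 2 * A.det := by
  rw [Matrix.trace_fin_two] at hA
  simp [Matrix.det_fin_two]
  linear_combination (α * β) * hA

/-- The trace of the square root of the product of the determinants. -/
theorem trace_mul_sq_of_commute (hA : A.trace = 0) (hB : B.trace = 0) (h : A * B = B * A) :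
    A * B = ((A * B).trace / 2) • (1 : Mat2) ∧ ((A * B).trace / 2) ^ 2 = A.det * B.det := by
  rw [Matrix.trace_fin_two] at hA hB
  have hA1 : A 1 1 = -A 0 0 := eq_neg_of_add_eq_zero_right hA
  have hB1 : B 1 1 = -B 0 0 := eq_neg_of_add_eq_zero_right hB
  have e := fun i j => congrFun (congrFun h i) j
  have e00 := e 0 0
  have e01 := e 0 1
  have e10 := e 1 0
  simp only [Matrix.mul_apply, Fin.sum_univ_two, hA1, hB1] at e00 e01 e10
  have key : A * B = ((A * B).trace / 2) • (1 : Mat2) := by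
    ext i j
    fin_cases i <;> fin_cases j <;>
      simp [Matrix.mul_apply, Fin.sum_univ_two, Matrix.trace_fin_two, hA1, hB1]
    · linear_combination e00 / 2
    · linear_combination e01 / 2
    · linear_combination e10 / 2
    · linear_combination -e00 / 2
  refine ⟨key, ?_⟩
  rw [← Matrix.det_mul, key, Matrix.det_smul]
  simp

end Algebra

/-- Four twisted unitary matrices which form an orthogonal basis. -/
def unitLoop (k : Fin 4) (ζ : ℂ) : Mat2 :=
  (![1, !![Complex.I, 0; 0, -Complex.I], !![0, ζ; -1 / ζ, 0],
    !![0, Complex.I * ζ; Complex.I / ζ, 0]] : Fin 4 → Mat2) k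

theorem det_unitLoop (k : Fin 4) {ζ : ℂ} (hζ : ζ ≠ 0) : (unitLoop k ζ).det = 1 := by
  fin_cases k <;> simp [unitLoop, Matrix.det_fin_two]
  · field_simp
  · field_simp
    linear_combination -Complex.I_sq

theorem twisted_unitLoop (k : Fin 4) (ζ : ℂ) :
    sigma3 * unitLoop k (-ζ) * sigma3 = unitLoop k ζ := by
  fin_cases k <;> ext i j <;> fin_cases i <;> fin_cases j <;>
    simp [unitLoop, sigma3, Matrix.mul_apply, Fin.sum_univ_two, div_neg]

theorem quatOn_unitLoop (k : Fin 4) : QuatOn (unitLoop k) {0}ᶜ := by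
  intro ζ _
  fin_cases k <;> ext i j <;> fin_cases i <;> fin_cases j <;>
    simp [unitLoop, Matrix.adjugate_fin_two, div_eq_mul_inv]

theorem analyticOnNhd_unitLoop (k : Fin 4) (i j : Fin 2) :
    AnalyticOnNhd ℂ (fun ζ => unitLoop k ζ i j) {0}ᶜ := by
  intro ζ hζ
  have h0 : ζ ≠ 0 := hζ
  fin_cases k <;> fin_cases i <;> fin_cases j <;> simp [unitLoop] <;>
    fun_prop (disch := exact h0)

/-- Averaging `X⁻¹ B X` over the four basis elements leaves only the scalar part of `B`, which is
zero. -/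
theorem sum_trace_unitLoop {A B : Mat2} (hB : B.trace = 0) {ζ : ℂ} (hζ : ζ ≠ 0) :
    ∑ k, ((unitLoop k ζ).adjugate * B * unitLoop k ζ * A).trace = 0 := by
  have h1 : ∑ k, (unitLoop k ζ).adjugate * B * unitLoop k ζ = 0 := by
    rw [Matrix.trace_fin_two] at hB
    have hB1 : B 1 1 = -B 0 0 := eq_neg_of_add_eq_zero_right hB
    ext i j
    simp only [Fin.sum_univ_four, Matrix.add_apply, Matrix.mul_apply, Fin.sum_univ_two,
      Matrix.adjugate_fin_two, unitLoop]
    fin_cases i <;> fin_cases j <;> simp [hB1] <;> field_simp <;> ring_nf <;>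
      simp [Complex.I_sq]
  rw [← Matrix.trace_sum, ← Finset.sum_mul, h1, zero_mul, Matrix.trace_zero]

namespace QuatOn

variable {D : Set ℂ} {N N' : ℂ → Mat2} {f : ℂ → ℂ}

theorem mono {D' : Set ℂ} (h : QuatOn N D) (hD : D' ⊆ D) : QuatOn N D' := fun ζ hζ => h ζ (hD hζ)

theorem mul (h : QuatOn N D) (h' : QuatOn N' D) : QuatOn (fun ζ => N ζ * N' ζ) D := by
  intro ζ hζ
  simp only [Matrix.conjTranspose_mul, Matrix.adjugate_mul_distrib, h ζ hζ, h' ζ hζ]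

theorem add (h : QuatOn N D) (h' : QuatOn N' D) : QuatOn (fun ζ => N ζ + N' ζ) D := by
  intro ζ hζ
  simp only [Matrix.conjTranspose_add, h ζ hζ, h' ζ hζ, Matrix.adjugate_fin_two]
  ext i j
  fin_cases i <;> fin_cases j <;> simp <;> ring

theorem smul (hf : ∀ ζ ∈ D, reflect f ζ = f ζ) (h : QuatOn N D) :
    QuatOn (fun ζ => f ζ • N ζ) D := by
  intro ζ hζ
  have h1 : star (f (1 / conj ζ)) = f ζ := hf ζ hζ
  simp only [Matrix.conjTranspose_smul, h ζ hζ, h1, Matrix.adjugate_fin_two]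
  ext i j
  fin_cases i <;> fin_cases j <;> simp

theorem sub (h : QuatOn N D) (h' : QuatOn N' D) : QuatOn (fun ζ => N ζ - N' ζ) D := by
  intro ζ hζ
  simp only [Matrix.conjTranspose_sub, h ζ hζ, h' ζ hζ, Matrix.adjugate_fin_two]
  ext i j
  fin_cases i <;> fin_cases j <;> simp <;> ring

theorem one : QuatOn (fun _ => 1) D := fun ζ _ => by simp

theorem det_reflect (h : QuatOn N D) {ζ : ℂ} (hζ : ζ ∈ D) :
    reflect (fun ζ => (N ζ).det) ζ = (N ζ).det := by
  have h1 := congrArg Matrix.det (h ζ hζ)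
  rw [Matrix.det_conjTranspose] at h1
  refine h1.trans ?_
  rw [Matrix.det_adjugate]
  simp

/-- On the unit circle `N` is a quaternion, and its determinant is the quaternion norm `|a|² +
|b|²`. -/
theorem det_nonneg (h : QuatOn N D) (hD : circle 1 ⊆ D) {ζ : ℂ} (hζ : ζ ∈ circle 1) :
    (N ζ).det.im = 0 ∧ 0 ≤ (N ζ).det.re := by
  have h1 := h ζ (hD hζ)
  rw [one_div_conj_of_mem_circle hζ] at h1
  have e := fun i j => congrFun (congrFun h1 i) j
  have e00 := e 0 0
  have e01 := e 0 1
  simp only [Matrix.conjTranspose_apply, Matrix.adjugate_fin_two] at e00 e01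
  simp at e00 e01
  have h2 : (N ζ).det = ((Complex.normSq (N ζ 0 0) + Complex.normSq (N ζ 1 0) : ℝ) : ℂ) := by
    rw [Matrix.det_fin_two, Complex.ofReal_add, ← Complex.mul_conj, ← Complex.mul_conj, e00, e01]
    ring
  rw [h2]
  exact ⟨Complex.ofReal_im _, by
    rw [Complex.ofReal_re]; exact add_nonneg (Complex.normSq_nonneg _) (Complex.normSq_nonneg _)⟩

end QuatOn

theorem sigma3_mul_self : sigma3 * sigma3 = 1 := by simp [sigma3, Matrix.one_fin_two]

theorem det_sigma3_conj (A : Mat2) : (sigma3 * A * sigma3).det = A.det := by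
  rw [Matrix.det_mul_comm, ← mul_assoc, sigma3_mul_self, one_mul]

namespace TwistedOn

variable {D : Set ℂ} {N N' : ℂ → Mat2} {f : ℂ → ℂ}

theorem mono {D' : Set ℂ} (h : TwistedOn N D) (hD : D' ⊆ D) : TwistedOn N D' :=
  fun ζ hζ => h ζ (hD hζ)

theorem mul (h : TwistedOn N D) (h' : TwistedOn N' D) : TwistedOn (fun ζ => N ζ * N' ζ) D := by
  intro ζ hζ
  beta_reduce
  rw [← h ζ hζ, ← h' ζ hζ]
  calc sigma3 * (N (-ζ) * N' (-ζ)) * sigma3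
      = sigma3 * N (-ζ) * (sigma3 * sigma3) * N' (-ζ) * sigma3 := by
        rw [sigma3_mul_self]; simp only [mul_one, mul_assoc]
    _ = _ := by simp only [mul_assoc]

theorem add (h : TwistedOn N D) (h' : TwistedOn N' D) : TwistedOn (fun ζ => N ζ + N' ζ) D := by
  intro ζ hζ
  beta_reduce
  rw [← h ζ hζ, ← h' ζ hζ, mul_add, add_mul]

theorem sub (h : TwistedOn N D) (h' : TwistedOn N' D) : TwistedOn (fun ζ => N ζ - N' ζ) D := by
  intro ζ hζ
  beta_reduce
  rw [← h ζ hζ, ← h' ζ hζ, mul_sub, sub_mul]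

theorem smul (hf : ∀ ζ ∈ D, f (-ζ) = f ζ) (h : TwistedOn N D) :
    TwistedOn (fun ζ => f ζ • N ζ) D := by
  intro ζ hζ
  simp only
  rw [← h ζ hζ, hf ζ hζ, Matrix.mul_smul, Matrix.smul_mul]

theorem one : TwistedOn (fun _ => 1) D := fun ζ _ => by simp only [mul_one, sigma3_mul_self]

theorem adjugate (h : TwistedOn N D) : TwistedOn (fun ζ => (N ζ).adjugate) D := by
  intro ζ hζ
  have h1 := congrArg Matrix.adjugate (h ζ hζ)
  have h2 : sigma3.adjugate = -sigma3 := by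
    rw [Matrix.adjugate_fin_two]; ext i j; fin_cases i <;> fin_cases j <;> simp [sigma3]
  rw [Matrix.adjugate_mul_distrib, Matrix.adjugate_mul_distrib, h2] at h1
  simpa [mul_assoc] using h1

theorem trace_neg (h : TwistedOn N D) {ζ : ℂ} (hζ : ζ ∈ D) : (N (-ζ)).trace = (N ζ).trace := by
  rw [← h ζ hζ, Matrix.trace_mul_comm, ← mul_assoc, sigma3_mul_self, one_mul]

theorem det_neg (h : TwistedOn N D) {ζ : ℂ} (hζ : ζ ∈ D) : (N (-ζ)).det = (N ζ).det := by
  rw [← h ζ hζ, det_sigma3_conj]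

theorem traceFree (h : TwistedOn N D) : TwistedOn (fun ζ => traceFree (N ζ)) D := by
  intro ζ hζ
  simp only [LoopDressing.traceFree, h.trace_neg hζ, mul_sub, sub_mul, Matrix.mul_smul,
    Matrix.smul_mul, mul_one, sigma3_mul_self, h ζ hζ]

end TwistedOn

theorem reflect_neg_apply (g : ℂ → ℂ) (ζ : ℂ) :
    reflect g (-ζ) = conj (g (-(1 / conj ζ))) := by simp [reflect]

/-! ### The twisted unitary conjugator. -/

/-- The data which determine a twisted unitary matrix conjugating `A` to a multiple of `B`. -/
structure IsTwistedPair (D : Set ℂ) (s : ℝ) (A B : ℂ → Mat2) (ρ : ℂ → ℂ) : Prop where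
  isSymmetricDomain : IsSymmetricDomain D
  pos : 0 < s
  subset : D ⊆ annulus s
  analytic_left : ∀ i j, AnalyticOnNhd ℂ (fun ζ => A ζ i j) {0}ᶜ
  analytic_right : ∀ i j, AnalyticOnNhd ℂ (fun ζ => B ζ i j) {0}ᶜ
  trace_left : ∀ ζ, (A ζ).trace = 0
  trace_right : ∀ ζ, (B ζ).trace = 0
  quat_left : QuatOn A {0}ᶜ
  quat_right : QuatOn B {0}ᶜ
  twisted_left : TwistedOn A {0}ᶜ
  twisted_right : TwistedOn B {0}ᶜ
  left_ne_zero : ∃ ζ : ℂ, ζ ≠ 0 ∧ (A ζ).det ≠ 0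
  right_ne_zero : ∃ ζ : ℂ, ζ ≠ 0 ∧ (B ζ).det ≠ 0
  analytic : AnalyticOnNhd ℂ ρ D
  sq_eq : ∀ ζ ∈ D, ρ ζ ^ 2 = (A ζ).det * (B ζ).det
  even : ∀ ζ ∈ D, ρ (-ζ) = ρ ζ
  reflect_eq : ∀ ζ ∈ D, reflect ρ ζ = ρ ζ

namespace IsTwistedPair

variable {D : Set ℂ} {s : ℝ} {A B : ℂ → Mat2} {ρ : ℂ → ℂ} (h : IsTwistedPair D s A B ρ)
include h

theorem subset_compl_zero : D ⊆ {0}ᶜ := h.isSymmetricDomain.ne_zero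

theorem finite_zeros {f : ℂ → ℂ} (hf : AnalyticOnNhd ℂ f {0}ᶜ) (hne : ∃ ζ : ℂ, ζ ≠ 0 ∧ f ζ ≠ 0) :
    {ζ ∈ D | f ζ = 0}.Finite :=
  (LoopDressing.finite_zeros hf hne h.pos).subset fun _ hζ =>
    ⟨(h.subset hζ.1).1.le, (h.subset hζ.1).2.le, hζ.2⟩

theorem analyticOnNhd_det_left : AnalyticOnNhd ℂ (fun ζ => (A ζ).det) {0}ᶜ :=
  (isFunctionRing_analyticOnNhd _).det h.analytic_left

theorem analyticOnNhd_det_right : AnalyticOnNhd ℂ (fun ζ => (B ζ).det) {0}ᶜ :=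
  (isFunctionRing_analyticOnNhd _).det h.analytic_right

theorem exists_det_mul_det_ne_zero : ∃ ζ ∈ D, (A ζ).det * (B ζ).det ≠ 0 := by
  by_contra hcon
  push Not at hcon
  have h1 := isSymmetricDomain_compl_zero.eqOn_of_circle
    (h.analyticOnNhd_det_left.mul h.analyticOnNhd_det_right)
    (analyticOnNhd_const (v := (0 : ℂ)))
    fun ζ hζ => hcon ζ (h.isSymmetricDomain.circle_subset hζ)
  obtain ⟨a, ha, ha'⟩ := h.left_ne_zero
  obtain ⟨b, hb, hb'⟩ := h.right_ne_zero
  rcases isSymmetricDomain_compl_zero.eq_zero_or_eq_zero_of_mul h.analyticOnNhd_det_left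
    h.analyticOnNhd_det_right h1 with h2 | h2
  · exact ha' (h2 a ha)
  · exact hb' (h2 b hb)

theorem isNonnegEven_det : IsNonnegEven D fun ζ => (A ζ).det where
  analyticOnNhd := h.analyticOnNhd_det_left.mono h.subset_compl_zero
  even _ hζ := h.twisted_left.det_neg (h.subset_compl_zero hζ)
  nonneg _ hζ := h.quat_left.det_nonneg isSymmetricDomain_compl_zero.circle_subset hζ

theorem quatOn_intertwiner (k : Fin 4) :
    QuatOn (fun ζ => intertwiner (ρ ζ) (A ζ) (B ζ) (unitLoop k ζ)) D := by
  have hA := h.quat_left.mono h.subset_compl_zero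
  have hB := h.quat_right.mono h.subset_compl_zero
  have hX := (quatOn_unitLoop k).mono h.subset_compl_zero
  refine QuatOn.sub (QuatOn.smul (f := fun ζ => (A ζ).det * (B ζ).det) (fun ζ hζ => ?_) hX)
    (QuatOn.smul h.reflect_eq ((hB.mul hX).mul hA))
  rw [reflect_mul (fun ζ => (A ζ).det), hA.det_reflect hζ, hB.det_reflect hζ]

theorem twistedOn_intertwiner (k : Fin 4) :
    TwistedOn (fun ζ => intertwiner (ρ ζ) (A ζ) (B ζ) (unitLoop k ζ)) D := by
  have hA := h.twisted_left.mono h.subset_compl_zero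
  have hB := h.twisted_right.mono h.subset_compl_zero
  have hX : TwistedOn (unitLoop k) D := fun ζ _ => twisted_unitLoop k ζ
  refine TwistedOn.sub (TwistedOn.smul (f := fun ζ => (A ζ).det * (B ζ).det) (fun ζ hζ => ?_) hX)
    (TwistedOn.smul h.even ((hB.mul hX).mul hA))
  rw [hA.det_neg hζ, hB.det_neg hζ]

theorem analyticOnNhd_intertwiner (k : Fin 4) (i j : Fin 2) :
    AnalyticOnNhd ℂ (fun ζ => intertwiner (ρ ζ) (A ζ) (B ζ) (unitLoop k ζ) i j) D := by
  have hR := isFunctionRing_analyticOnNhd D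
  have hA := fun i j => (h.analytic_left i j).mono h.subset_compl_zero
  have hB := fun i j => (h.analytic_right i j).mono h.subset_compl_zero
  have hX := fun i j => (analyticOnNhd_unitLoop k i j).mono h.subset_compl_zero
  exact hR.mat_sub (hR.mat_smul (hR.mul _ _ (hR.det hA) (hR.det hB)) hX)
    (hR.mat_smul h.analytic (hR.mat_mul (hR.mat_mul hB hX) hA)) i j

theorem det_intertwiner_eq (k : Fin 4) {ζ : ℂ} (hζ : ζ ∈ D) :
    (intertwiner (ρ ζ) (A ζ) (B ζ) (unitLoop k ζ)).det
      = ((A ζ).det * (B ζ).det) * (2 * ((A ζ).det * (B ζ).det)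
        - ρ ζ * ((unitLoop k ζ).adjugate * B ζ * unitLoop k ζ * A ζ).trace) :=
  det_intertwiner (det_unitLoop k (h.subset_compl_zero hζ)) (h.sq_eq ζ hζ)

/-- Summed over the four basis elements, the second factors of the determinants give `8 det A det
B`, so they cannot all vanish at a point where this product is nonzero. -/
theorem exists_det_intertwiner_ne_zero :
    ∃ k, ∃ ζ ∈ D, (intertwiner (ρ ζ) (A ζ) (B ζ) (unitLoop k ζ)).det ≠ 0 := by
  by_contra hcon
  push Not at hcon
  obtain ⟨ζ, hζ, hne⟩ := h.exists_det_mul_det_ne_zero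
  have h1 : ∀ k, 2 * ((A ζ).det * (B ζ).det)
      - ρ ζ * ((unitLoop k ζ).adjugate * B ζ * unitLoop k ζ * A ζ).trace = 0 := fun k =>
    (mul_eq_zero.1 ((h.det_intertwiner_eq k hζ).symm.trans (hcon k ζ hζ))).resolve_left hne
  have h2 := Finset.sum_eq_zero fun k (_ : k ∈ Finset.univ) => h1 k
  rw [Finset.sum_sub_distrib, ← Finset.mul_sum _ _ (ρ ζ),
    sum_trace_unitLoop (h.trace_right ζ) (h.subset_compl_zero hζ)] at h2
  simp only [Finset.sum_const, Finset.card_univ, Fintype.card_fin, mul_zero, sub_zero,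
    nsmul_eq_mul] at h2
  exact hne (by
    push_cast at h2
    linear_combination h2 / 8)

/-- The root `ρ` lives only on `D`, so zeros might a priori accumulate at the boundary. Multiplying
`2p - ρ q` by `2p + ρ q` removes `ρ` and gives `p (4p - q²)`, holomorphic on `ℂ*`, with finitely
many zeros in the annulus unless `4p = q²` identically. In that case the nonvanishing hypothesis
leaves `2p + ρ q = 0`, and the determinant is `4p²`. -/
theorem finite_det_intertwiner_eq_zero {k : Fin 4}
    (hk : ∃ ζ ∈ D, (intertwiner (ρ ζ) (A ζ) (B ζ) (unitLoop k ζ)).det ≠ 0) :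
    {ζ ∈ D | (intertwiner (ρ ζ) (A ζ) (B ζ) (unitLoop k ζ)).det = 0}.Finite := by
  have hR := isFunctionRing_analyticOnNhd ({0}ᶜ : Set ℂ)
  have hRD := isFunctionRing_analyticOnNhd D
  have hX := analyticOnNhd_unitLoop k
  set p : ℂ → ℂ := fun ζ => (A ζ).det * (B ζ).det with hp
  set q : ℂ → ℂ := fun ζ => ((unitLoop k ζ).adjugate * B ζ * unitLoop k ζ * A ζ).trace with hq
  have hpa : AnalyticOnNhd ℂ p {0}ᶜ := h.analyticOnNhd_det_left.mul h.analyticOnNhd_det_right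
  have hqa : AnalyticOnNhd ℂ q {0}ᶜ := hR.trace
    (hR.mat_mul (hR.mat_mul (hR.mat_mul (hR.mat_adjugate hX) h.analytic_right) hX) h.analytic_left)
  have hdet : ∀ ζ ∈ D, (intertwiner (ρ ζ) (A ζ) (B ζ) (unitLoop k ζ)).det
      = p ζ * (2 * p ζ - ρ ζ * q ζ) := fun ζ hζ => h.det_intertwiner_eq k hζ
  have hsq : ∀ ζ ∈ D, ρ ζ ^ 2 = p ζ := h.sq_eq
  have hpfin : {ζ ∈ D | p ζ = 0}.Finite := by
    obtain ⟨ζ, hζ, hne⟩ := h.exists_det_mul_det_ne_zero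
    exact h.finite_zeros hpa ⟨ζ, h.subset_compl_zero hζ, hne⟩
  by_cases hne : ∃ ζ : ℂ, ζ ≠ 0 ∧ 4 * p ζ - q ζ ^ 2 ≠ 0
  · refine (hpfin.union (h.finite_zeros (hR.sub (hR.mul _ _ (hR.const 4) hpa) (hR.pow_two hqa))
      hne)).subset ?_
    rintro ζ ⟨hζ, hz⟩
    rw [hdet ζ hζ] at hz
    rcases mul_eq_zero.1 hz with h1 | h1
    · exact Or.inl ⟨hζ, h1⟩
    · have h2 : p ζ * (4 * p ζ - q ζ ^ 2) = 0 := by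
        linear_combination (2 * p ζ + ρ ζ * q ζ) * h1 + q ζ ^ 2 * hsq ζ hζ
      rcases mul_eq_zero.1 h2 with h3 | h3
      · exact Or.inl ⟨hζ, h3⟩
      · exact Or.inr ⟨hζ, h3⟩
  · push Not at hne
    have h1 : ∀ ζ ∈ D, (2 * p ζ - ρ ζ * q ζ) * (2 * p ζ + ρ ζ * q ζ) = 0 := fun ζ hζ => by
      linear_combination p ζ * hne ζ (h.subset_compl_zero hζ) - q ζ ^ 2 * hsq ζ hζ
    have hpD := hpa.mono h.subset_compl_zero
    have hqD := hqa.mono h.subset_compl_zero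
    have e1 := hRD.mul _ _ (hRD.const 2) hpD
    have e2 := hRD.mul _ _ h.analytic hqD
    rcases h.isSymmetricDomain.eq_zero_or_eq_zero_of_mul (hRD.sub e1 e2) (hRD.add _ _ e1 e2) h1
      with h2 | h2
    · exfalso
      obtain ⟨ζ, hζ, hz⟩ := hk
      exact hz (by rw [hdet ζ hζ, h2 ζ hζ, mul_zero])
    · refine hpfin.subset ?_
      rintro ζ ⟨hζ, hz⟩
      rw [hdet ζ hζ] at hz
      refine ⟨hζ, ?_⟩
      have h3 : 4 * (p ζ * p ζ) = 0 := by linear_combination hz + p ζ * h2 ζ hζ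
      exact mul_self_eq_zero.1 ((mul_eq_zero.1 h3).resolve_left (by norm_num))

/-- The twisted unitary matrix which conjugates `A` to a multiple of `B`. -/
theorem exists_conjugator
    (hord : ∀ w ∈ D, ‖w‖ ≠ 1 → ∀ n : ℕ, Odd n → analyticOrderAt (fun ζ => (A ζ).det) w ≠ n) :
    ∃ (M : ℂ → Mat2) (Z : Set ℂ), Z.Finite ∧ IsTwistedSUMeromorphicOn M D ∧
      ∀ ζ ∈ D, ζ ∉ Z → MatAnalyticAt M ζ ∧ (M ζ).det = 1 ∧ sigma3 * M (-ζ) * sigma3 = M ζ ∧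
        (B ζ).det ≠ 0 ∧ (B ζ).det • (M ζ * A ζ) = ρ ζ • (B ζ * M ζ) := by
  have hD := h.isSymmetricDomain
  obtain ⟨k, hk⟩ := h.exists_det_intertwiner_ne_zero
  have hfin := h.finite_det_intertwiner_eq_zero hk
  have hPq := h.quatOn_intertwiner k
  have hPt := h.twistedOn_intertwiner k
  have hPa := h.analyticOnNhd_intertwiner k
  have hPdet := fun ζ hζ => h.det_intertwiner_eq k (ζ := ζ) hζ
  set P : ℂ → Mat2 := fun ζ => intertwiner (ρ ζ) (A ζ) (B ζ) (unitLoop k ζ) with hP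
  have hPn : IsNonnegEven D fun ζ => (P ζ).det :=
    ⟨(isFunctionRing_analyticOnNhd D).det hPa, fun ζ hζ => hPt.det_neg hζ,
      fun ζ hζ => hPq.det_nonneg hD.circle_subset hζ⟩
  obtain ⟨δ, ε, hδ, hδsq, hε, hδn, hδr⟩ := h.isNonnegEven_det.exists_sqrt hD
    (by
      obtain ⟨ζ, hζ, hne⟩ := h.exists_det_mul_det_ne_zero
      exact ⟨ζ, hζ, left_ne_zero_of_mul hne⟩)
    (h.finite_zeros h.analyticOnNhd_det_left h.left_ne_zero) hord
  -- The sign `ε` is the parity of `δ`; it dictates the symmetry of `g` which makes `α` and `β`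
  -- even.
  obtain ⟨g, hg, hgg, hge, hgs⟩ := hPn.exists_mul_reflect hD hk hfin ε hε
  have hgr := hD.analyticOnNhd_reflect hg
  have hgn : ∀ ζ ∈ D, (ε = 1 → reflect g (-ζ) = reflect g ζ) ∧ (ε = -1 → reflect g (-ζ) = g ζ) := by
    intro ζ hζ
    have hm := hD.inv_conj_mem ζ hζ
    rw [reflect_neg_apply]
    refine ⟨fun h1 => by rw [hge h1 _ hm]; rfl, fun h1 => ?_⟩
    rw [hgs h1 _ hm]
    exact congrFun (reflect_reflect g) ζ
  -- The eigenvalues of `A` are `±iδ`, and `α`, `β` solve `α + iδβ = 1/g`, `α - iδβ = 1/g^*`. So `α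
  -- + β A` commutes with `A` and has determinant `1 / (g g^*) = 1 / det P`.
  set α : ℂ → ℂ := fun ζ => (1 / 2) * ((g ζ)⁻¹ + (reflect g ζ)⁻¹) with hα
  set β : ℂ → ℂ := fun ζ => (1 / (2 * Complex.I)) * ((g ζ)⁻¹ - (reflect g ζ)⁻¹) * (δ ζ)⁻¹ with hβ
  have hrr : ∀ ζ, conj (reflect g (1 / conj ζ)) = g ζ := fun ζ => congrFun (reflect_reflect g) ζ
  have hrg : ∀ ζ, conj (g (1 / conj ζ)) = reflect g ζ := fun ζ => rfl
  have hαr : ∀ ζ ∈ D, reflect α ζ = α ζ := fun ζ _ => by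
    simp only [hα]
    rw [reflect, map_mul, map_add, map_inv₀, map_inv₀, hrr, hrg, map_div₀, map_one, map_ofNat,
      add_comm]
  have hβr : ∀ ζ ∈ D, reflect β ζ = β ζ := fun ζ hζ => by
    have hδζ : conj (δ (1 / conj ζ)) = δ ζ := hδr ζ hζ
    simp only [hβ]
    rw [reflect, map_mul, map_mul, map_sub, map_inv₀, map_inv₀, map_inv₀, hrr, hrg, hδζ, map_div₀,
      map_one, map_mul, map_ofNat, Complex.conj_I, mul_neg, div_neg]
    ring
  have hαn : ∀ ζ ∈ D, α (-ζ) = α ζ := by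
    intro ζ hζ
    simp only [hα]
    rcases hε with h1 | h1
    · rw [hge h1 ζ hζ, (hgn ζ hζ).1 h1]
    · rw [hgs h1 ζ hζ, (hgn ζ hζ).2 h1, add_comm]
  have hβn : ∀ ζ ∈ D, β (-ζ) = β ζ := by
    intro ζ hζ
    simp only [hβ]
    rcases hε with h1 | h1
    · rw [hge h1 ζ hζ, (hgn ζ hζ).1 h1, hδn ζ hζ, h1, one_mul]
    · rw [hgs h1 ζ hζ, (hgn ζ hζ).2 h1, hδn ζ hζ, h1, neg_one_mul, inv_neg]
      ring
  set M : ℂ → Mat2 := fun ζ => P ζ * (α ζ • (1 : Mat2) + β ζ • A ζ) with hM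
  set Z : Set ℂ := {ζ ∈ D | (P ζ).det = 0} with hZ
  have hoff : ∀ ζ ∈ D, ζ ∉ Z → (P ζ).det ≠ 0 := fun ζ hζ hn h0 => hn ⟨hζ, h0⟩
  have hoffAB : ∀ ζ ∈ D, ζ ∉ Z → (A ζ).det ≠ 0 ∧ (B ζ).det ≠ 0 := fun ζ hζ hn => by
    have h1 := hoff ζ hζ hn
    rw [hPdet ζ hζ] at h1
    exact mul_ne_zero_iff.1 (left_ne_zero_of_mul h1)
  have hoffg : ∀ ζ ∈ D, ζ ∉ Z → g ζ ≠ 0 ∧ reflect g ζ ≠ 0 := fun ζ hζ hn =>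
    mul_ne_zero_iff.1 (by rw [hgg ζ hζ]; exact hoff ζ hζ hn)
  have hoffδ : ∀ ζ ∈ D, ζ ∉ Z → δ ζ ≠ 0 := fun ζ hζ hn h0 => (hoffAB ζ hζ hn).1 (by
    rw [← hδsq ζ hζ, h0]; simp)
  have hring : ∀ {R : (ℂ → ℂ) → Prop}, IsFunctionRing R → R (fun ζ => (g ζ)⁻¹) →
      R (fun ζ => (reflect g ζ)⁻¹) → R (fun ζ => (δ ζ)⁻¹) → (∀ i j, R fun ζ => P ζ i j) →
      (∀ i j, R fun ζ => A ζ i j) → ∀ i j, R fun ζ => M ζ i j := by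
    intro R hR h1 h2 h3 h4 h5
    refine hR.mat_mul h4 (hR.mat_add (hR.mat_smul ?_ (hR.mat_const 1)) (hR.mat_smul ?_ h5))
    · exact hR.mul _ _ (hR.const _) (hR.add _ _ h1 h2)
    · exact hR.mul _ _ (hR.mul _ _ (hR.const _) (hR.sub h1 h2)) h3
  have hAD : ∀ i j, AnalyticOnNhd ℂ (fun ζ => A ζ i j) D := fun i j =>
    (h.analytic_left i j).mono h.subset_compl_zero
  have hMm : MatMeromorphicOn M D := hring (isFunctionRing_meromorphicOn D) hg.meromorphicOn.inv
    hgr.meromorphicOn.inv hδ.meromorphicOn.inv (fun i j => (hPa i j).meromorphicOn)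
    fun i j => (hAD i j).meromorphicOn
  have hsub : D \ Z ⊆ D := Set.sdiff_subset
  have hMa : ∀ i j, AnalyticOnNhd ℂ (fun ζ => M ζ i j) (D \ Z) :=
    hring (isFunctionRing_analyticOnNhd (D \ Z))
      ((hg.mono hsub).inv fun ζ hζ => (hoffg ζ hζ.1 hζ.2).1)
      ((hgr.mono hsub).inv fun ζ hζ => (hoffg ζ hζ.1 hζ.2).2)
      ((hδ.mono hsub).inv fun ζ hζ => hoffδ ζ hζ.1 hζ.2)
      (fun i j => (hPa i j).mono hsub) fun i j => (hAD i j).mono hsub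
  have hMdet : ∀ ζ ∈ D, ζ ∉ Z → (M ζ).det = 1 := by
    intro ζ hζ hn
    have h1 : (g ζ)⁻¹ * g ζ = 1 := inv_mul_cancel₀ (hoffg ζ hζ hn).1
    have h2 : (reflect g ζ)⁻¹ * reflect g ζ = 1 := inv_mul_cancel₀ (hoffg ζ hζ hn).2
    have h3 : (δ ζ)⁻¹ * δ ζ = 1 := inv_mul_cancel₀ (hoffδ ζ hζ hn)
    have h4 : (1 / (2 * Complex.I)) ^ 2 = -1 / 4 := by
      rw [div_pow, mul_pow, Complex.I_sq]; norm_num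
    have h5 : α ζ ^ 2 + β ζ ^ 2 * (A ζ).det = (g ζ)⁻¹ * (reflect g ζ)⁻¹ := by
      have h6 : β ζ ^ 2 * (A ζ).det = -1 / 4 * ((g ζ)⁻¹ - (reflect g ζ)⁻¹) ^ 2 := by
        rw [← hδsq ζ hζ, hβ]
        calc _ = (1 / (2 * Complex.I)) ^ 2 * ((g ζ)⁻¹ - (reflect g ζ)⁻¹) ^ 2
              * ((δ ζ)⁻¹ * δ ζ) ^ 2 := by ring
          _ = _ := by rw [h3, h4]; ring
      rw [h6, hα]
      ring
    rw [hM]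
    simp only
    rw [Matrix.det_mul, det_smul_one_add_smul (h.trace_left ζ), h5, ← hgg ζ hζ]
    linear_combination (reflect g ζ)⁻¹ * reflect g ζ * h1 + h2
  have hMt : TwistedOn M D := hPt.mul ((TwistedOn.one.smul hαn).add
    ((h.twisted_left.mono h.subset_compl_zero).smul hβn))
  have hMq : QuatOn M D := hPq.mul ((QuatOn.one.smul hαr).add
    ((h.quat_left.mono h.subset_compl_zero).smul hβr))
  -- The set `Z` contains the zeros of `g`, `g^*`, `δ` and `det B` in `D`, because `det A · det B`
  -- divides `det P = g g^*`; it inherits the symmetries of `det P`.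
  obtain ⟨M', hM', heq⟩ := hD.exists_isTwistedSUMeromorphicOn (M := M) (Z := Z) hfin
    (fun ζ hζ hn => ⟨hζ, (hPt.det_neg hζ).symm.trans hn.2⟩)
    (fun ζ hζ hn => ⟨hζ, by
      rw [← hPq.det_reflect hζ, reflect, hn.2, map_zero]⟩)
    hMm (fun ζ hζ hn i j => hMa i j ζ ⟨hζ, hn⟩) hMdet (fun ζ hζ _ => hMt ζ hζ)
    (fun ζ hζ _ => hMq ζ hζ)
  refine ⟨M', Z, hfin, hM', fun ζ hζ hn => ?_⟩
  obtain ⟨h1, h2⟩ := heq ζ hζ hn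
  have hn' : -ζ ∉ Z := fun h3 => hn ⟨hζ, (hPt.det_neg hζ).symm.trans h3.2⟩
  refine ⟨h1, by rw [h2, hMdet ζ hζ hn], ?_, (hoffAB ζ hζ hn).2, ?_⟩
  · rw [h2, (heq (-ζ) (hD.neg_mem ζ hζ) hn').2, hMt ζ hζ]
  · rw [h2]
    have h3 := intertwiner_mul (X := unitLoop k ζ) (h.trace_left ζ) (h.trace_right ζ) (h.sq_eq ζ hζ)
    have h4 : (α ζ • (1 : Mat2) + β ζ • A ζ) * A ζ = A ζ * (α ζ • (1 : Mat2) + β ζ • A ζ) := by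
      simp only [add_mul, mul_add, Matrix.smul_mul, Matrix.mul_smul, one_mul, mul_one]
    calc (B ζ).det • (M ζ * A ζ)
        = ((B ζ).det • (P ζ * A ζ)) * (α ζ • (1 : Mat2) + β ζ • A ζ) := by
          rw [hM, Matrix.smul_mul, mul_assoc, h4, mul_assoc]
      _ = _ := by rw [h3, Matrix.smul_mul, mul_assoc]

end IsTwistedPair

/-! ### The root of the product of the determinants. -/

theorem infinite_circle_one : (circle 1).Infinite := by
  have h1 : IsConnected (circle 1) := by
    rw [circle_eq_sphere]
    exact isConnected_sphere (by simp) 0 zero_le_one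
  refine h1.isPreconnected.infinite_of_nontrivial ⟨1, mem_circle_one, -1, ?_, ?_⟩
  · simp [circle]
  · norm_num

/-- There is a ray which does not meet the cuts. -/
theorem exists_ray {g g' : ℂ → Mat2} (hg : IsUnitaryLoopStar g) (hg' : IsUnitaryLoopStar g')
    {s : ℝ} (hs : 0 < s) :
    ∃ u ∈ circle 1, ∀ t : ℝ, s < t → t ≤ 1 → (t : ℂ) * u ∈ cutPlane g ∩ cutPlane g' := by
  -- Finitely many branch points in the annulus block finitely many directions.
  have hfin := ((hg.finite_branchPoints hs).union (hg'.finite_branchPoints hs)).image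
    fun α : ℂ => α / ‖α‖
  obtain ⟨u, hu, hub⟩ := infinite_circle_one.exists_notMem_finite hfin
  have hu1 : ‖u‖ = 1 := hu
  refine ⟨u, hu, fun t ht ht1 => ?_⟩
  have ht0 : 0 < t := hs.trans ht
  have key : ∀ g : ℂ → Mat2, (∀ α ∈ branchPoints g, α ∈ annulus s → α / ‖α‖ ≠ u) →
      (t : ℂ) * u ∈ cutPlane g := by
    intro g hgu
    refine ⟨mul_ne_zero (Complex.ofReal_ne_zero.2 ht0.ne') (ne_zero_of_mem_circle one_pos hu),
      fun α hα => ⟨fun h1 t' h2 h3 he => ?_, fun h1 t' h2 he => ?_⟩⟩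
    · have hn := congrArg norm he
      rw [norm_mul, norm_mul, hu1, Complex.norm_real, Complex.norm_real, Real.norm_of_nonneg ht0.le,
        Real.norm_of_nonneg h2, mul_one] at hn
      have hα0 : 0 < ‖α‖ := norm_pos_iff.2 hα.1
      have h4 : t ≤ ‖α‖ := by rw [hn]; exact mul_le_of_le_one_left hα0.le h3
      refine hgu α hα ⟨ht.trans_le h4, h1.trans ?_⟩ ?_
      · exact (one_lt_div hs).2 (ht.trans_le ht1)
      · have h5 : (t : ℂ) ≠ 0 := Complex.ofReal_ne_zero.2 ht0.ne'
        have h6 : ((‖α‖ : ℝ) : ℂ) ≠ 0 := Complex.ofReal_ne_zero.2 hα0.ne'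
        have h7 : (t : ℂ) = t' * (‖α‖ : ℝ) := by exact_mod_cast hn
        refine mul_left_cancel₀ h5 ?_
        rw [he, h7]
        field_simp
    · have hn := congrArg norm he
      rw [norm_mul, norm_mul, hu1, Complex.norm_real, Complex.norm_real, Real.norm_of_nonneg ht0.le,
        Real.norm_of_nonneg (by linarith), mul_one] at hn
      nlinarith
  exact ⟨key g fun α hα ha he => hub ⟨α, Or.inl ⟨hα, ha⟩, he⟩,
    key g' fun α hα ha he => hub ⟨α, Or.inr ⟨hα, ha⟩, he⟩⟩

namespace IsUnitaryLoopStar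

variable {g : ℂ → Mat2} (hg : IsUnitaryLoopStar g)
include hg

theorem twistedOn : TwistedOn g {0}ᶜ := fun _ hζ => hg.twisted hζ

/-- This determinant is `-((tr g)² - 4) / 4`, so a zero of odd order is a branch point, and off the
circle the branch point belongs to its own cut (`t = 1`). -/
theorem analyticOrderAt_det_traceFree_ne {w : ℂ} (hw : w ∈ cutPlane g) (hw1 : ‖w‖ ≠ 1) {n : ℕ}
    (hn : Odd n) : analyticOrderAt (fun ζ => (LoopDressing.traceFree (g ζ)).det) w ≠ n := by
  intro hord
  have hw0 : w ≠ 0 := hw.1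
  have hda : AnalyticAt ℂ (fun ζ => (LoopDressing.traceFree (g ζ)).det) w :=
    (isFunctionRing_analyticOnNhd _).det
      ((isFunctionRing_analyticOnNhd _).mat_traceFree hg.analyticOnNhd) w hw0
  have hbr : w ∈ branchPoints g := by
    refine ⟨hw0, n, hn, ?_⟩
    obtain ⟨u, hu, hu0, heq⟩ := hda.analyticOrderAt_eq_natCast.1 hord
    rw [(hg.analyticOnNhd_disc w hw0).analyticOrderAt_eq_natCast]
    refine ⟨fun z => -4 * u z, analyticAt_const.mul hu, by simp [hu0], ?_⟩
    filter_upwards [heq, isOpen_compl_singleton.mem_nhds hw0] with z h1 hz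
    rw [hg.det_traceFree hz, smul_eq_mul] at h1
    rw [smul_eq_mul]
    linear_combination -4 * h1
  rcases lt_or_gt_of_ne hw1 with h1 | h1
  · exact (hw.2 w hbr).1 h1 1 zero_le_one le_rfl (by simp)
  · exact (hw.2 w hbr).2 h1 1 le_rfl (by simp)

end IsUnitaryLoopStar

theorem traceFree_conj {H A : Mat2} (hH : H.det = 1) :
    traceFree (H * A * H.adjugate) = H * traceFree A * H.adjugate := by
  have h1 : (H * A * H.adjugate).trace = A.trace := by
    rw [Matrix.trace_mul_comm, ← mul_assoc, adjugate_mul_of_det hH, one_mul]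
  simp only [traceFree, h1, mul_sub, sub_mul, Matrix.mul_smul, Matrix.smul_mul, mul_one,
    mul_adjugate_of_det hH]

theorem det_conj {H A : Mat2} (hH : H.det = 1) : (H * A * H.adjugate).det = A.det := by
  rw [Matrix.det_mul_comm, ← mul_assoc, adjugate_mul_of_det hH, one_mul]

theorem im_eq_zero_of_sq_nonneg {z : ℂ} (h : (z ^ 2).im = 0 ∧ 0 ≤ (z ^ 2).re) : z.im = 0 := by
  obtain ⟨h1, h2⟩ := h
  rw [sq, Complex.mul_im] at h1
  rw [sq, Complex.mul_re] at h2
  have h3 : z.re * z.im = 0 := by linarith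
  rcases mul_eq_zero.1 h3 with h4 | h4
  · rw [h4] at h2
    nlinarith
  · exact h4

theorem nonneg_mul {z w : ℂ} (hz : z.im = 0 ∧ 0 ≤ z.re) (hw : w.im = 0 ∧ 0 ≤ w.re) :
    (z * w).im = 0 ∧ 0 ≤ (z * w).re := by
  rw [Complex.mul_im, Complex.mul_re, hz.1, hw.1]
  simp [mul_nonneg hz.2 hw.2]

section Frame

variable {X : Type*} [TopologicalSpace X] [ChartedSpace ℂ X] [IsManifold 𝓘(ℂ) ω X]
  [ConnectedSpace X] {τ : X → X} {r : ℝ} {F F' : X → ℂ → Mat2} {z₀ : X} {χ χ' h : ℂ → Mat2}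

/-- `h χ h⁻¹` commutes with the monodromy of the dressed frame on the punctured disc. -/
theorem commute_of_norm_le (hr : 0 < r) (hF : IsNormalizedFrame F z₀) (hχ : IsMonodromy r τ F χ)
    (hχtr : ¬ ∃ c : ℂ, ∀ ζ : ℂ, ζ ≠ 0 → (χ ζ).trace = c)
    (hh : IsPositiveLoop r h) (hF' : IsDressedFrame r h F z₀ F') (hχ' : IsMonodromy r τ F' χ')
    {ζ : ℂ} (hζ : ζ ≠ 0) (hζr : ‖ζ‖ ≤ r) :
    h ζ * χ ζ * (h ζ).adjugate * χ' ζ = χ' ζ * (h ζ * χ ζ * (h ζ).adjugate) := by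
  have hR := isFunctionRing_continuousOn_differentiableOn {ζ : ℂ | ζ ≠ 0 ∧ ‖ζ‖ ≤ r}
    {ζ : ℂ | ζ ≠ 0 ∧ ‖ζ‖ < r}
  have hloop : ∀ {g : ℂ → Mat2}, IsUnitaryLoopStar g → ∀ i j,
      ContinuousOn (fun ζ => g ζ i j) {ζ : ℂ | ζ ≠ 0 ∧ ‖ζ‖ ≤ r} ∧
      DifferentiableOn ℂ (fun ζ => g ζ i j) {ζ : ℂ | ζ ≠ 0 ∧ ‖ζ‖ < r} := fun hg i j =>
    ⟨(hg.analyticOnNhd i j).continuousOn.mono fun w hw => hw.1,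
      (hg.analyticOnNhd i j).differentiableOn.mono fun w hw => hw.1⟩
  have hhe : ∀ i j, ContinuousOn (fun ζ => h ζ i j) {ζ : ℂ | ζ ≠ 0 ∧ ‖ζ‖ ≤ r} ∧
      DifferentiableOn ℂ (fun ζ => h ζ i j) {ζ : ℂ | ζ ≠ 0 ∧ ‖ζ‖ < r} := fun i j =>
    ⟨(continuousOn_pi.1 (continuousOn_pi.1 hh.continuousOn i) j).mono
        fun w hw => mem_closedBall_zero_iff.2 hw.2,
      (hh.differentiableOn i j).mono fun w hw => mem_ball_zero_iff.2 hw.2⟩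
  have hH := hR.mat_mul (hR.mat_mul hhe (hloop hχ.1)) (hR.mat_adjugate hhe)
  have hdiff := hR.mat_sub (hR.mat_mul hH (hloop hχ'.1)) (hR.mat_mul (hloop hχ'.1) hH)
  rw [← sub_eq_zero]
  ext i j
  refine eq_zero_of_eq_zero_on_circle hr (hdiff i j).1 (hdiff i j).2 (fun w hw => ?_) hζ hζr
  have := commute_on_circle hr hF hχ hχtr hh hF' hχ' hw
  simp only [this, sub_self, Matrix.zero_apply]

end Frame

/-- The dressing relation provides a square root of the product of the determinants. -/
theorem exists_isTwistedPair {r s : ℝ} (hr : r ≤ 1) (hs : 0 < s) (hsr : s < r) {χ χ' h : ℂ → Mat2}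
    (hχ : IsUnitaryLoopStar χ) (hχ' : IsUnitaryLoopStar χ') (hh : IsPositiveLoop r h)
    (hχd : ∃ ζ : ℂ, ζ ≠ 0 ∧ (traceFree (χ ζ)).det ≠ 0)
    (hχd' : ∃ ζ : ℂ, ζ ≠ 0 ∧ (traceFree (χ' ζ)).det ≠ 0)
    (hcomm : ∀ ζ : ℂ, ζ ≠ 0 → ‖ζ‖ ≤ r →
      h ζ * χ ζ * (h ζ).adjugate * χ' ζ = χ' ζ * (h ζ * χ ζ * (h ζ).adjugate))
    (hmer : ∃ K : ℂ → Mat2, MatMeromorphicOn K (cutPlane χ ∩ annulus s) ∧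
      ∀ ζ ∈ cutPlane χ ∩ annulus s, ‖ζ‖ ≤ r → K ζ = h ζ * χ ζ * (h ζ).adjugate) :
    ∃ ρ : ℂ → ℂ, IsTwistedPair (cutPlane χ ∩ cutPlane χ' ∩ annulus s) s
        (fun ζ => traceFree (χ ζ)) (fun ζ => traceFree (χ' ζ)) ρ ∧
      ∀ ζ ∈ cutPlane χ ∩ cutPlane χ' ∩ annulus s, ‖ζ‖ < r →
        ρ ζ • traceFree (χ' ζ) = (traceFree (χ' ζ)).det •
          (h ζ * traceFree (χ ζ) * (h ζ).adjugate) := by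
  have hD := isSymmetricDomain_cut hχ hχ' hs (hsr.trans_le hr)
  set D := cutPlane χ ∩ cutPlane χ' ∩ annulus s with hDdef
  set A : ℂ → Mat2 := fun ζ => traceFree (χ ζ) with hA
  set B : ℂ → Mat2 := fun ζ => traceFree (χ' ζ) with hB
  set H : ℂ → Mat2 := fun ζ => h ζ * A ζ * (h ζ).adjugate with hH
  have hD0 : D ⊆ {0}ᶜ := hD.ne_zero
  have hR0 := isFunctionRing_analyticOnNhd ({0}ᶜ : Set ℂ)
  have hAa := hR0.mat_traceFree hχ.analyticOnNhd
  have hBa := hR0.mat_traceFree hχ'.analyticOnNhd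
  have hAt : TwistedOn A {0}ᶜ := hχ.twistedOn.traceFree
  have hBt : TwistedOn B {0}ᶜ := hχ'.twistedOn.traceFree
  have hAq : QuatOn A {0}ᶜ := hχ.quatOn.traceFree
  have hBq : QuatOn B {0}ᶜ := hχ'.quatOn.traceFree
  set W : Set ℂ := D ∩ Metric.ball 0 r with hW
  have hWo : IsOpen W := hD.isOpen.inter Metric.isOpen_ball
  have hWD : W ⊆ D := Set.inter_subset_left
  have hWr : ∀ ζ ∈ W, ‖ζ‖ < r := fun ζ hζ => mem_ball_zero_iff.1 hζ.2
  have hdet1 : ∀ ζ ∈ W, (h ζ).det = 1 := fun ζ hζ =>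
    hh.det_eq_one ζ (Metric.ball_subset_closedBall hζ.2)
  -- The identity theorem needs a starting point in `D` with modulus below `r`; a ray that avoids
  -- all cuts provides it.
  have hWne : W.Nonempty := by
    obtain ⟨u, hu, hray⟩ := exists_ray hχ hχ' hs
    obtain ⟨t, ht1, ht2⟩ := exists_between hsr
    have hn : ‖(t : ℂ) * u‖ = t := by
      rw [norm_mul, show ‖u‖ = 1 from hu, mul_one, Complex.norm_real,
        Real.norm_of_nonneg (hs.trans ht1).le]
    have ht3 : t < 1 := ht2.trans_le hr
    refine ⟨t * u, ⟨hray t ht1 ht3.le, ?_⟩, mem_ball_zero_iff.2 (by rw [hn]; exact ht2)⟩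
    rw [annulus, Set.mem_ofPred_eq, hn]
    exact ⟨ht1, ht3.trans ((one_lt_div hs).2 (hsr.trans_le hr))⟩
  obtain ⟨K, hKm, hK⟩ := hmer
  have hKD : MatMeromorphicOn K D := fun i j => (hKm i j).mono_set fun ζ hζ => ⟨hζ.1.1, hζ.2⟩
  have hKH : ∀ ζ ∈ W, traceFree (K ζ) = H ζ := fun ζ hζ => by
    rw [hK ζ ⟨hζ.1.1.1, hζ.1.2⟩ (hWr ζ hζ).le, traceFree_conj (hdet1 ζ hζ)]
  have htrH : ∀ ζ ∈ W, (H ζ).trace = 0 := fun ζ hζ => by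
    rw [← hKH ζ hζ, trace_traceFree]
  have hHB : ∀ ζ ∈ W, H ζ * B ζ = B ζ * H ζ := by
    intro ζ hζ
    have h1 := hcomm ζ (hD0 hζ.1) (hWr ζ hζ).le
    rw [← hKH ζ hζ, hK ζ ⟨hζ.1.1.1, hζ.1.2⟩ (hWr ζ hζ).le]
    simp only [hB, traceFree, mul_sub, sub_mul, Matrix.mul_smul, Matrix.smul_mul, mul_one, one_mul,
      h1]
    rw [smul_comm]
    abel
  -- On `W` the trace free matrices `H` and `B` commute, so `H B` is the scalar `-f` with `f² = det
  -- H det B = det A det B`. Written with `K`, the function `f` is meromorphic on all of `D`.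
  set f : ℂ → ℂ := fun ζ => -(1 / 2) * (traceFree (K ζ) * B ζ).trace with hf
  have hfm : MeromorphicOn f D := by
    have hR := isFunctionRing_meromorphicOn D
    exact hR.mul _ _ (hR.const _) (hR.trace (hR.mat_mul (hR.mat_traceFree hKD)
      fun i j => ((hBa i j).mono hD0).meromorphicOn))
  have hfW : ∀ ζ ∈ W, f ζ = -(1 / 2) * (H ζ * B ζ).trace := fun ζ hζ => by
    rw [hf]; simp only [hKH ζ hζ]
  have hfa : AnalyticOnNhd ℂ f W := by
    have hR := isFunctionRing_analyticOnNhd W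
    have hha : ∀ i j, AnalyticOnNhd ℂ (fun ζ => h ζ i j) W := fun i j =>
      ((Complex.analyticOnNhd_iff_differentiableOn Metric.isOpen_ball).2
        (hh.differentiableOn i j)).mono Set.inter_subset_right
    have h1 := hR.mul _ _ (hR.const (-(1 / 2))) (hR.trace (hR.mat_mul (hR.mat_mul (hR.mat_mul hha
      fun i j => (hAa i j).mono (hWD.trans hD0)) (hR.mat_adjugate hha))
      fun i j => (hBa i j).mono (hWD.trans hD0)))
    exact h1.congr hWo fun ζ hζ => (hfW ζ hζ).symm
  have hHdet : ∀ ζ ∈ W, (H ζ).det = (A ζ).det := fun ζ hζ => det_conj (hdet1 ζ hζ)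
  have htrace := fun ζ (hζ : ζ ∈ W) =>
    trace_mul_sq_of_commute (htrH ζ hζ) (trace_traceFree _) (hHB ζ hζ)
  have hfsq : ∀ ζ ∈ W, f ζ ^ 2 = (A ζ).det * (B ζ).det := fun ζ hζ => by
    rw [hfW ζ hζ, ← hHdet ζ hζ, ← (htrace ζ hζ).2]
    ring
  obtain ⟨ρ, hρ, hρsq, hρf⟩ := exists_analyticOnNhd_of_sq hD.isConnected.isPreconnected hfm
    ((hR0.mul _ _ (hR0.det hAa) (hR0.det hBa)).mono hD0) hWo hWD hWne hfa hfsq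
  have hWneg : ∀ ζ ∈ W, -ζ ∈ W := fun ζ hζ =>
    ⟨hD.neg_mem ζ hζ.1, by simpa using hζ.2⟩
  have hρn : ∀ ζ ∈ D, ρ (-ζ) = ρ ζ := by
    have hht : TwistedOn h W := hh.twisted.mono fun ζ hζ => Metric.ball_subset_closedBall hζ.2
    have hHt : TwistedOn (fun ζ => H ζ * B ζ) W :=
      ((hht.mul (hAt.mono (hWD.trans hD0))).mul hht.adjugate).mul (hBt.mono (hWD.trans hD0))
    obtain ⟨w, hw⟩ := hWne
    refine (hD.analyticOnNhd_neg hρ).eqOn_of_preconnected_of_eventuallyEq hρ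
      hD.isConnected.isPreconnected (hWD hw) ?_
    filter_upwards [hWo.mem_nhds hw] with z hz
    rw [hρf z hz, hρf _ (hWneg z hz), hfW z hz, hfW _ (hWneg z hz), hHt.trace_neg hz]
  -- On the circle `ρ²` is a product of two nonnegative numbers, hence `ρ` is real there.
  have hρr : ∀ ζ ∈ D, reflect ρ ζ = ρ ζ := by
    refine hD.reflect_eq hρ fun ζ hζ => Complex.conj_eq_iff_im.2 (im_eq_zero_of_sq_nonneg ?_)
    rw [hρsq ζ (hD.circle_subset hζ)]
    exact nonneg_mul (hAq.det_nonneg isSymmetricDomain_compl_zero.circle_subset hζ)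
      (hBq.det_nonneg isSymmetricDomain_compl_zero.circle_subset hζ)
  refine ⟨ρ, ⟨hD, hs, Set.inter_subset_right, hAa, hBa, fun ζ => trace_traceFree _,
    fun ζ => trace_traceFree _, hAq, hBq, hAt, hBt, hχd, hχd', hρ, hρsq, hρn, hρr⟩,
    fun ζ hζ hζr => ?_⟩
  have hζW : ζ ∈ W := ⟨hζ, mem_ball_zero_iff.2 hζr⟩
  -- Multiplying `H B = -ρ • 1` by `B` and using `B² = -det B` gives `det B • H = ρ • B`.
  have h1 := congrArg (fun N => N * B ζ) (htrace ζ hζW).1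
  simp only [Matrix.smul_mul, one_mul] at h1
  rw [mul_assoc, sq_of_trace_eq_zero (trace_traceFree (χ' ζ)), mul_neg, Matrix.mul_smul,
    mul_one] at h1
  rw [hρf ζ hζW, hfW ζ hζW,
    show -(1 / 2) * (H ζ * B ζ).trace = -((H ζ * B ζ).trace / 2) by ring, neg_smul]
  exact neg_eq_iff_eq_neg.2 h1.symm

end LoopDressing

end

/-! ### The factorization of the dressing matrix. -/

theorem mainTheorem1
    -- a connected Riemann surface `S` with its universal covering `p : X → S`
    {S : Type*} [TopologicalSpace S] [T2Space S] [ConnectedSpace S]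
    [ChartedSpace ℂ S] [IsManifold 𝓘(ℂ) ω S]
    {X : Type*} [TopologicalSpace X] [T2Space X] [SimplyConnectedSpace X]
    [ChartedSpace ℂ X] [IsManifold 𝓘(ℂ) ω X]
    (p : X → S) (hp : IsCoveringMap p) (hp' : ContMDiff 𝓘(ℂ) 𝓘(ℂ) ω p)
    -- a deck transformation
    (τ : X ≃ₜ X) (hτ : ∀ z, p (τ z) = p z)
    (r s : ℝ) (hr : r ≤ 1) (hs : 0 < s) (hsr : s < r)
    -- a normalized extended unitary frame and its monodromy
    (F : X → ℂ → Mat2) (z₀ : X) (hF : IsNormalizedFrame F z₀)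
    (χ : ℂ → Mat2) (hχ : IsMonodromy r τ F χ)
    (hχtr : ¬ ∃ c : ℂ, ∀ ζ : ℂ, ζ ≠ 0 → (χ ζ).trace = c)
    -- the dressing matrix; `h χ h⁻¹` is meromorphic on the cut annulus
    (h : ℂ → Mat2) (hh : IsPositiveLoop r h)
    (hmer : ∃ K : ℂ → Mat2, MatMeromorphicOn K (cutPlane χ ∩ annulus s) ∧
      ∀ ζ ∈ cutPlane χ ∩ annulus s, ‖ζ‖ ≤ r → K ζ = h ζ * χ ζ * (h ζ)⁻¹)
    -- the dressed frame and its monodromy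
    (F' : X → ℂ → Mat2) (hF' : IsDressedFrame r h F z₀ F')
    (χ' : ℂ → Mat2) (hχ' : IsMonodromy r τ F' χ') :
    IsOpen (cutPlane χ ∩ cutPlane χ' ∩ annulus s) ∧
    IsConnected (cutPlane χ ∩ cutPlane χ' ∩ annulus s) ∧
    circle 1 ⊆ cutPlane χ ∩ cutPlane χ' ∩ annulus s ∧
    ∃ l : ℝ, s < l ∧ l ≤ r ∧
      ∃ M C : ℂ → Mat2,
        IsTwistedSUMeromorphicOn M (cutPlane χ ∩ cutPlane χ' ∩ annulus s) ∧
        (∀ ζ ∈ circle l ∩ cutPlane χ ∩ cutPlane χ', MatAnalyticAt M ζ) ∧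
        (∀ ζ ∈ circle l ∩ cutPlane χ ∩ cutPlane χ', (C ζ).det = 1) ∧
        TwistedOn C (circle l ∩ cutPlane χ ∩ cutPlane χ') ∧
        (∀ ζ ∈ circle l ∩ cutPlane χ ∩ cutPlane χ', Commute (C ζ) (χ ζ)) ∧
        (∀ ζ ∈ circle l ∩ cutPlane χ ∩ cutPlane χ', h ζ = M ζ * C ζ) := by
  have hr0 : 0 < r := hs.trans hsr
  have hD := isSymmetricDomain_cut hχ.1 hχ'.1 hs (hsr.trans_le hr)
  refine ⟨hD.isOpen, hD.isConnected, hD.circle_subset, ?_⟩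
  have hdet1 : ∀ ζ : ℂ, ‖ζ‖ ≤ r → (h ζ).det = 1 := fun ζ hζ =>
    hh.det_eq_one ζ (mem_closedBall_zero_iff.2 hζ)
  have hχd : ∃ ζ : ℂ, ζ ≠ 0 ∧ (traceFree (χ ζ)).det ≠ 0 := by
    by_contra hcon
    push Not at hcon
    -- If the determinant vanished identically, then `(tr χ)² = 4 = 2²`, and the trace would be
    -- constant.
    refine hχtr (hχ.1.trace_const_of_sq one_pos (n := fun _ => 2) diffContOnCl_const
      fun ζ hζ => ?_)
    have hζ0 := ne_zero_of_mem_circle one_pos hζ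
    have h1 := hcon ζ hζ0
    rw [hχ.1.det_traceFree hζ0] at h1
    linear_combination -4 * h1
  obtain ⟨ρ, hpair, hρ⟩ := exists_isTwistedPair hr hs hsr hχ.1 hχ'.1 hh hχd
    (exists_det_traceFree_ne_zero hr0 hF hχ hχtr hh hF' hχ')
    (fun ζ hζ hζr => commute_of_norm_le hr0 hF hχ hχtr hh hF' hχ' hζ hζr) (by
      obtain ⟨K, hKm, hK⟩ := hmer
      refine ⟨K, hKm, fun ζ hζ hζr => ?_⟩
      rw [hK ζ hζ hζr, Matrix.inv_eq_right_inv (mul_adjugate_of_det (hdet1 ζ hζr))])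
  obtain ⟨M, Z, hZ, hM, hMZ⟩ := hpair.exists_conjugator fun w hw hw1 n hn =>
    hχ.1.analyticOrderAt_det_traceFree_ne hw.1.1 hw1 hn
  -- The circle must miss the exceptional points, and `l < r` must be strict, because the relation
  -- between `ρ`, `B` and `h A h⁻¹` is available only inside the open disc.
  obtain ⟨l, hl, hlZ⟩ := (Set.Ioo_infinite hsr).exists_notMem_finite (hZ.image fun ζ => ‖ζ‖)
  have hS : ∀ ζ ∈ circle l ∩ cutPlane χ ∩ cutPlane χ',
      ζ ∈ cutPlane χ ∩ cutPlane χ' ∩ annulus s ∧ ζ ∉ Z ∧ ‖ζ‖ < r := by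
    intro ζ hζ
    have hn : ‖ζ‖ = l := hζ.1.1
    refine ⟨⟨⟨hζ.1.2, hζ.2⟩, ?_⟩, fun hζZ => hlZ ⟨ζ, hζZ, hn⟩, by rw [hn]; exact hl.2⟩
    rw [annulus, Set.mem_ofPred_eq, hn]
    exact ⟨hl.1, (hl.2.trans_le hr).trans ((one_lt_div hs).2 (hsr.trans_le hr))⟩
  refine ⟨l, hl.1, hl.2.le, M, fun ζ => (M ζ).adjugate * h ζ, hM, fun ζ hζ => ?_, fun ζ hζ => ?_,
    ?_, fun ζ hζ => ?_, fun ζ hζ => ?_⟩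
  · obtain ⟨h1, h2, -⟩ := hS ζ hζ
    exact (hMZ ζ h1 h2).1
  · obtain ⟨h1, h2, h3⟩ := hS ζ hζ
    rw [Matrix.det_mul, Matrix.det_adjugate, (hMZ ζ h1 h2).2.1, one_pow, one_mul, hdet1 ζ h3.le]
  · have hMt : TwistedOn M (circle l ∩ cutPlane χ ∩ cutPlane χ') := fun ζ hζ => by
      obtain ⟨h1, h2, -⟩ := hS ζ hζ
      exact (hMZ ζ h1 h2).2.2.1
    exact hMt.adjugate.mul (hh.twisted.mono fun ζ hζ =>
      mem_closedBall_zero_iff.2 (hS ζ hζ).2.2.le)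
  · obtain ⟨h1, h2, h3⟩ := hS ζ hζ
    obtain ⟨-, hMd, -, hB, hMA⟩ := hMZ ζ h1 h2
    have hhd := adjugate_mul_of_det (hdet1 ζ h3.le)
    have hhd' := mul_adjugate_of_det (hdet1 ζ h3.le)
    set t := (χ ζ).trace / 2
    have hχ0 : χ ζ = traceFree (χ ζ) + t • (1 : Mat2) := (traceFree_add_trace _).symm
    set H := h ζ * traceFree (χ ζ) * (h ζ).adjugate with hH
    -- Both `M` and `h` conjugate the trace free part of `χ` to the same matrix `H`, so `M⁻¹ h`
    -- commutes with it.
    have hMH : M ζ * traceFree (χ ζ) = H * M ζ := by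
      rw [← Matrix.smul_mul (ρ ζ), hρ ζ h1 h3, Matrix.smul_mul] at hMA
      exact smul_right_injective _ hB hMA
    have hHh : h ζ * traceFree (χ ζ) = H * h ζ := by
      rw [hH, mul_assoc _ _ (h ζ), hhd, mul_one]
    have hadj : (M ζ).adjugate * H = traceFree (χ ζ) * (M ζ).adjugate := by
      calc (M ζ).adjugate * H = (M ζ).adjugate * (H * M ζ) * (M ζ).adjugate := by
            rw [mul_assoc, mul_assoc, mul_adjugate_of_det hMd, mul_one]
        _ = _ := by rw [← hMH, ← mul_assoc, adjugate_mul_of_det hMd, one_mul]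
    change (M ζ).adjugate * h ζ * χ ζ = χ ζ * ((M ζ).adjugate * h ζ)
    rw [hχ0, mul_add, add_mul, mul_assoc, hHh, ← mul_assoc, hadj, Matrix.mul_smul, mul_one,
      Matrix.smul_mul, one_mul, mul_assoc]
  · obtain ⟨h1, h2, -⟩ := hS ζ hζ
    rw [← mul_assoc, mul_adjugate_of_det (hMZ ζ h1 h2).2.1, one_mul]
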